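/- \textbf{Setting.} Let $G$ be a finite undirected loopless multigraph with $n\ge 1$ vertices, all of positive degree; $d_j$ is the degree of $j$, $m=\sum_j d_j$ (twice the number of edges), $\Delta=\max_j d_j$. The value of a cut $(L,R)$ is the fraction of edges it cuts, and $\mathrm{maxcut}(G)$ is the largest value of a cut. For disjoint vertex sets $A,B$ let $\mathrm{good}(A,B)$ be the number of edges between $A$ and $B$, $\mathrm{cross}(A,B)$ the number of edges with exactly one end in $A\cup B$, $\mathrm{inc}(A,B)$ the number of edges with at least one end in $A\cup B$, and $\mathrm{cut}(A,B)=\mathrm{good}(A,B)+\mathrm{cross}(A,B)/2$. Let $s_1(\sigma)=\frac{-1+\sqrt{4\sigma^2-8\sigma+5}}{2(1-\sigma)}$ and $s_2(\sigma)=\frac1{1+2\sqrt{\sigma(1-\sigma)}}$, let $\sigma_0=0.22815\ldots$ be the point of $(0,1/3)$ with $s_1=s_2$, and put $\mathcal S(\sigma)=\frac12$ for $\sigma>\frac13$, $\mathcal S=s_1$ for $\sigma_0<\sigma\le\frac13$, $\mathcal S=s_2$ for $\sigma\le\sigma_0$. For $\mu>0$ and $\theta\in[0,1)$ let $\sigma^{(\theta)}(\varepsilon,\mu)=1-(1-\theta)\max(1-\varepsilon,0)^{1+1/\mu}$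 and let $\sigma(\varepsilon,\mu)=1-\max(1-\varepsilon,0)^{1+1/\mu}$ be this function for $\theta=0$. Let $z^*$ be the largest $z>0$ with $\mathcal S(\sigma(\varepsilon/z,\mu))=\frac12$ ($z^*=0$ if $\varepsilon=0$), and $$H(\varepsilon,\mu)=\frac{z^*}2+\int_{z^*}^1\mathcal S(\sigma(\varepsilon/z,\mu))\,dz .$$ \textbf{Algorithm} $\mathrm{Simple}'(G,\mu)$, with constants $\delta,\gamma,\theta\in(0,1)$ and $\kappa,\tau,a,b>0$. Throughout, $m$ and $\Delta$ refer to the input graph. \emph{Threshold}$(i,t)$, on a graph $G'$ with vertex degrees $d'_j$ and parameters $\varepsilon,\alpha$: perform $w=\lceil\kappa\ln(m)\max(\alpha,t)/t^2\rceil$ lazy random walks (holding probability $\frac12$, otherwise move along a uniformly random edge) from $i$, of length $\lceil\mu\ln(4m/\delta^2)/(2(\delta-\ln(1-\varepsilon)))\rceil$. A walk is even or odd according to its number of moves. For each $j\notin Even\cup Odd$ let $q(j)$ be the number of even walks minus the number of odd walks that end at $j$, divided by $d'_jw$; put $j$ in $Even$ if $q(j)>t$ and in $Odd$ if $q(j)<-t$.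 \emph{Find}$(i)$: start with $Even=Odd=\emptyset$. For $r=0,1,\dots$, as long as $t_r=(1-\gamma)^r\ge\gamma/m^{1+\mu/2}$, run Threshold$(i,t_r)$, and stop with output $(Even,Odd)$ if $\mathrm{cut}(Even,Odd)\ge\mathcal S(\sigma^{(\theta)}(\varepsilon,\mu))\,\mathrm{inc}(Even,Odd)$ and $|Even\cup Odd|\ge\tau/(\Delta t_r^2m^{1+\mu}\ln m)$. If no round stops, output FAIL. \emph{Simple}$(G',\varepsilon,\mu,\alpha)$: if $\mathcal S(\sigma^{(\theta)}(\varepsilon,\mu))=\frac12$ or $G'$ has no edges, put each vertex of $G'$ in $L$ or $R$ uniformly at random and return. Otherwise choose $\lceil a\ln m\rceil$ independent random vertices of $G'$ with probabilities proportional to their degrees in $G'$, and run Find from all of them in parallel until one succeeds or all fail. If all fail, output FAIL. Otherwise put $Even$ in $L$ and $Odd$ in $R$, or the opposite, with probability $\frac12$ each; let $\xi$ be the fraction of the edges of $G'$ that have no end in $Even\cup Odd$; recurse on the subgraph induced on the other vertices with parameter $\varepsilon/\xi$, and output FAIL if the recursive call does. If the top-level call fails, put all vertices of $G$ in $L$ or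 $R$ uniformly at random. \emph{Simple}$'(G,\mu)$: for each $r\ge0$ with $(1-\gamma)^r\ge\frac12$, run Simple$(G,1-(1-\gamma)^r,\mu,1)$ independently $\lceil b\ln m\rceil$ times; output the best of all the cuts found. \textbf{Statement.} Let $\mu>0$. The minimum $h(\mu)=\min_{0\le\varepsilon\le1/2}\frac{H(\varepsilon,\mu)}{1-\varepsilon}$ exists. For every $\eta>0$ and every $p$ there are constants $\delta,\gamma,\theta,\kappa,\tau,a,b$ and $C,k$, depending only on $\mu,\eta,p$, such that for every $G$ as above, with $\mathrm{maxcut}(G)=1-\varepsilon$: (i) with probability at least $1-n^{-p}$, $\mathrm{Simple}'(G,\mu)$ outputs a cut whose value is at least $H(\varepsilon,\mu)-\eta$ and at least $(h(\mu)-\eta)\,\mathrm{maxcut}(G)$; (ii) the number of elementary steps (random draws, arithmetic operations, comparisons, array accesses, each at unit cost) performed by $\mathrm{Simple}'(G,\mu)$ is always at most $C\,\Delta\,m^{2+\mu}(1+\ln m)^k$, that is, $\tilde O(\Delta m^{2+\mu})$. -/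

import Mathlib

open scoped ENNReal

noncomputable section

namespace MaxCut

/-! ## Randomized computations with a step counter -/

/-- A randomized computation: the joint law of its result and of the number of elementary steps
it has performed. Unit cost is charged for a random draw, an arithmetic operation, a comparison,
or an access to an array cell. -/
def Comp (α : Type) : Type := PMF (α × ℕ)

namespace Comp

/-- The law of result and step count. -/
def law {α : Type} (x : Comp α) : PMF (α × ℕ) := x

instance : Monad Comp where
  pure a := PMF.pure (a, 0)
  bind x f := PMF.bind x fun p => PMF.bind (f p.1) fun q => PMF.pure (q.1, p.2 + q.2)

/-- Spend `k` steps. -/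
def tick (k : ℕ) : Comp Unit := PMF.pure ((), k)

/-- One random draw, at the cost of one step. -/
def sample {α : Type} (p : PMF α) : Comp α := PMF.bind p fun a => PMF.pure (a, 1)

/-- `k` independent draws from the same law. -/
def samples {α : Type} (p : PMF α) : ℕ → Comp (List α)
  | 0 => pure []
  | k + 1 => do
    let a ← sample p
    let l ← samples p k
    pure (a :: l)

/-- The probability that the result lies in `s`. -/
def prob {α : Type} (x : Comp α) (s : Set α) : ℝ :=
  (x.law.toOuterMeasure {y | y.1 ∈ s}).toReal

/-- The product law of a list of laws. -/
def jointLaw {β : Type} : List (PMF β) → PMF (List β)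
  | [] => PMF.pure []
  | p :: ps => PMF.bind p fun x => PMF.bind (jointLaw ps) fun xs => PMF.pure (x :: xs)

/-- What a round-robin execution does with processes whose (private) outcomes and step counts are
listed in `l`: it stops as soon as one of them has finished with a result, and otherwise when all of
them have finished without one. By the time `T` at which it stops, a process that needs `c` steps
has performed `min c T` of them; the scheduler spends one extra step on each of these, and one
for each process at the start. -/
def roundRobin {α : Type} (l : List (Option α × ℕ)) : Option α × ℕ :=
  match (l.filter fun x => x.1.isSome).argmin Prod.snd with
  | none => (none, 2 * (l.map Prod.snd).sum + l.length)
  | some x => (x.1, 2 * (l.map fun y => min y.2 x.2).sum + l.length)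

/-- Run independent computations in parallel, until one of them succeeds or all have failed. -/
def parallel {α : Type} (l : List (Comp (Option α))) : Comp (Option α) :=
  (jointLaw (l.map law)).map roundRobin

end Comp

open MaxCut.Comp

/-! ## Multigraphs and cuts -/

/-- Undirected loopless multigraphs: `mult i j` is the number of edges between `i` and `j`. -/
structure MultiGraph (V : Type) where
  mult : V → V → ℕ
  symm : ∀ i j, mult i j = mult j i
  loopless : ∀ i, mult i i = 0

namespace MultiGraph

variable {V : Type} [Fintype V] [DecidableEq V] (G : MultiGraph V)

/-- The degree of a vertex, counted with multiplicity. -/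
def deg (j : V) : ℕ := ∑ k, G.mult j k

/-- The sum `m` of all degrees, which is twice the number of edges. -/
def vol : ℕ := ∑ j, G.deg j

/-- The maximum degree `Δ`. -/
def maxDeg : ℕ := Finset.univ.sup G.deg

/-- The number of pairs (vertex of `A`, incident edge whose other end is in `B`); for disjoint
`A` and `B` this is the number of edges between them. -/
def between (A B : Finset V) : ℕ := ∑ i ∈ A, ∑ j ∈ B, G.mult i j

/-- The number of edges between `A` and `B`, for disjoint sets. -/
def good (A B : Finset V) : ℝ := G.between A B

/-- The number of edges with exactly one end in `A ∪ B`. -/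
def cross (A B : Finset V) : ℝ := G.between (A ∪ B) (A ∪ B)ᶜ

/-- The number of edges with at least one end in `A ∪ B`. -/
def inc (A B : Finset V) : ℝ := (G.between (A ∪ B) (A ∪ B) : ℝ) / 2 + G.cross A B

/-- `cut(A, B) = good(A, B) + cross(A, B) / 2`. -/
def cut (A B : Finset V) : ℝ := G.good A B + G.cross A B / 2

/-- The value of the cut `(L, V ∖ L)`: the fraction of all edges that it cuts. -/
def cutValue (L : Finset V) : ℝ := (G.between L Lᶜ : ℝ) / ((G.vol : ℝ) / 2)

/-- The largest value of a cut. -/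
def maxcut : ℝ := ⨆ L : Finset V, G.cutValue L

/-- The subgraph induced on `U`. The vertex type is kept: vertices outside `U` become isolated. -/
def induce (U : Finset V) : MultiGraph V where
  mult i j := if i ∈ U ∧ j ∈ U then G.mult i j else 0
  symm i j := by simp only [and_comm (a := i ∈ U), G.symm i j]
  loopless i := by simp [G.loopless]

end MultiGraph

/-! ## The performance functions -/

/-- Expression for `𝒮(σ)` when `σ` lies between `σ₀` and `1 / 3`. -/
def sotoMid (s : ℝ) : ℝ := (-1 + √(4 * s ^ 2 - 8 * s + 5)) / (2 * (1 - s))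

/-- Expression for `𝒮(σ)` when `σ` is at most `σ₀`. -/
def sotoLow (s : ℝ) : ℝ := 1 / (1 + 2 * √(s * (1 - s)))

/-- The constant `σ₀ = 0.22815…`, the point of `(0, 1/3)` where the two expressions agree. -/
def sigmaZero : ℝ := sInf {s : ℝ | 0 < s ∧ s < 1 / 3 ∧ sotoMid s = sotoLow s}

/-- The function `𝒮(σ)`. -/
def soto (s : ℝ) : ℝ :=
  if 1 / 3 < s then 1 / 2 else if sigmaZero < s then sotoMid s else sotoLow s

/-- `σ(ε, μ) = 1 - (1 - θ) (1 - ε) ^ (1 + 1 / μ)`, where the constant `θ` is the error term, and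
`1 - ε` is replaced by `0` when `ε > 1`. -/
def sigma (θ ε μ : ℝ) : ℝ := 1 - (1 - θ) * (max (1 - ε) 0) ^ (1 + 1 / μ)

/-- `z*`: the largest `z > 0` with `𝒮(σ(ε / z, μ)) = 1 / 2` (error term `0`). For `ε = 0` there is
no such `z`, and the value is `0`. -/
def zStar (ε μ : ℝ) : ℝ := sSup {z : ℝ | 0 < z ∧ soto (sigma 0 (ε / z) μ) = 1 / 2}

/-- `H(ε, μ) = z* / 2 + ∫_{z*}^1 𝒮(σ(ε / z, μ)) dz`. -/
def H (ε μ : ℝ) : ℝ := zStar ε μ / 2 + ∫ z in (zStar ε μ)..1, soto (sigma 0 (ε / z) μ)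

/-- The approximation ratio `min_ε H(ε, μ) / (1 - ε)`. A maximum cut has value at least `1 / 2`,
so that `ε` ranges over `[0, 1/2]`. -/
def ratio (μ : ℝ) : ℝ := sInf ((fun ε => H ε μ / (1 - ε)) '' Set.Icc 0 (1 / 2))

/-! ## The algorithm -/

/-- The constants of the algorithm, which do not depend on the input graph. -/
structure Consts where
  /-- controls the length of the random walks -/
  δ : ℝ
  /-- the step of the geometric searches -/
  γ : ℝ
  /-- the error term in `σ` -/
  θ : ℝ
  /-- the constant in the number of walks -/
  κ : ℝ
  /-- the constant in the test on the number of classified vertices -/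
  τ : ℝ
  /-- the constant in the number of starting vertices -/
  a : ℝ
  /-- the constant in the number of repetitions -/
  b : ℝ
  δ_mem : δ ∈ Set.Ioo (0 : ℝ) 1
  γ_mem : γ ∈ Set.Ioo (0 : ℝ) 1
  θ_mem : θ ∈ Set.Ioo (0 : ℝ) 1
  κ_pos : 0 < κ
  τ_pos : 0 < τ
  a_pos : 0 < a
  b_pos : 0 < b

section Algorithm

variable {V : Type} [Fintype V] [DecidableEq V]

/-- The law on `V` proportional to `f`. -/
def proportional (f : V → ℕ) (h : ∑ v, f v ≠ 0) : PMF V :=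
  PMF.normalize (fun v => (f v : ℝ≥0∞))
    (by rw [tsum_fintype, ← Nat.cast_sum]; exact Nat.cast_ne_zero.mpr h)
    (by rw [tsum_fintype, ← Nat.cast_sum]; exact ENNReal.natCast_ne_top _)

/-- A uniformly random edge at `j` is chosen; the result is its other end. -/
def neighbour (G : MultiGraph V) (j : V) : PMF V :=
  if h : ∑ k, G.mult j k ≠ 0 then proportional (G.mult j) h else PMF.pure j

/-- `ℓ` steps of the lazy random walk with holding probability `1 / 2`. The state is the current
vertex and the parity of the number of hops (`true` for odd). -/
def walk (G : MultiGraph V) : ℕ → V × Bool → Comp (V × Bool)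
  | 0, s => pure s
  | l + 1, s => do
    tick 1
    let stay ← sample (PMF.uniformOfFintype Bool)
    if stay then walk G l s
    else do
      let k ← sample (neighbour G s.1)
      walk G l (k, !s.2)

/-- Perform walks of length `ℓ` from `i`, and add to the tally of each vertex the number of even
walks minus the number of odd walks that end there. -/
def tallyWalks (G : MultiGraph V) (i : V) (l : ℕ) : ℕ → (V → ℤ) → Comp (V → ℤ)
  | 0, f => pure f
  | w + 1, f => do
    let s ← walk G l (i, false)
    tick 1
    tallyWalks G i l w (Function.update f s.1 (f s.1 + if s.2 then -1 else 1))

/-- The length `ℓ` of the walks. Here and below, `m` is the degree sum of the input graph of the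
whole algorithm. -/
def walkLength (c : Consts) (μ : ℝ) (m : ℕ) (ε : ℝ) : ℕ :=
  ⌈μ * Real.log (4 * m / c.δ ^ 2) / (2 * (c.δ - Real.log (1 - ε)))⌉₊

/-- The number `w(t)` of walks. -/
def numWalks (c : Consts) (m : ℕ) (α t : ℝ) : ℕ :=
  ⌈c.κ * Real.log m * max α t / t ^ 2⌉₊

/-- The procedure Threshold, on the graph `G`, starting vertex `i`, and threshold `t`. The pair
`S` holds the current sets `Even` and `Odd`. -/
def threshold (c : Consts) (μ : ℝ) (m : ℕ) (G : MultiGraph V) (ε α : ℝ) (i : V) (t : ℝ)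
    (S : Finset V × Finset V) : Comp (Finset V × Finset V) := do
  let w := numWalks c m α t
  tick (Fintype.card V + 1)
  let f ← tallyWalks G i (walkLength c μ m ε) w 0
  tick (Fintype.card V)
  let q : V → ℝ := fun j => (f j : ℝ) / ((G.deg j : ℝ) * w)
  pure (S.1 ∪ Finset.univ.filter (fun j => j ∉ S.1 ∪ S.2 ∧ t < q j),
    S.2 ∪ Finset.univ.filter (fun j => j ∉ S.1 ∪ S.2 ∧ q j < -t))

/-- The rounds `r` of Find, over a list of values of `r`. After each call of Threshold, the
quantities in the test are computed by a scan of all vertices and adjacency lists. `Δ` is the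
maximum degree of the input graph of the whole algorithm. -/
def findRounds (c : Consts) (μ : ℝ) (m Δ : ℕ) (G : MultiGraph V) (ε α : ℝ) (i : V) :
    List ℕ → Finset V × Finset V → Comp (Option (Finset V × Finset V))
  | [], _ => pure none
  | r :: rs, S => do
    let t := (1 - c.γ) ^ r
    let S' ← threshold c μ m G ε α i t S
    tick (Fintype.card V + G.vol + 1)
    if soto (sigma c.θ ε μ) * G.inc S'.1 S'.2 ≤ G.cut S'.1 S'.2 ∧
        c.τ / (Δ * t ^ 2 * (m : ℝ) ^ (1 + μ) * Real.log m) ≤ ((S'.1 ∪ S'.2).card : ℝ)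
    then pure (some S')
    else findRounds c μ m Δ G ε α i rs S'

/-- The number of `r ≥ 0` with `(1 - γ) ^ r ≥ γ / m ^ (1 + μ / 2)`. -/
def numRounds (c : Consts) (μ : ℝ) (m : ℕ) : ℕ :=
  ⌊Real.log (c.γ / (m : ℝ) ^ (1 + μ / 2)) / Real.log (1 - c.γ)⌋₊ + 1

/-- The procedure Find; the result `none` stands for FAIL. -/
def find (c : Consts) (μ : ℝ) (m Δ : ℕ) (G : MultiGraph V) (ε α : ℝ) (i : V) :
    Comp (Option (Finset V × Finset V)) :=
  findRounds c μ m Δ G ε α i (List.range (numRounds c μ m)) (∅, ∅)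

/-- Put each vertex of `U` independently on either side with probability `1 / 2`; the result is
the set of the vertices put in `L`. -/
def randomSide (U : Finset V) : Comp (Finset V) := do
  tick U.card
  sample (PMF.uniformOfFinset U.powerset (Finset.powerset_nonempty U))

/-- The recursive procedure Simple on the subgraph of the input graph `G₀` that is induced on
the set `U` of unclassified vertices. It returns the part of `L` in `U`, or `none` for FAIL. The
first argument bounds the depth of the recursion. As each successful call of Find classifies a
vertex, the depth `|V| + 1` is never exceeded. Building the adjacency lists of the induced subgraph
and computing `ξ` are charged as scans of the input graph. -/
def simpleRec (c : Consts) (μ : ℝ) (G₀ : MultiGraph V) (α : ℝ) :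
    ℕ → Finset V → ℝ → Comp (Option (Finset V))
  | 0, _, _ => pure none
  | d + 1, U, ε => do
    tick (Fintype.card V + G₀.vol + 1)
    let G := G₀.induce U
    if h : soto (sigma c.θ ε μ) = 1 / 2 ∨ ∑ j, G.deg j = 0 then
      let L ← randomSide U
      pure (some L)
    else do
      let starts ← samples (proportional G.deg (not_or.mp h).2) ⌈c.a * Real.log G₀.vol⌉₊
      let out ← parallel (starts.map fun i => find c μ G₀.vol G₀.maxDeg G ε α i)
      match out with
      | none => pure none
      | some S => do
        let coin ← sample (PMF.uniformOfFintype Bool)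
        tick (Fintype.card V + G₀.vol + 1)
        let ξ := 1 - G.inc S.1 S.2 / ((G.vol : ℝ) / 2)
        let rest ← simpleRec c μ G₀ α d (U \ (S.1 ∪ S.2)) (ε / ξ)
        match rest with
        | none => pure none
        | some L => pure (some (L ∪ if coin then S.1 else S.2))

/-- The procedure Simple on an input graph: a random cut is output if the recursion fails. -/
def simple (c : Consts) (μ : ℝ) (G : MultiGraph V) (ε α : ℝ) : Comp (Finset V) := do
  let out ← simpleRec c μ G α (Fintype.card V + 1) Finset.univ ε
  match out with
  | none => randomSide Finset.univ
  | some L => pure L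

/-- Run algorithms one after the other and keep the best of the cuts found. -/
def bestCut (G : MultiGraph V) : List (Comp (Finset V)) → Finset V → Comp (Finset V)
  | [], best => pure best
  | x :: xs, best => do
    let L ← x
    tick (Fintype.card V + G.vol + 1)
    bestCut G xs (if G.cutValue best < G.cutValue L then L else best)

/-- The number of `r ≥ 0` with `(1 - γ) ^ r ≥ 1 / 2`. -/
def gridSize (c : Consts) : ℕ := ⌊Real.log (1 / 2) / Real.log (1 - c.γ)⌋₊ + 1

/-- The algorithm Simple′: for each `ε_r ≥ 0` with `1 - ε_r = (1 - γ) ^ r ≥ 1 / 2`, it runs Simple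
with parameters `ε_r`, `μ`, `α = 1`, repeats each run `⌈b log m⌉` times, and outputs the best
cut. -/
def simple' (c : Consts) (μ : ℝ) (G : MultiGraph V) : Comp (Finset V) :=
  bestCut G ((List.range (gridSize c)).flatMap fun r =>
    List.replicate ⌈c.b * Real.log G.vol⌉₊ (simple c μ G (1 - (1 - c.γ) ^ r) 1)) ∅

end Algorithm

end MaxCut

end

/-! Let N = (1 - D^(-1/2) M D^(-1/2)) / 2 be the operator of the lazy walk in which every hop
carries a sign; its eigenvalues lie in [0, 1]. A cut that misses a fraction ε of the edges gives a
vector with Rayleigh quotient at least 1 - ε. So, measured by degree, a constant fraction of the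
vertices i have an entry (N^(2l))_ii not much below (1 - ε)^(2l) d_i / m (`exists_good_starts`). By
convexity, N^l e_i then has Rayleigh quotient at least the 2l-th root of that entry
(`lazyOp_rayleigh`). The prescribed walk length l makes this root nearly (1 - ε)^(1 + 1/μ), while
the degree-normalized squared norm stays above a constant times m^-(1+μ) (`walkLength_spec`).

The tallies of Threshold estimate this vector. They are sums of independent unit vectors, so the
squared deviation, summed over all vertices, is at most the number of walks in expectation
(`ev_tallyWalks`). An inequality for a single edge (`exists_edge_inequality`), summed over the
nested threshold sets (`sweep_sum`), shows that a vector with Rayleigh quotient above 1 - σ has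
threshold cuts whose weighted total excess over 𝒮(σ) inc is at least a constant times its energy
surplus. There are only O(log m) rounds, and a small classified set can carry only little excess.
Hence, if all rounds are accurate, one of them passes both tests of Find (`exists_round_passes`,
`ev_find_none`).

In the recursion, ε times the number of remaining edges is constant. Each success removes a set that
cuts, on average over the coin, at least a fraction 𝒮(σ(ε)) of its incident edges. Since 𝒮(σ(ε / z))
increases with z, these gains dominate the integral H, which yields the expected number of uncut
edges (`perf_sub_le`, `ev_simpleRec`). Uniform continuity absorbs θ and the step of the grid
(`exists_perf_approx`). Markov's inequality and repetition turn the expectation into high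
probability (`prob_simple'_ge`).

For the running time, a search that succeeds with threshold t costs about 1/t² up to logarithms, and
the size test bounds 1/t² by Δ m^(1+μ) ln m times the number of classified vertices. Each vertex is
thus charged Δ m^(1+μ) once, and the single possible failing search costs at most m^(2+μ), up to
logarithms (`parallel_find_cost`, `simpleRec_cost`). -/

set_option linter.unusedSectionVars false

noncomputable section

namespace MaxCut

section


/-! ## Expectations of randomized computations -/

/-- The expectation of a nonnegative function under a law. -/
def pev {β : Type} (p : PMF β) (g : β → ℝ≥0∞) : ℝ≥0∞ := ∑' b, p b * g b

section pev

variable {β γ : Type}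

theorem pev_pure (b : β) (g : β → ℝ≥0∞) : pev (PMF.pure b) g = g b := by
  unfold pev
  rw [tsum_eq_single b]
  · simp
  · intro c hc
    simp [PMF.pure_apply, hc]

theorem pev_bind (p : PMF β) (f : β → PMF γ) (g : γ → ℝ≥0∞) :
    pev (p.bind f) g = pev p fun b => pev (f b) g := by
  unfold pev
  simp_rw [PMF.bind_apply, ← ENNReal.tsum_mul_right, ← ENNReal.tsum_mul_left]
  rw [ENNReal.tsum_comm]
  simp_rw [mul_assoc]

theorem pev_map (p : PMF β) (f : β → γ) (g : γ → ℝ≥0∞) :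
    pev (p.map f) g = pev p fun b => g (f b) := by
  unfold PMF.map
  rw [pev_bind]
  simp [pev_pure]

theorem pev_mono {p : PMF β} {g h : β → ℝ≥0∞} (H : ∀ b ∈ p.support, g b ≤ h b) :
    pev p g ≤ pev p h := by
  refine ENNReal.tsum_le_tsum fun b => ?_
  by_cases hb : b ∈ p.support
  · exact mul_le_mul_right (H b hb) _
  · rw [PMF.mem_support_iff, not_not] at hb
    simp [hb]

theorem pev_const (p : PMF β) (a : ℝ≥0∞) : pev p (fun _ => a) = a := by
  unfold pev
  rw [ENNReal.tsum_mul_right, p.tsum_coe, one_mul]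

theorem pev_add (p : PMF β) (g h : β → ℝ≥0∞) :
    pev p (fun b => g b + h b) = pev p g + pev p h := by
  unfold pev
  simp_rw [mul_add]
  rw [ENNReal.tsum_add]

theorem pev_mul_left (p : PMF β) (a : ℝ≥0∞) (g : β → ℝ≥0∞) :
    pev p (fun b => a * g b) = a * pev p g := by
  unfold pev
  rw [← ENNReal.tsum_mul_left]
  simp_rw [mul_left_comm]

theorem pev_mul_right (p : PMF β) (a : ℝ≥0∞) (g : β → ℝ≥0∞) :
    pev p (fun b => g b * a) = pev p g * a := by
  simp_rw [mul_comm _ a]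
  exact pev_mul_left p a g

theorem pev_fintype [Fintype β] (p : PMF β) (g : β → ℝ≥0∞) : pev p g = ∑ b, p b * g b :=
  tsum_fintype _

end pev

namespace Comp

variable {α β : Type}

/-- The expectation of a nonnegative function of the result of a randomized computation. -/
def ev (x : Comp α) (φ : α → ℝ≥0∞) : ℝ≥0∞ := pev x.law fun y => φ y.1

theorem ev_pure (a : α) (φ : α → ℝ≥0∞) : ev (pure a : Comp α) φ = φ a :=
  pev_pure (a, 0) _

theorem ev_bind (x : Comp α) (f : α → Comp β) (φ : β → ℝ≥0∞) :
    ev (x >>= f) φ = ev x fun a => ev (f a) φ := by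
  change pev (PMF.bind x.law fun p => PMF.bind (f p.1).law fun q =>
    PMF.pure (q.1, p.2 + q.2)) _ = _
  rw [pev_bind]
  simp_rw [pev_bind, pev_pure]
  rfl

theorem ev_tick (k : ℕ) (φ : Unit → ℝ≥0∞) : ev (tick k) φ = φ () :=
  pev_pure _ _

theorem ev_sample (p : PMF α) (φ : α → ℝ≥0∞) : ev (sample p) φ = pev p φ := by
  change pev (PMF.bind p fun a => PMF.pure (a, 1)) _ = _
  rw [pev_bind]
  simp_rw [pev_pure]

theorem ev_mono {x : Comp α} {φ ψ : α → ℝ≥0∞} (h : ∀ y ∈ x.law.support, φ y.1 ≤ ψ y.1) :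
    ev x φ ≤ ev x ψ := pev_mono h

theorem ev_mono' {x : Comp α} {φ ψ : α → ℝ≥0∞} (h : ∀ a, φ a ≤ ψ a) :
    ev x φ ≤ ev x ψ := pev_mono fun y _ => h y.1

theorem ev_const (x : Comp α) (a : ℝ≥0∞) : ev x (fun _ => a) = a := pev_const _ _

theorem ev_add (x : Comp α) (φ ψ : α → ℝ≥0∞) :
    ev x (fun a => φ a + ψ a) = ev x φ + ev x ψ := pev_add _ _ _

theorem ev_mul_left (x : Comp α) (c : ℝ≥0∞) (φ : α → ℝ≥0∞) :
    ev x (fun a => c * φ a) = c * ev x φ := pev_mul_left _ _ _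

theorem ev_mul_right (x : Comp α) (c : ℝ≥0∞) (φ : α → ℝ≥0∞) :
    ev x (fun a => φ a * c) = ev x φ * c := pev_mul_right _ _ _

theorem ev_le_of_forall {x : Comp α} {φ : α → ℝ≥0∞} {c : ℝ≥0∞}
    (h : ∀ y ∈ x.law.support, φ y.1 ≤ c) : ev x φ ≤ c :=
  (ev_mono (ψ := fun _ => c) h).trans (ev_const x c).le

/-- The probability of an event as an expectation. -/
theorem prob_eq (x : Comp α) (s : Set α) :
    x.prob s = (ev x (s.indicator fun _ => 1)).toReal := by
  unfold prob ev pev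
  rw [PMF.toOuterMeasure_apply]
  congr 1
  refine tsum_congr fun y => ?_
  by_cases h : y.1 ∈ s <;> simp [Set.indicator, h]

theorem prob_compl (x : Comp α) (s : Set α) :
    x.prob s = 1 - (ev x (sᶜ.indicator fun _ => 1)).toReal := by
  have h : ev x (s.indicator fun _ => 1) + ev x (sᶜ.indicator fun _ => 1) = 1 := by
    rw [← ev_add]
    refine Eq.trans ?_ (ev_const x 1)
    congr 1
    funext a
    by_cases h : a ∈ s <;> simp [h]
  have hle : ∀ u : Set α, ev x (u.indicator fun _ => 1) ≠ ∞ := fun u =>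
    ne_top_of_le_ne_top ENNReal.one_ne_top <|
      ev_le_of_forall fun y _ => Set.indicator_le_self' (fun _ _ => zero_le_one) y.1
  rw [prob_eq, eq_sub_iff_add_eq, ← ENNReal.toReal_add (hle _) (hle _), h, ENNReal.toReal_one]

/-- Markov's inequality. -/
theorem ev_indicator_mul_le (x : Comp α) (φ : α → ℝ≥0∞) (c : ℝ≥0∞) (s : Set α)
    (h : ∀ a ∈ s, c ≤ φ a) : c * ev x (s.indicator fun _ => 1) ≤ ev x φ := by
  rw [← ev_mul_left]
  refine ev_mono' fun a => ?_
  by_cases ha : a ∈ s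
  · simpa [ha] using h a ha
  · simp [ha]

/-! ### Supports -/

theorem mem_support_pure {a : α} {y : α × ℕ} :
    y ∈ (pure a : Comp α).law.support ↔ y = (a, 0) := by
  change y ∈ (PMF.pure (a, 0)).support ↔ _
  simp

theorem mem_support_tick {k : ℕ} {y : Unit × ℕ} :
    y ∈ (tick k).law.support ↔ y = ((), k) := by
  change y ∈ (PMF.pure ((), k)).support ↔ _
  simp

theorem mem_support_bind {x : Comp α} {f : α → Comp β} {y : β × ℕ} :
    y ∈ (x >>= f).law.support ↔
      ∃ p ∈ x.law.support, ∃ q ∈ (f p.1).law.support, y = (q.1, p.2 + q.2) := by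
  change y ∈ (PMF.bind x.law fun p => PMF.bind (f p.1).law fun q =>
    PMF.pure (q.1, p.2 + q.2)).support ↔ _
  simp only [PMF.mem_support_bind_iff, PMF.mem_support_pure_iff]

theorem mem_support_sample {p : PMF α} {y : α × ℕ} :
    y ∈ (sample p).law.support ↔ ∃ a ∈ p.support, y = (a, 1) := by
  change y ∈ (PMF.bind p fun a => PMF.pure (a, 1)).support ↔ _
  simp only [PMF.mem_support_bind_iff, PMF.mem_support_pure_iff]

theorem mem_support_samples {p : PMF α} (k : ℕ) {y : List α × ℕ} :
    y ∈ (samples p k).law.support → y.1.length = k ∧ y.2 = k ∧ ∀ a ∈ y.1, a ∈ p.support := by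
  induction k generalizing y with
  | zero =>
    intro h
    rw [samples, mem_support_pure] at h
    simp [h]
  | succ k ih =>
    intro h
    rw [samples, mem_support_bind] at h
    obtain ⟨a, ha, z, hz, rfl⟩ := h
    rw [mem_support_sample] at ha
    obtain ⟨a, ha, rfl⟩ := ha
    rw [mem_support_bind] at hz
    obtain ⟨l, hl, w, hw, rfl⟩ := hz
    rw [mem_support_pure] at hw
    subst hw
    obtain ⟨h1, h2, h3⟩ := ih hl
    simp only [List.length_cons, h1, h2, List.mem_cons, forall_eq_or_imp, true_and]
    exact ⟨by omega, ha, h3⟩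

/-! ### Repeated draws and parallel execution -/

/-- Independence of the draws. It is applied with `ψ` a bound for the probability that Find fails
from a given start. -/
theorem ev_samples_prod (p : PMF α) (ψ : α → ℝ≥0∞) (k : ℕ) :
    ev (samples p k) (fun l => (l.map ψ).prod) = pev p ψ ^ k := by
  induction k with
  | zero => simp [samples, ev_pure]
  | succ k ih =>
    rw [samples, ev_bind, ev_sample]
    simp_rw [ev_bind, ev_pure, List.map_cons, List.prod_cons, ev_mul_left, ih]
    rw [pev_mul_right, pow_succ, mul_comm]

theorem mem_support_jointLaw (ps : List (PMF β)) {xs : List β} :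
    xs ∈ (jointLaw ps).support → List.Forall₂ (fun p x => x ∈ p.support) ps xs := by
  induction ps generalizing xs with
  | nil =>
    intro h
    rw [jointLaw, PMF.mem_support_pure_iff] at h
    simp [h]
  | cons p ps ih =>
    intro h
    simp only [jointLaw, PMF.mem_support_bind_iff, PMF.mem_support_pure_iff] at h
    obtain ⟨x, hx, ys, hy, rfl⟩ := h
    exact List.Forall₂.cons hx (ih hy)

theorem pev_jointLaw_prod (ps : List (PMF β)) (ψ : β → ℝ≥0∞) :
    pev (jointLaw ps) (fun xs => (xs.map ψ).prod) = (ps.map fun p => pev p ψ).prod := by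
  induction ps with
  | nil => simp [jointLaw, pev_pure]
  | cons p ps ih =>
    simp only [jointLaw, pev_bind, pev_pure, List.map_cons, List.prod_cons, pev_mul_left, ih,
      pev_mul_right]

theorem roundRobin_eq_none {l : List (Option α × ℕ)} (h : (roundRobin l).1 = none) :
    (∀ x ∈ l, x.1 = none) ∧ (roundRobin l).2 = 2 * (l.map Prod.snd).sum + l.length := by
  unfold roundRobin at h ⊢
  split at h
  · rename_i hl
    rw [List.argmin_eq_none, List.filter_eq_nil_iff] at hl
    exact ⟨fun x hx => by simpa using hl x hx, rfl⟩
  · rename_i x hx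
    have := List.argmin_mem hx
    rw [List.mem_filter] at this
    rw [show x.1 = none from h] at this
    simp at this

/-- When the winner stops, no other process has done more steps than the winner. This is what lets a
successful search be charged by the round in which its winner passed, however slow the other starts
are. -/
theorem roundRobin_eq_some {l : List (Option α × ℕ)} {a : α} (h : (roundRobin l).1 = some a) :
    ∃ x ∈ l, x.1 = some a ∧ (roundRobin l).2 ≤ 2 * (l.length * x.2) + l.length := by
  unfold roundRobin at h ⊢
  split at h
  · simp at h
  · rename_i x hx
    have hm := List.argmin_mem hx
    rw [List.mem_filter] at hm
    refine ⟨x, hm.1, h, ?_⟩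
    have : (l.map fun y => min y.2 x.2).sum ≤ l.length * x.2 := by
      have := List.sum_le_card_nsmul (l.map fun y => min y.2 x.2) x.2 (by
        intro z hz
        rw [List.mem_map] at hz
        obtain ⟨y, -, rfl⟩ := hz
        exact min_le_right _ _)
      simpa using this
    simp only
    omega

/-- A joint failure forces every process to fail, and the processes are independent. -/
theorem ev_parallel_none (l : List (Comp (Option α))) :
    ev (parallel l) (({none} : Set (Option α)).indicator fun _ => 1) ≤
      (l.map fun x => ev x (({none} : Set (Option α)).indicator fun _ => 1)).prod := by
  have h := pev_jointLaw_prod (l.map law)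
    (fun y => ({none} : Set (Option α)).indicator (fun _ => (1 : ℝ≥0∞)) y.1)
  rw [List.map_map] at h
  refine le_trans ?_ h.le
  unfold ev parallel
  change pev (PMF.map roundRobin _) _ ≤ _
  rw [pev_map]
  refine pev_mono fun xs _ => ?_
  by_cases hx : (roundRobin xs).1 = none
  · have := (roundRobin_eq_none hx).1
    rw [List.prod_eq_one]
    · exact Set.indicator_le_self' (fun _ _ => zero_le_one) _
    · intro y hy
      rw [List.mem_map] at hy
      obtain ⟨z, hz, rfl⟩ := hy
      simp [this z hz]
  · simp [hx]

theorem mem_support_parallel {l : List (Comp (Option α))} {y : Option α × ℕ}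
    (h : y ∈ (parallel l).law.support) :
    ∃ xs : List (Option α × ℕ), List.Forall₂ (fun x z => z ∈ x.law.support) l xs ∧
      roundRobin xs = y := by
  change y ∈ (PMF.map roundRobin _).support at h
  rw [PMF.mem_support_map_iff] at h
  obtain ⟨xs, hxs, rfl⟩ := h
  exact ⟨xs, by simpa [List.forall₂_map_left_iff] using mem_support_jointLaw _ hxs, rfl⟩

end Comp

end

section


/-! ## The function `𝒮` -/

theorem sotoMid_pos {s : ℝ} (hs : s < 1) : 0 < sotoMid s := by
  unfold sotoMid
  have : 1 < √(4 * s ^ 2 - 8 * s + 5) := by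
    rw [Real.lt_sqrt (by norm_num)]
    nlinarith [sq_pos_of_pos (sub_pos.mpr hs)]
  exact div_pos (by linarith) (by linarith)

/-- The radicand is 1 + 4 (1 - s)², so `sotoMid s` is the positive root of this quadratic. Later
arguments use the equation in place of the radical. -/
theorem sotoMid_eq {s : ℝ} (hs : s < 1) :
    (1 - s) * sotoMid s ^ 2 + sotoMid s = 1 - s := by
  have h1 : (√(4 * s ^ 2 - 8 * s + 5)) ^ 2 = 4 * s ^ 2 - 8 * s + 5 :=
    Real.sq_sqrt (by nlinarith [sq_nonneg (s - 1)])
  have h2 : 1 - s ≠ 0 := by linarith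
  unfold sotoMid
  field_simp
  ring_nf
  ring_nf at h1
  rw [h1]
  ring

theorem sotoMid_lt_one {s : ℝ} (hs : s < 1) : sotoMid s < 1 := by
  have h1 := sotoMid_eq hs
  have h2 := sotoMid_pos hs
  by_contra h
  push Not at h
  nlinarith [mul_le_mul_of_nonneg_left (one_le_pow₀ h (n := 2)) (sub_pos.mpr hs).le]

theorem eq_sotoMid {s x : ℝ} (hs : s < 1) (hx : 0 < x) (h : (1 - s) * x ^ 2 + x = 1 - s) :
    sotoMid s = x := by
  have h1 := sotoMid_eq hs
  have h2 := sotoMid_pos hs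
  have h3 : (sotoMid s - x) * ((1 - s) * (sotoMid s + x) + 1) = 0 := by linear_combination h1 - h
  rcases mul_eq_zero.mp h3 with h4 | h4
  · linarith
  · have : 0 < (1 - s) * (sotoMid s + x) := mul_pos (by linarith) (by linarith)
    linarith

/-- The quadratic equation reads x / (1 - x²) = 1 - s, and the left side increases with x on (0, 1).
-/
theorem sotoMid_strictAnti {s t : ℝ} (hst : s < t) (ht : t < 1) : sotoMid t < sotoMid s := by
  have h1 := sotoMid_eq (hst.trans ht)
  have h2 := sotoMid_eq ht
  have h3 := sotoMid_pos (hst.trans ht)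
  have h4 := sotoMid_pos ht
  have h5 := sotoMid_lt_one ht
  by_contra h
  push Not at h
  have h6 : sotoMid s ^ 2 ≤ sotoMid t ^ 2 := pow_le_pow_left₀ h3.le h 2
  have h7 : sotoMid t ^ 2 < 1 := by nlinarith
  nlinarith [mul_le_mul_of_nonneg_left h6 (sub_pos.mpr (hst.trans ht)).le,
    mul_lt_mul_of_pos_right hst (sub_pos.mpr h7)]

theorem sotoMid_third : sotoMid (1 / 3) = 1 / 2 :=
  eq_sotoMid (by norm_num) (by norm_num) (by norm_num)

theorem sotoMid_eq_sotoLow_iff {s : ℝ} (h0 : 0 < s) (h1 : s < 1 / 3) :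
    sotoMid s = sotoLow s ↔ (1 - 2 * s) ^ 2 * (1 - s) = s := by
  have hs : s < 1 := by linarith
  constructor
  · intro h
    have e1 := sotoMid_eq hs
    have e2 := sotoMid_pos hs
    have e3 := sotoMid_lt_one hs
    set x := sotoMid s
    have hc : (√(s * (1 - s))) ^ 2 = s * (1 - s) := Real.sq_sqrt (by nlinarith)
    have hc0 : 0 ≤ √(s * (1 - s)) := Real.sqrt_nonneg _
    unfold sotoLow at h
    have h2 : x * (1 + 2 * √(s * (1 - s))) = 1 := by
      rw [h]
      field_simp
    have h3 : (1 - x) ^ 2 = 4 * x ^ 2 * (s * (1 - s)) := by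
      rw [← hc]
      linear_combination (-(1 - x) - 2 * x * √(s * (1 - s))) * h2
    have hx2 : 0 < 1 - x ^ 2 := by nlinarith
    have e4 : (1 - s) * (1 - x ^ 2) = x := by linear_combination -e1
    have e5 : s * (1 - x ^ 2) = 1 - x - x ^ 2 := by linear_combination -e4
    -- Eliminating `s` leaves a perfect square, hence the cubic x + x² + x³ = 1. Combined with the
    -- quadratic equation it says x = 1 - 2 s, which turns that equation into the cubic for `s`.
    have h4 : ((1 - x) * (1 - x ^ 2)) ^ 2 = 4 * x ^ 3 * (1 - x - x ^ 2) := by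
      calc ((1 - x) * (1 - x ^ 2)) ^ 2 = (1 - x) ^ 2 * (1 - x ^ 2) ^ 2 := by ring
        _ = 4 * x ^ 2 * ((s * (1 - x ^ 2)) * ((1 - s) * (1 - x ^ 2))) := by rw [h3]; ring
        _ = _ := by rw [e4, e5]; ring
    have h5 : (1 - x - x ^ 2 - x ^ 3) ^ 2 = 0 := by linear_combination h4
    have h6 : 1 - x - x ^ 2 - x ^ 3 = 0 := pow_eq_zero_iff (two_ne_zero) |>.mp h5
    have h7 : (1 - 2 * s - x) * (1 - x ^ 2) = 0 := by linear_combination -2 * e5 - h6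
    have h8 : 1 - 2 * s = x := by
      rcases mul_eq_zero.mp h7 with h | h <;> linarith
    rw [h8]
    nlinarith [e1]
  · intro h
    have e1 : sotoMid s = 1 - 2 * s := eq_sotoMid hs (by linarith) (by linear_combination h)
    have e2 : √(s * (1 - s)) = (1 - 2 * s) * (1 - s) := by
      rw [Real.sqrt_eq_iff_mul_self_eq (by nlinarith) (by nlinarith)]
      linear_combination -(1 - s) * h
    rw [e1, sotoLow, e2, eq_div_iff (by nlinarith)]
    linear_combination 2 * h

theorem sigmaZero_spec : 0 < sigmaZero ∧ sigmaZero < 1 / 3 ∧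
    (1 - 2 * sigmaZero) ^ 2 * (1 - sigmaZero) = sigmaZero := by
  obtain ⟨s, ⟨hs0, hs1⟩, hs⟩ : ∃ s ∈ Set.Icc (0 : ℝ) (1 / 3),
      (1 - 2 * s) ^ 2 * (1 - s) - s = 0 := by
    have := intermediate_value_Icc' (by norm_num : (0 : ℝ) ≤ 1 / 3)
      (f := fun s : ℝ => (1 - 2 * s) ^ 2 * (1 - s) - s) (by fun_prop)
    exact this ⟨by norm_num, by norm_num⟩
  have hs0' : 0 < s := lt_of_le_of_ne hs0 (by rintro rfl; norm_num at hs)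
  have hs1' : s < 1 / 3 := lt_of_le_of_ne hs1 (by rintro rfl; norm_num at hs)
  have : {s : ℝ | 0 < s ∧ s < 1 / 3 ∧ sotoMid s = sotoLow s} = {s} := by
    ext t
    simp only [Set.mem_ofPred_eq, Set.mem_singleton_iff]
    constructor
    · rintro ⟨h0, h1, h⟩
      rw [sotoMid_eq_sotoLow_iff h0 h1] at h
      -- The difference of the two cubic equations, with `t - s` factored out. The cofactor is
      -- positive, so the root is unique and the infimum in `sigmaZero` is over a singleton.
      have h2 : (t - s) * (2 * (1 - 2 * t + (1 - 2 * s)) * (1 - t) + (1 - 2 * s) ^ 2 + 1) = 0 := by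
        linear_combination hs - h
      rcases mul_eq_zero.mp h2 with h3 | h3
      · linarith
      · have : 0 < (1 - 2 * t + (1 - 2 * s)) * (1 - t) := mul_pos (by linarith) (by linarith)
        nlinarith [sq_nonneg (1 - 2 * s)]
    · rintro rfl
      exact ⟨hs0', hs1', (sotoMid_eq_sotoLow_iff hs0' hs1').mpr (by linarith)⟩
  have hz : sigmaZero = s := by rw [sigmaZero, this, csInf_singleton]
  rw [hz]
  exact ⟨hs0', hs1', by linarith⟩

theorem sotoMid_sigmaZero : sotoMid sigmaZero = sotoLow sigmaZero :=
  (sotoMid_eq_sotoLow_iff sigmaZero_spec.1 sigmaZero_spec.2.1).mpr sigmaZero_spec.2.2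

theorem sotoLow_antitone {s t : ℝ} (hst : s ≤ t) (ht : t ≤ 1 / 2) : sotoLow t ≤ sotoLow s := by
  unfold sotoLow
  have : √(s * (1 - s)) ≤ √(t * (1 - t)) := Real.sqrt_le_sqrt (by nlinarith)
  have h0 := Real.sqrt_nonneg (s * (1 - s))
  exact one_div_le_one_div_of_le (by linarith) (by linarith)

theorem half_lt_sotoLow {s : ℝ} (hs : s < 1 / 2) : 1 / 2 < sotoLow s := by
  unfold sotoLow
  have h0 := Real.sqrt_nonneg (s * (1 - s))
  have : √(s * (1 - s)) < 1 / 2 := by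
    rw [Real.sqrt_lt' (by norm_num)]
    nlinarith [sq_pos_of_pos (sub_pos.mpr hs)]
  exact one_div_lt_one_div_of_lt (by linarith) (by linarith)

theorem soto_antitone : Antitone soto := by
  obtain ⟨h0, h1, -⟩ := sigmaZero_spec
  have hm := sotoMid_sigmaZero
  have mid : ∀ {s t : ℝ}, s ≤ t → t < 1 → sotoMid t ≤ sotoMid s := fun {s t} hst ht => by
    rcases hst.eq_or_lt with rfl | h
    · exact le_rfl
    · exact (sotoMid_strictAnti h ht).le
  intro s t hst
  unfold soto
  rcases lt_or_ge (1 / 3) t with ht | ht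
  · rw [if_pos ht]
    split_ifs with hs hs'
    · exact le_rfl
    · exact sotoMid_third ▸ mid (not_lt.mp hs) (by norm_num)
    · exact (half_lt_sotoLow (by linarith)).le
  · rw [if_neg (not_lt.mpr ht), if_neg (not_lt.mpr (hst.trans ht))]
    split_ifs with ht' hs hs
    · exact mid hst (by linarith)
    · exact (mid ht'.le (by linarith)).trans
        (hm.trans_le (sotoLow_antitone (not_lt.mp hs) (by linarith)))
    · linarith
    · exact sotoLow_antitone hst (by linarith)

theorem soto_of_third_le {s : ℝ} (hs : 1 / 3 ≤ s) : soto s = 1 / 2 := by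
  obtain ⟨h0, h1, -⟩ := sigmaZero_spec
  unfold soto
  split_ifs with h h'
  · rfl
  · rw [le_antisymm (not_lt.mp h) hs, sotoMid_third]
  · linarith

theorem half_le_soto (s : ℝ) : 1 / 2 ≤ soto s := by
  rw [← soto_of_third_le (le_max_right s (1 / 3))]
  exact soto_antitone (le_max_left _ _)

theorem soto_eq_half_iff {s : ℝ} : soto s = 1 / 2 ↔ 1 / 3 ≤ s := by
  refine ⟨fun h => ?_, soto_of_third_le⟩
  by_contra hs
  push Not at hs
  unfold soto at h
  rw [if_neg (by linarith)] at h
  split_ifs at h with h'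
  · have := sotoMid_strictAnti hs (by norm_num)
    rw [sotoMid_third] at this
    linarith
  · have := half_lt_sotoLow (s := s) (by linarith)
    linarith

theorem soto_le_one (s : ℝ) : soto s ≤ 1 := by
  refine (soto_antitone (min_le_left s 0)).trans ?_
  obtain ⟨h0, h1, -⟩ := sigmaZero_spec
  have h2 : min s 0 ≤ 0 := min_le_right _ _
  unfold soto
  rw [if_neg (by linarith), if_neg (by linarith), sotoLow]
  have := Real.sqrt_nonneg (min s 0 * (1 - min s 0))
  exact (div_le_one (by linarith)).mpr (by linarith)

theorem soto_continuous : Continuous soto := by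
  obtain ⟨h0, h1, -⟩ := sigmaZero_spec
  have hlow : Continuous sotoLow := by
    unfold sotoLow
    refine continuous_const.div (by fun_prop) fun s => ?_
    have := Real.sqrt_nonneg (s * (1 - s))
    linarith
  have hmid : Continuous fun s => sotoMid (min s (1 / 3)) := by
    unfold sotoMid
    refine Continuous.div (by fun_prop) (by fun_prop) fun s => ?_
    have := min_le_right s (1 / 3)
    linarith
  have : soto = fun s => if s ≤ sigmaZero then sotoLow s else sotoMid (min s (1 / 3)) := by
    funext s
    unfold soto
    split_ifs with h2 h3 h3 h4 h4
    any_goals linarith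
    · rw [min_eq_right h2.le, sotoMid_third]
    · rw [min_eq_left (not_lt.mp h2)]
  rw [this]
  refine Continuous.if_le hlow hmid continuous_id continuous_const fun s hs => ?_
  rw [hs, min_eq_left h1.le, sotoMid_sigmaZero]

/-! ### The inequality for a single edge -/

/-- The first expression expands to (A - S) x² + 2 l x y + A y², and `h1` is its discriminant
condition. It serves edges whose ends are on opposite sides. The second serves edges with both ends
on the same side; there y lies between 0 and x, and it suffices to look at the extreme rays y = 0,
which needs A ≥ S, and y = x, which needs `h2`. -/
theorem edge_inequality_aux {S l s A x y : ℝ} (hA : A = 1 / 2 + l * (1 - 2 * s)) (hA0 : 0 < A)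
    (h1 : l ^ 2 ≤ A * (A - S)) (h2 : S ≤ 4 * l * (1 - s)) (hxy : y ^ 2 ≤ x ^ 2) :
    (0 ≤ (x ^ 2 + y ^ 2) / 2 - S * x ^ 2 - l * (2 * s * (x ^ 2 + y ^ 2) - (x + y) ^ 2)) ∧
    (0 ≤ l → 0 ≤ x * y →
      0 ≤ (x ^ 2 - y ^ 2) / 2 - S * x ^ 2 - l * (2 * s * (x ^ 2 + y ^ 2) - (x + y) ^ 2)) := by
  have hAS : 0 ≤ A - S := by
    by_contra h
    push Not at h
    nlinarith [sq_nonneg l]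
  constructor
  · refine nonneg_of_mul_nonneg_right ?_ hA0
    have : A * ((x ^ 2 + y ^ 2) / 2 - S * x ^ 2 - l * (2 * s * (x ^ 2 + y ^ 2) - (x + y) ^ 2)) =
        (A * (A - S) - l ^ 2) * x ^ 2 + (l * x + A * y) ^ 2 := by
      rw [hA]; ring
    rw [this]
    have := mul_nonneg (sub_nonneg.mpr h1) (sq_nonneg x)
    positivity
  · intro hl hxy'
    have h3 : y ^ 2 ≤ x * y := by
      have := sq_le_sq.mp hxy
      calc y ^ 2 = |y| * |y| := by rw [abs_mul_abs_self, sq]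
        _ ≤ |x| * |y| := mul_le_mul_of_nonneg_right this (abs_nonneg _)
        _ = x * y := by rw [← abs_mul, abs_of_nonneg hxy']
    have key : (x ^ 2 - y ^ 2) / 2 - S * x ^ 2 - l * (2 * s * (x ^ 2 + y ^ 2) - (x + y) ^ 2) =
        (A - S) * (x ^ 2 - y ^ 2) + (4 * l * (1 - s) - S) * y ^ 2 + 2 * l * (x * y - y ^ 2) := by
      rw [hA]; ring
    rw [key]
    have := mul_nonneg hAS (sub_nonneg.mpr hxy)
    have := mul_nonneg (sub_nonneg.mpr h2) (sq_nonneg y)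
    have := mul_nonneg hl (sub_nonneg.mpr h3)
    linarith

/-- The two branches of 𝒮 are the two regimes of an optimization over `l`. For small `s` the maximum
of A - l² / A is attained at an `l` that satisfies the last condition. Beyond `sigmaZero` the last
condition is tight and determines `l`. The discriminant vanishes in both cases. -/
theorem exists_multiplier {s : ℝ} (h0 : 0 < s) (h1 : soto s ≠ 1 / 2) :
    ∃ l A : ℝ, 1 / 8 ≤ l ∧ A = 1 / 2 + l * (1 - 2 * s) ∧ 0 < A ∧ l ^ 2 ≤ A * (A - soto s) ∧
      soto s ≤ 4 * l * (1 - s) := by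
  have hs : s < 1 / 3 := by
    by_contra h
    exact h1 (soto_of_third_le (not_lt.mp h))
  obtain ⟨hz0, hz1, hz⟩ := sigmaZero_spec
  have hhalf := half_le_soto s
  suffices H : ∃ l : ℝ, 0 < l ∧
      l ^ 2 ≤ (1 / 2 + l * (1 - 2 * s)) * (1 / 2 + l * (1 - 2 * s) - soto s) ∧
      soto s ≤ 4 * l * (1 - s) by
    obtain ⟨l, hl, hl1, hl2⟩ := H
    refine ⟨l, _, ?_, rfl, ?_, hl1, hl2⟩
    · nlinarith
    · nlinarith
  unfold soto at *
  rw [if_neg (by linarith)] at *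
  split_ifs at * with h2
  · have e := sotoMid_eq (s := s) (by linarith)
    have hu : 1 - s ≠ 0 := by linarith
    set x := sotoMid s
    -- The value that makes the last condition an equality.
    refine ⟨x / (4 * (1 - s)), div_pos (by linarith) (by linarith), ?_, ?_⟩
    · have hx : 4 * (x / (4 * (1 - s))) * (1 - s) = x := by field_simp
      set l := x / (4 * (1 - s))
      have : l ^ 2 = (1 / 2 + l * (1 - 2 * s)) * (1 / 2 + l * (1 - 2 * s) - x) := by
        have e' : (1 - s) * (1 / 4 - l - 4 * (1 - s) ^ 2 * l ^ 2) = 0 := by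
          rw [← hx] at e
          linear_combination (-1 / 4) * e
        have e'' := (mul_eq_zero.mp e').resolve_left hu
        rw [← hx]
        linear_combination -e''
      exact this.le
    · exact le_of_eq (by field_simp)
  · have hc : (√(s * (1 - s))) ^ 2 = s * (1 - s) := Real.sq_sqrt (by nlinarith)
    have hc0 : 0 < √(s * (1 - s)) := Real.sqrt_pos.mpr (by nlinarith)
    unfold sotoLow
    set r := √(s * (1 - s))
    have ha : 0 < 1 - 2 * s := by linarith
    have hca : 4 * r ^ 2 + (1 - 2 * s) ^ 2 = 1 := by rw [hc]; ring
    have hr1 : r < 1 / 2 := by nlinarith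
    -- This is where `s ≤ sigmaZero` enters; it is the last condition in disguise, for the
    -- multiplier chosen below.
    have hfeas : s ≤ (1 - 2 * s) ^ 2 * (1 - s) := by
      have h3 : s ≤ sigmaZero := not_lt.mp h2
      calc s ≤ sigmaZero := h3
        _ = (1 - 2 * sigmaZero) ^ 2 * (1 - sigmaZero) := hz.symm
        _ ≤ (1 - 2 * s) ^ 2 * (1 - s) := by
          have : (1 - 2 * sigmaZero) ^ 2 ≤ (1 - 2 * s) ^ 2 :=
            pow_le_pow_left₀ (by linarith) (by linarith) 2
          exact mul_le_mul this (by linarith) (by linarith) (sq_nonneg _)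
    have hr2 : r ≤ (1 - 2 * s) * (1 - s) := by
      refine abs_le_of_sq_le_sq' ?_ (by nlinarith) |>.2
      rw [hc]
      nlinarith
    set a := 1 - 2 * s
    -- The maximizer of A - l² / A, where A = 1 / (4 r).
    refine ⟨(1 - 2 * r) / (4 * a * r), div_pos (by linarith) (by positivity), ?_, ?_⟩
    · refine le_of_eq ?_
      have hr' : (1 + 2 * r) ≠ 0 := by linarith
      field_simp
      have ha2 : a ^ 2 = 1 - 4 * r ^ 2 := by linarith
      ring_nf
      simp only [ha2]
      ring
    · rw [div_le_iff₀ (by linarith)]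
      have e1 : 4 * ((1 - 2 * r) / (4 * a * r)) * (1 - s) * (1 + 2 * r) = a * (1 - s) / r := by
        field_simp
        linear_combination (1 - s) * (-hca)
      rw [e1, le_div_iff₀ hc0]
      linarith

/-- The edge inequality behind Soto's bound: the threshold cuts of a vector beat the ratio `𝒮(s)`
by a multiple of its excess energy. -/
theorem exists_edge_inequality {s : ℝ} (h0 : 0 < s) (h1 : soto s ≠ 1 / 2) :
    ∃ l : ℝ, 1 / 8 ≤ l ∧ ∀ e f p q : ℝ, (e = 1 ∨ e = -1) → (f = 1 ∨ f = -1) → 0 ≤ p → 0 ≤ q →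
      l * (2 * s * (p ^ 2 + q ^ 2) - (e * p + f * q) ^ 2) ≤
        (max (p ^ 2) (q ^ 2) - e * f * min (p ^ 2) (q ^ 2)) / 2 -
          soto s * max (p ^ 2) (q ^ 2) := by
  obtain ⟨l, A, hl, hA, hA0, h2, h3⟩ := exists_multiplier h0 h1
  refine ⟨l, hl, ?_⟩
  have key : ∀ e f p q : ℝ, (e = 1 ∨ e = -1) → (f = 1 ∨ f = -1) → 0 ≤ p → 0 ≤ q → q ^ 2 ≤ p ^ 2 →
      l * (2 * s * (p ^ 2 + q ^ 2) - (e * p + f * q) ^ 2) ≤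
        (p ^ 2 - e * f * q ^ 2) / 2 - soto s * p ^ 2 := by
    rintro e f p q he hf hp hq hpq
    have hpq0 := mul_nonneg hp hq
    have g1 := edge_inequality_aux (x := p) (y := -q) hA hA0 h2 h3 (by simpa using hpq)
    have g2 := edge_inequality_aux (x := p) (y := q) hA hA0 h2 h3 hpq
    -- `g3` settles equal signs, and `g4`, obtained with `-q`, opposite signs.
    have g3 := g2.2 (by linarith) hpq0
    have g4 := g1.1
    rcases he with rfl | rfl <;> rcases hf with rfl | rfl <;> ring_nf at g3 g4 ⊢ <;> linarith
  intro e f p q he hf hp hq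
  rcases le_total (q ^ 2) (p ^ 2) with h | h
  · rw [max_eq_left h, min_eq_right h]
    exact key e f p q he hf hp hq h
  · rw [max_eq_right h, min_eq_left h]
    have := key f e q p hf he hq hp h
    rw [mul_comm e f, add_comm (p ^ 2), add_comm (e * p)]
    exact this

end

section


open MeasureTheory

/-! ## The performance integral -/

theorem one_add_inv_pos {μ : ℝ} (hμ : 0 < μ) : 0 < 1 + 1 / μ := by positivity

theorem sigma_continuous {μ : ℝ} (hμ : 0 < μ) :
    Continuous fun x : ℝ × ℝ => sigma x.1 x.2 μ := by
  unfold sigma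
  have := one_add_inv_pos hμ
  have h : Continuous fun x : ℝ × ℝ => (max (1 - x.2) 0) ^ (1 + 1 / μ) :=
    Continuous.rpow_const (by fun_prop) fun _ => Or.inr this.le
  fun_prop

theorem sigma_mono {θ μ x y : ℝ} (hμ : 0 < μ) (hθ : θ ≤ 1) (hxy : x ≤ y) :
    sigma θ x μ ≤ sigma θ y μ := by
  unfold sigma
  have h : (max (1 - y) 0) ^ (1 + 1 / μ) ≤ (max (1 - x) 0) ^ (1 + 1 / μ) :=
    Real.rpow_le_rpow (le_max_right _ _) (max_le_max (by linarith) le_rfl)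
      (one_add_inv_pos hμ).le
  nlinarith

/-- `𝒮(σ(ε))` as a function of `ε`. -/
def sotoAt (θ μ ε : ℝ) : ℝ := soto (sigma θ ε μ)

theorem sotoAt_antitone {θ μ : ℝ} (hμ : 0 < μ) (hθ : θ ≤ 1) : Antitone (sotoAt θ μ) :=
  fun _ _ h => soto_antitone (sigma_mono hμ hθ h)

theorem sotoAt_continuous {μ : ℝ} (hμ : 0 < μ) :
    Continuous fun x : ℝ × ℝ => sotoAt x.1 μ x.2 :=
  soto_continuous.comp (sigma_continuous hμ)

theorem sotoAt_measurable {θ μ : ℝ} (hμ : 0 < μ) (ε : ℝ) :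
    Measurable fun z : ℝ => sotoAt θ μ (ε / z) := by
  have h : Continuous fun x : ℝ => sotoAt θ μ x :=
    (sotoAt_continuous hμ).comp (by fun_prop : Continuous fun x : ℝ => (θ, x))
  exact h.measurable.comp (measurable_const.div measurable_id)

theorem sotoAt_norm_le (θ μ ε : ℝ) : ‖sotoAt θ μ ε‖ ≤ 1 := by
  rw [sotoAt, Real.norm_of_nonneg ((by norm_num : (0 : ℝ) ≤ 1 / 2).trans (half_le_soto _))]
  exact soto_le_one _

theorem sotoAt_intervalIntegrable {θ μ : ℝ} (hμ : 0 < μ) (ε a b : ℝ) :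
    IntervalIntegrable (fun z : ℝ => sotoAt θ μ (ε / z)) volume a b :=
  (intervalIntegrable_const (c := (1 : ℝ))).mono_fun'
    (sotoAt_measurable hμ ε).aestronglyMeasurable
    (Filter.Eventually.of_forall fun _ => sotoAt_norm_le _ _ _)

/-- The integral of `𝒮(σ(ε / z))` over `z ∈ (0, x)`. -/
def perf (θ μ ε x : ℝ) : ℝ := ∫ z in (0)..x, sotoAt θ μ (ε / z)

/-- The integrand increases with `z`, so its value at the right end bounds it. In the recursion, `y`
and `x` are the fractions of edges left before and after a removal: the guaranteed ratio at the
start of the removal dominates the integral over what is removed. -/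
theorem perf_sub_le {θ μ ε x y : ℝ} (hμ : 0 < μ) (hθ : θ ≤ 1) (hε : 0 ≤ ε) (hx : 0 ≤ x)
    (hxy : x ≤ y) : perf θ μ ε y - perf θ μ ε x ≤ sotoAt θ μ (ε / y) * (y - x) := by
  unfold perf
  rw [intervalIntegral.integral_interval_sub_left (sotoAt_intervalIntegrable hμ _ _ _)
    (sotoAt_intervalIntegrable hμ _ _ _), mul_comm, ← smul_eq_mul,
    ← intervalIntegral.integral_const]
  refine intervalIntegral.integral_mono_on_of_le_Ioo hxy (sotoAt_intervalIntegrable hμ _ _ _)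
    intervalIntegrable_const fun z hz => sotoAt_antitone hμ hθ ?_
  exact div_le_div_of_nonneg_left hε (hx.trans_lt hz.1) hz.2.le

theorem perf_zero (θ μ ε : ℝ) : perf θ μ ε 0 = 0 := intervalIntegral.integral_same

theorem perf_continuous {μ : ℝ} (hμ : 0 < μ) :
    Continuous fun x : ℝ × ℝ => perf x.1 μ x.2 1 := by
  unfold perf
  refine intervalIntegral.continuous_of_dominated_interval (bound := fun _ => 1)
    (fun x => (sotoAt_measurable hμ x.2).aestronglyMeasurable)
    (fun x => Filter.Eventually.of_forall fun _ _ => sotoAt_norm_le _ _ _)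
    intervalIntegrable_const (Filter.Eventually.of_forall fun z _ => ?_)
  exact (sotoAt_continuous hμ).comp
    (by fun_prop : Continuous fun x : ℝ × ℝ => (x.1, x.2 / z))

theorem sotoAt_eq_half_iff {θ μ ε : ℝ} : sotoAt θ μ ε = 1 / 2 ↔
    (1 - θ) * (max (1 - ε) 0) ^ (1 + 1 / μ) ≤ 2 / 3 := by
  unfold sotoAt
  rw [soto_eq_half_iff, sigma]
  constructor <;> intro h <;> linarith

theorem sotoAt_zero_eq_half_iff {μ ε : ℝ} (hμ : 0 < μ) : sotoAt 0 μ ε = 1 / 2 ↔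
    1 - (2 / 3 : ℝ) ^ (1 + 1 / μ)⁻¹ ≤ ε := by
  have hp := one_add_inv_pos hμ
  rw [sotoAt_eq_half_iff, sub_zero, one_mul,
    ← Real.le_rpow_inv_iff_of_pos (le_max_right _ _) (by norm_num) hp, max_le_iff]
  have : (0 : ℝ) ≤ (2 / 3 : ℝ) ^ (1 + 1 / μ)⁻¹ := Real.rpow_nonneg (by norm_num) _
  constructor
  · intro h
    linarith [h.1]
  · intro h
    exact ⟨by linarith, this⟩

/-- The exponent 1 + 1/μ is at least 1, so (1 - ε)^(1 + 1/μ) is at most 2/3 already for ε = 1/3.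
Above 1/3 neither the algorithm nor `H` depends on the precise parameter. -/
theorem sotoAt_eq_half_of_third_le {θ μ ε : ℝ} (hμ : 0 < μ) (hθ0 : 0 ≤ θ)
    (hε : 1 / 3 ≤ ε) : sotoAt θ μ ε = 1 / 2 := by
  rw [sotoAt_eq_half_iff]
  have h1 : (max (1 - ε) 0) ^ (1 + 1 / μ) ≤ (2 / 3 : ℝ) ^ (1 + 1 / μ) :=
    Real.rpow_le_rpow (le_max_right _ _) (max_le (by linarith) (by norm_num))
      (one_add_inv_pos hμ).le
  have h2 : (2 / 3 : ℝ) ^ (1 + 1 / μ) ≤ (2 / 3 : ℝ) ^ (1 : ℝ) :=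
    Real.rpow_le_rpow_of_exponent_ge (by norm_num) (by norm_num)
      (by have : 0 < 1 / μ := by positivity
          linarith)
  rw [Real.rpow_one] at h2
  have h3 : 0 ≤ (max (1 - ε) 0) ^ (1 + 1 / μ) := Real.rpow_nonneg (le_max_right _ _) _
  nlinarith

/-- The integrand is 1/2 on (0, z*], so the term z*/2 is the missing part of the integral. If z* >
1, the integral from z* to 1 is oriented backwards and additivity still applies. -/
theorem H_eq_perf {μ ε : ℝ} (hμ : 0 < μ) (hε : 0 ≤ ε) : H ε μ = perf 0 μ ε 1 := by
  have hp := one_add_inv_pos hμ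
  set x₀ : ℝ := 1 - (2 / 3 : ℝ) ^ (1 + 1 / μ)⁻¹ with hx₀
  have hx₀_pos : 0 < x₀ := by
    have : (2 / 3 : ℝ) ^ (1 + 1 / μ)⁻¹ < 1 :=
      Real.rpow_lt_one (by norm_num) (by norm_num) (inv_pos.mpr hp)
    linarith
  have hset : ∀ z : ℝ, 0 < z → (soto (sigma 0 (ε / z) μ) = 1 / 2 ↔ z ≤ ε / x₀) := by
    intro z hz
    rw [show soto (sigma 0 (ε / z) μ) = sotoAt 0 μ (ε / z) from rfl,
      sotoAt_zero_eq_half_iff hμ, ← hx₀, le_div_iff₀ hz, le_div_iff₀ hx₀_pos, mul_comm]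
  have hz : zStar ε μ = ε / x₀ := by
    unfold zStar
    rcases hε.eq_or_lt with rfl | hε'
    · rw [zero_div]
      -- The supremum of the empty set of reals is 0 by default, which is the intended value for ε =
      -- 0.
      convert Real.sSup_empty
      rw [Set.eq_empty_iff_forall_notMem]
      rintro z ⟨h1, h2⟩
      rw [hset z h1, zero_div] at h2
      linarith
    · have : {z : ℝ | 0 < z ∧ soto (sigma 0 (ε / z) μ) = 1 / 2} = Set.Ioc 0 (ε / x₀) := by
        ext z
        constructor
        · rintro ⟨h1, h2⟩
          exact ⟨h1, (hset z h1).mp h2⟩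
        · rintro ⟨h1, h2⟩
          exact ⟨h1, (hset z h1).mpr h2⟩
      rw [this, csSup_Ioc (div_pos hε' hx₀_pos)]
  have hz0 : 0 ≤ zStar ε μ := hz ▸ div_nonneg hε hx₀_pos.le
  have h1 : ∫ z in (0)..(zStar ε μ), sotoAt 0 μ (ε / z) = zStar ε μ / 2 := by
    have : ∫ z in (0)..(zStar ε μ), sotoAt 0 μ (ε / z) = ∫ z in (0)..(zStar ε μ), (1 / 2 : ℝ) := by
      refine intervalIntegral.integral_congr_ae (Filter.Eventually.of_forall fun z hz' => ?_)
      rw [Set.uIoc_of_le hz0] at hz'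
      exact (hset z hz'.1).mpr (hz ▸ hz'.2)
    rw [this, intervalIntegral.integral_const, smul_eq_mul]
    ring
  unfold H perf
  rw [← intervalIntegral.integral_add_adjacent_intervals
    (sotoAt_intervalIntegrable hμ ε 0 (zStar ε μ)) (sotoAt_intervalIntegrable hμ ε _ 1), h1]
  rfl

theorem half_le_perf_one {θ μ ε : ℝ} (hμ : 0 < μ) : 1 / 2 ≤ perf θ μ ε 1 := by
  have h : ∫ _ in (0 : ℝ)..1, (1 / 2 : ℝ) ≤ perf θ μ ε 1 :=
    intervalIntegral.integral_mono_on zero_le_one intervalIntegrable_const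
      (sotoAt_intervalIntegrable hμ _ _ _) fun _ _ => half_le_soto _
  simpa using h

theorem perf_one_of_third_le {θ μ ε : ℝ} (hμ : 0 < μ) (hθ0 : 0 ≤ θ) (hθ : θ ≤ 1)
    (hε : 1 / 3 ≤ ε) : perf θ μ ε 1 = 1 / 2 := by
  have h := perf_sub_le (μ := μ) (ε := ε) hμ hθ (by linarith) le_rfl zero_le_one
  rw [perf_zero, div_one, sotoAt_eq_half_of_third_le hμ hθ0 hε] at h
  linarith [half_le_perf_one (θ := θ) (ε := ε) hμ]

theorem exists_min_ratio {μ : ℝ} (hμ : 0 < μ) :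
    ∃ ε₀ ∈ Set.Icc (0 : ℝ) (1 / 2), ratio μ = H ε₀ μ / (1 - ε₀) ∧
      ∀ ε ∈ Set.Icc (0 : ℝ) (1 / 2), ratio μ ≤ H ε μ / (1 - ε) := by
  have hcont : ContinuousOn (fun ε => H ε μ / (1 - ε)) (Set.Icc 0 (1 / 2)) := by
    have h1 : Continuous fun ε => perf 0 μ ε 1 :=
      (perf_continuous hμ).comp (by fun_prop : Continuous fun x : ℝ => ((0 : ℝ), x))
    have h2 : ContinuousOn (fun ε => perf 0 μ ε 1 / (1 - ε)) (Set.Icc 0 (1 / 2)) :=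
      h1.continuousOn.div (by fun_prop) fun ε hε => by linarith [hε.2]
    exact h2.congr fun ε hε => by simp only [H_eq_perf hμ hε.1]
  obtain ⟨ε₀, hε₀, hmin⟩ := isCompact_Icc.exists_isMinOn
    (Set.nonempty_Icc.mpr (by norm_num : (0 : ℝ) ≤ 1 / 2)) hcont
  have hleast : IsLeast ((fun ε => H ε μ / (1 - ε)) '' Set.Icc 0 (1 / 2)) (H ε₀ μ / (1 - ε₀)) :=
    ⟨Set.mem_image_of_mem _ hε₀, by
      rintro _ ⟨ε, hε, rfl⟩
      exact hmin hε⟩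
  refine ⟨ε₀, hε₀, hleast.csInf_eq, fun ε hε => ?_⟩
  rw [ratio, hleast.csInf_eq]
  exact hmin hε

/-- Joint uniform continuity on the unit square. The same radius later serves as θ and as a bound
for the grid step γ. -/
theorem exists_perf_approx {μ η : ℝ} (hμ : 0 < μ) (hη : 0 < η) :
    ∃ r : ℝ, 0 < r ∧ r < 1 ∧ ∀ θ ∈ Set.Icc 0 r, ∀ ε ∈ Set.Icc (0 : ℝ) 1, ∀ ε' ∈ Set.Icc (0 : ℝ) 1,
      |ε' - ε| ≤ r → perf 0 μ ε 1 - η ≤ perf θ μ ε' 1 := by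
  have hK : IsCompact (Set.Icc (0 : ℝ) 1 ×ˢ Set.Icc (0 : ℝ) 1) := isCompact_Icc.prod isCompact_Icc
  have huc := hK.uniformContinuousOn_of_continuous (perf_continuous hμ).continuousOn
  rw [Metric.uniformContinuousOn_iff] at huc
  obtain ⟨d, hd, h⟩ := huc η hη
  have hr1 : min (d / 2) (1 / 2) ≤ d / 2 := min_le_left _ _
  have hr2 : min (d / 2) (1 / 2) ≤ 1 / 2 := min_le_right _ _
  refine ⟨min (d / 2) (1 / 2), by positivity, by linarith, fun θ hθ ε hε ε' hε' hd' => ?_⟩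
  have := h (0, ε) ⟨⟨le_rfl, zero_le_one⟩, hε⟩ (θ, ε') ⟨⟨hθ.1, by linarith [hθ.2]⟩, hε'⟩ (by
    rw [Prod.dist_eq, max_lt_iff, Real.dist_eq, Real.dist_eq, abs_sub_comm, abs_sub_comm ε,
      sub_zero, abs_of_nonneg hθ.1]
    exact ⟨by linarith [hθ.2], by linarith⟩)
  rw [Real.dist_eq, abs_lt] at this
  simp only at this
  linarith [this.2]

end

section


/-! ## Edge sums -/

namespace MultiGraph

variable {V : Type} [Fintype V] [DecidableEq V] (G : MultiGraph V)

/-- The indicator function of a finite set, with real values. -/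
def ind (A : Finset V) (i : V) : ℝ := if i ∈ A then 1 else 0

theorem ind_of_mem {A : Finset V} {i : V} (h : i ∈ A) : ind A i = 1 := if_pos h

theorem ind_of_notMem {A : Finset V} {i : V} (h : i ∉ A) : ind A i = 0 := if_neg h

theorem ind_compl (A : Finset V) (i : V) : ind Aᶜ i = 1 - ind A i := by
  by_cases h : i ∈ A <;> simp [ind, h]

/-- The sum of `F` over all ordered pairs of vertices, weighted by multiplicities. -/
def esum (F : V → V → ℝ) : ℝ := ∑ i, ∑ j, (G.mult i j : ℝ) * F i j

theorem esum_swap (F : V → V → ℝ) : G.esum (fun i j => F j i) = G.esum F := by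
  unfold esum
  rw [Finset.sum_comm]
  simp_rw [G.symm]

theorem esum_add (F F' : V → V → ℝ) :
    G.esum (fun i j => F i j + F' i j) = G.esum F + G.esum F' := by
  simp only [esum, mul_add, Finset.sum_add_distrib]

theorem esum_mul_left (c : ℝ) (F : V → V → ℝ) :
    G.esum (fun i j => c * F i j) = c * G.esum F := by
  simp only [esum, Finset.mul_sum]
  simp_rw [mul_left_comm]

theorem esum_sub (F F' : V → V → ℝ) :
    G.esum (fun i j => F i j - F' i j) = G.esum F - G.esum F' := by
  simp only [esum, mul_sub, Finset.sum_sub_distrib]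

theorem esum_sum {ι : Type} (s : Finset ι) (F : ι → V → V → ℝ) :
    G.esum (fun i j => ∑ r ∈ s, F r i j) = ∑ r ∈ s, G.esum (F r) := by
  simp only [esum, Finset.mul_sum]
  rw [Finset.sum_comm]
  conv_rhs => rw [Finset.sum_comm]; enter [2, x]; rw [Finset.sum_comm]
  rw [Finset.sum_comm]

theorem esum_mono {F F' : V → V → ℝ} (h : ∀ i j, F i j ≤ F' i j) : G.esum F ≤ G.esum F' :=
  Finset.sum_le_sum fun i _ => Finset.sum_le_sum fun j _ =>
    mul_le_mul_of_nonneg_left (h i j) (Nat.cast_nonneg _)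

theorem esum_nonneg {F : V → V → ℝ} (h : ∀ i j, 0 ≤ F i j) : 0 ≤ G.esum F :=
  Finset.sum_nonneg fun i _ => Finset.sum_nonneg fun j _ =>
    mul_nonneg (Nat.cast_nonneg _) (h i j)

/-- Multiplicities are symmetric, so only the symmetrization of the summand matters. Identities
between edge counts thereby reduce to pointwise identities between indicators. -/
theorem esum_congr_symm {F F' : V → V → ℝ} (h : ∀ i j, F i j + F j i = F' i j + F' j i) :
    G.esum F = G.esum F' := by
  have h1 : ∀ F : V → V → ℝ, G.esum (fun i j => F i j + F j i) = 2 * G.esum F := fun F => by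
    rw [esum_add, esum_swap, two_mul]
  have h2 := h1 F
  simp_rw [h] at h2
  rw [h1] at h2
  linarith

theorem esum_left (x : V → ℝ) : G.esum (fun i _ => x i) = ∑ i, (G.deg i : ℝ) * x i := by
  simp only [esum, deg, Nat.cast_sum, Finset.sum_mul]

theorem esum_right (x : V → ℝ) : G.esum (fun _ j => x j) = ∑ i, (G.deg i : ℝ) * x i := by
  rw [← esum_left, ← esum_swap]

theorem vol_eq : (G.vol : ℝ) = G.esum fun _ _ => 1 := by
  rw [G.esum_left fun _ => 1]
  simp [vol]

theorem between_eq (A B : Finset V) :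
    (G.between A B : ℝ) = G.esum fun i j => ind A i * ind B j := by
  unfold between esum ind
  push_cast
  simp

theorem induce_esum (U : Finset V) (F : V → V → ℝ) :
    (G.induce U).esum F = G.esum fun i j => ind U i * ind U j * F i j := by
  unfold esum
  refine Finset.sum_congr rfl fun i _ => Finset.sum_congr rfl fun j _ => ?_
  by_cases hi : i ∈ U <;> by_cases hj : j ∈ U <;> simp [induce, ind, hi, hj]

/-- The number of edges that the cut `(L, V ∖ L)` does not cut. -/
def uncut (L : Finset V) : ℝ := (G.vol : ℝ) / 2 - G.between L Lᶜ

theorem uncut_eq (L : Finset V) :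
    G.uncut L = G.esum fun i j => (ind L i * ind L j + (1 - ind L i) * (1 - ind L j)) / 2 := by
  have : G.uncut L = G.esum fun i j => (1 / 2 : ℝ) * 1 - ind L i * ind Lᶜ j := by
    rw [esum_sub, esum_mul_left, ← vol_eq, ← between_eq, uncut]
    ring
  rw [this]
  refine G.esum_congr_symm fun i j => ?_
  simp only [ind_compl]
  ring

theorem ind_nonneg (A : Finset V) (i : V) : 0 ≤ ind A i := by
  unfold ind
  split_ifs <;> norm_num

theorem ind_le_one (A : Finset V) (i : V) : ind A i ≤ 1 := by
  unfold ind
  split_ifs <;> norm_num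

theorem uncut_nonneg (L : Finset V) : 0 ≤ G.uncut L := by
  rw [uncut_eq]
  refine G.esum_nonneg fun i j => ?_
  have h1 := ind_nonneg L i
  have h2 := ind_nonneg L j
  have h3 := ind_le_one L i
  have h4 := ind_le_one L j
  have := mul_nonneg h1 h2
  have := mul_nonneg (sub_nonneg.mpr h3) (sub_nonneg.mpr h4)
  linarith

theorem uncut_le (L : Finset V) : G.uncut L ≤ G.vol / 2 := by
  unfold uncut
  linarith [Nat.cast_nonneg (α := ℝ) (G.between L Lᶜ)]

theorem uncut_induce_mono {U U' : Finset V} (h : U' ⊆ U) (L : Finset V) :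
    (G.induce U').uncut L ≤ (G.induce U).uncut L := by
  rw [uncut_eq, uncut_eq, induce_esum, induce_esum]
  refine G.esum_mono fun i j => mul_le_mul_of_nonneg_right ?_ ?_
  · have : ∀ i, ind U' i ≤ ind U i := fun i => by
      by_cases hi : i ∈ U'
      · simp [ind, hi, h hi]
      · simpa [ind, hi] using ind_nonneg U i
    exact mul_le_mul (this i) (this j) (ind_nonneg _ _) (ind_nonneg _ _)
  · have h1 := ind_nonneg L i
    have h2 := ind_nonneg L j
    have h3 := ind_le_one L i
    have h4 := ind_le_one L j
    have := mul_nonneg h1 h2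
    have := mul_nonneg (sub_nonneg.mpr h3) (sub_nonneg.mpr h4)
    linarith

theorem induce_univ : G.induce Finset.univ = G := by
  cases G
  simp [induce]

theorem cutValue_eq (h : G.vol ≠ 0) (L : Finset V) :
    G.cutValue L = 1 - G.uncut L / (G.vol / 2) := by
  have : (G.vol : ℝ) ≠ 0 := Nat.cast_ne_zero.mpr h
  unfold cutValue uncut
  field_simp
  ring

theorem ind_union {A B : Finset V} (h : Disjoint A B) (i : V) :
    ind (A ∪ B) i = ind A i + ind B i := by
  by_cases hA : i ∈ A
  · simp [ind, hA, Finset.disjoint_left.mp h hA]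
  · by_cases hB : i ∈ B <;> simp [ind, hA, hB]

theorem inc_eq (A B : Finset V) :
    G.inc A B = G.esum fun i j =>
      (ind (A ∪ B) i + ind (A ∪ B) j - ind (A ∪ B) i * ind (A ∪ B) j) / 2 := by
  have : G.inc A B = G.esum fun i j =>
      (1 / 2 : ℝ) * (ind (A ∪ B) i * ind (A ∪ B) j) + ind (A ∪ B) i * ind (A ∪ B)ᶜ j := by
    rw [esum_add, esum_mul_left, ← between_eq, ← between_eq, inc, cross]
    ring
  rw [this]
  refine G.esum_congr_symm fun i j => ?_
  simp only [ind_compl]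
  ring

theorem cut_eq {A B : Finset V} (h : Disjoint A B) :
    G.cut A B = G.esum fun i j =>
      (ind (A ∪ B) i + ind (A ∪ B) j - ind (A ∪ B) i * ind (A ∪ B) j -
        (ind A i - ind B i) * (ind A j - ind B j)) / 4 := by
  have : G.cut A B = G.esum fun i j =>
      ind A i * ind B j + (1 / 2 : ℝ) * (ind (A ∪ B) i * ind (A ∪ B)ᶜ j) := by
    rw [esum_add, esum_mul_left, ← between_eq, ← between_eq, cut, cross, good]
    ring
  rw [this]
  refine G.esum_congr_symm fun i j => ?_
  simp only [ind_compl, ind_union h]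
  ring

theorem inc_nonneg (A B : Finset V) : 0 ≤ G.inc A B := by
  unfold inc cross
  positivity

theorem cut_le_inc {A B : Finset V} (h : Disjoint A B) : G.cut A B ≤ G.inc A B := by
  rw [cut_eq G h, inc_eq]
  refine G.esum_mono fun i j => ?_
  simp only [ind_union h]
  by_cases h1 : i ∈ A <;> by_cases h2 : j ∈ A <;> by_cases h3 : i ∈ B <;> by_cases h4 : j ∈ B <;>
    simp [ind, h1, h2, h3, h4] <;> norm_num

theorem inc_le_sum_deg (A B : Finset V) : G.inc A B ≤ ∑ i ∈ A ∪ B, (G.deg i : ℝ) := by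
  have h1 : ∑ i ∈ A ∪ B, (G.deg i : ℝ) = G.esum fun i j => (ind (A ∪ B) i + ind (A ∪ B) j) / 2 := by
    have h2 : G.esum (fun i _ => ind (A ∪ B) i) = ∑ i ∈ A ∪ B, (G.deg i : ℝ) := by
      rw [esum_left]
      simp only [ind, mul_ite, mul_one, mul_zero, Finset.sum_ite_mem, Finset.univ_inter]
    rw [← h2]
    exact G.esum_congr_symm fun i j => by ring
  rw [h1, inc_eq]
  refine G.esum_mono fun i j => ?_
  have := mul_nonneg (ind_nonneg (A ∪ B) i) (ind_nonneg (A ∪ B) j)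
  linarith

theorem deg_induce_le (U : Finset V) (i : V) : (G.induce U).deg i ≤ G.deg i := by
  refine Finset.sum_le_sum fun j _ => ?_
  change (if _ then _ else _) ≤ _
  split_ifs <;> simp

theorem vol_induce_le (U : Finset V) : (G.induce U).vol ≤ G.vol :=
  Finset.sum_le_sum fun i _ => G.deg_induce_le U i

theorem deg_induce_of_notMem {U : Finset V} {i : V} (h : i ∉ U) : (G.induce U).deg i = 0 := by
  simp [deg, induce, h]

theorem deg_le_maxDeg (i : V) : G.deg i ≤ G.maxDeg := Finset.le_sup (f := G.deg) (Finset.mem_univ i)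

theorem inc_induce_le (U A B : Finset V) :
    (G.induce U).inc A B ≤ G.maxDeg * (A ∪ B).card := by
  refine (inc_le_sum_deg _ _ _).trans ?_
  have : ∀ i ∈ A ∪ B, ((G.induce U).deg i : ℝ) ≤ G.maxDeg := fun i _ =>
    Nat.cast_le.mpr ((G.deg_induce_le U i).trans (G.deg_le_maxDeg i))
  refine (Finset.sum_le_card_nsmul _ _ _ this).trans ?_
  rw [nsmul_eq_mul, mul_comm]

theorem ind_sdiff {U T : Finset V} (h : T ⊆ U) (i : V) : ind (U \ T) i = ind U i - ind T i := by
  by_cases hT : i ∈ T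
  · simp [ind, hT, h hT]
  · by_cases hU : i ∈ U <;> simp [ind, hT, hU]

theorem ind_mul_ind {U T : Finset V} (h : T ⊆ U) (i : V) : ind U i * ind T i = ind T i := by
  by_cases hT : i ∈ T
  · simp [ind, hT, h hT]
  · simp [ind, hT]

theorem inc_induce_eq {U A B : Finset V} (h : A ∪ B ⊆ U) :
    (G.induce U).inc A B = (G.induce U).vol / 2 - (G.induce (U \ (A ∪ B))).vol / 2 := by
  rw [inc_eq, vol_eq, vol_eq, induce_esum, induce_esum, induce_esum]
  rw [show ∀ x y : ℝ, x / 2 - y / 2 = (1 / 2) * (x - y) by intros; ring, ← esum_sub,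
    ← esum_mul_left]
  congr 1
  funext i j
  have e1 := ind_mul_ind h i
  have e2 := ind_mul_ind h j
  simp only [ind_sdiff h]
  linear_combination (1 / 2) * (ind U j - ind (A ∪ B) j * ind U j) * e1 +
    (1 / 2) * (ind U i - ind (A ∪ B) i) * e2

/-- The average over the coin of Simple. Flipping it does not affect edges within `A ∪ B` or within
the rest, and it flips every edge between the two, so exactly half of the latter are cut on average.
The proof checks all pairs of the five possible positions of a vertex. -/
theorem uncut_union_add {U A B L : Finset V} (hAB : Disjoint A B) (h : A ∪ B ⊆ U)
    (hL : L ⊆ U \ (A ∪ B)) :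
    (G.induce U).uncut (L ∪ A) + (G.induce U).uncut (L ∪ B) =
      2 * ((G.induce U).inc A B - (G.induce U).cut A B + (G.induce (U \ (A ∪ B))).uncut L) := by
  rw [inc_eq, cut_eq _ hAB, uncut_eq, uncut_eq, uncut_eq]
  simp only [induce_esum]
  rw [← esum_add, ← esum_sub, ← esum_add, ← esum_mul_left]
  refine G.esum_congr_symm fun i j => ?_
  have hLA : Disjoint L A := Finset.disjoint_left.mpr fun x hx hA => by
    have := hL hx
    simp [hA] at this
  have hLB : Disjoint L B := Finset.disjoint_left.mpr fun x hx hB => by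
    have := hL hx
    simp [hB] at this
  have key : ∀ x, (ind A x, ind B x, ind L x, ind U x) ∈
      ({(1, 0, 0, 1), (0, 1, 0, 1), (0, 0, 1, 1), (0, 0, 0, 1), (0, 0, 0, 0)} :
        Set (ℝ × ℝ × ℝ × ℝ)) := by
    intro x
    simp only [Set.mem_insert_iff, Set.mem_singleton_iff]
    by_cases hA : x ∈ A
    · left
      simp [ind, hA, h (Finset.mem_union_left B hA), Finset.disjoint_left.mp hAB hA,
        Finset.disjoint_right.mp hLA hA]
    · by_cases hB : x ∈ B
      · right; left
        simp [ind, hA, hB, h (Finset.mem_union_right A hB), Finset.disjoint_right.mp hLB hB]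
      · by_cases hLx : x ∈ L
        · right; right; left
          simp [ind, hA, hB, hLx, (Finset.mem_sdiff.mp (hL hLx)).1]
        · by_cases hU : x ∈ U <;> simp [ind, hA, hB, hLx, hU]
  have hi := key i
  have hj := key j
  simp only [Set.mem_insert_iff, Set.mem_singleton_iff, Prod.mk.injEq] at hi hj
  simp only [ind_sdiff h, ind_union hAB, ind_union hLA, ind_union hLB]
  rcases hi with ⟨h1, h2, h3, h4⟩ | ⟨h1, h2, h3, h4⟩ | ⟨h1, h2, h3, h4⟩ | ⟨h1, h2, h3, h4⟩ |
    ⟨h1, h2, h3, h4⟩ <;> rw [h1, h2, h3, h4] <;>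
  rcases hj with ⟨h1, h2, h3, h4⟩ | ⟨h1, h2, h3, h4⟩ | ⟨h1, h2, h3, h4⟩ | ⟨h1, h2, h3, h4⟩ |
    ⟨h1, h2, h3, h4⟩ <;> rw [h1, h2, h3, h4] <;> norm_num

/-- Toggling `i` in `L` is an involution that exchanges "same side" with "different sides". -/
theorem sum_same_side {U : Finset V} {i j : V} (hi : i ∈ U) (hij : i ≠ j) :
    ∑ L ∈ U.powerset, (ind L i * ind L j + (1 - ind L i) * (1 - ind L j)) =
      (U.powerset.card : ℝ) / 2 := by
  have h1 : ∑ L ∈ U.powerset, (ind L i * ind L j + (1 - ind L i) * (1 - ind L j)) =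
      ∑ L ∈ U.powerset, (1 - (ind L i * ind L j + (1 - ind L i) * (1 - ind L j))) := by
    have hmem : ∀ L ∈ U.powerset, symmDiff L {i} ∈ U.powerset := fun L hL => by
      rw [Finset.mem_powerset] at hL ⊢
      intro x hx
      rw [Finset.mem_symmDiff, Finset.mem_singleton] at hx
      rcases hx with hx | hx
      · exact hL hx.1
      · exact hx.1 ▸ hi
    refine Finset.sum_nbij' (fun L => symmDiff L {i}) (fun L => symmDiff L {i}) hmem hmem
      (fun L _ => by simp) (fun L _ => by simp) fun L _ => ?_
    by_cases h1 : i ∈ L <;> by_cases h2 : j ∈ L <;>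
      simp [ind, Finset.mem_symmDiff, h1, h2, hij.symm]
  rw [Finset.sum_sub_distrib, Finset.sum_const, nsmul_eq_mul, mul_one] at h1
  linarith

theorem sum_uncut_powerset (U : Finset V) :
    ∑ L ∈ U.powerset, (G.induce U).uncut L = U.powerset.card * ((G.induce U).vol / 4) := by
  simp_rw [uncut_eq]
  rw [← esum_sum, vol_eq, ← mul_div_assoc, mul_comm, mul_div_assoc, mul_comm, ← esum_mul_left]
  unfold esum
  refine Finset.sum_congr rfl fun i _ => Finset.sum_congr rfl fun j _ => ?_
  by_cases h : i ∈ U ∧ j ∈ U ∧ i ≠ j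
  · simp only
    rw [← Finset.sum_div, sum_same_side h.1 h.2.2]
    ring
  · have : (G.induce U).mult i j = 0 := by
      change (if _ then _ else _) = 0
      split_ifs with h'
      · have : i = j := by
          by_contra hne
          exact h ⟨h'.1, h'.2, hne⟩
        rw [this, G.loopless]
      · rfl
    rw [this]
    simp

end MultiGraph

/-! ### Random sides and the maximum cut -/

open MaxCut.Comp MultiGraph

variable {V : Type} [Fintype V] [DecidableEq V]

theorem ev_randomSide (G : MultiGraph V) (U : Finset V) :
    ev (randomSide U) (fun L => ENNReal.ofReal ((G.induce U).uncut L)) ≤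
      ENNReal.ofReal ((G.induce U).vol / 4) := by
  unfold randomSide
  rw [ev_bind, ev_tick, ev_sample, pev_fintype]
  have hc : (0 : ℝ) < U.powerset.card := by
    rw [Finset.card_powerset]
    positivity
  have : ∀ L, PMF.uniformOfFinset U.powerset (Finset.powerset_nonempty U) L *
      ENNReal.ofReal ((G.induce U).uncut L) =
      if L ∈ U.powerset then ENNReal.ofReal ((G.induce U).uncut L / U.powerset.card) else 0 := by
    intro L
    rw [PMF.uniformOfFinset_apply]
    split_ifs
    · rw [ENNReal.ofReal_div_of_pos hc, ENNReal.ofReal_natCast, mul_comm, div_eq_mul_inv]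
    · simp
  simp_rw [this]
  rw [Finset.sum_ite_mem, Finset.univ_inter, ← ENNReal.ofReal_sum_of_nonneg, ← Finset.sum_div,
    sum_uncut_powerset, mul_div_cancel_left₀ _ hc.ne']
  intro L _
  exact div_nonneg (uncut_nonneg _ _) hc.le

theorem half_le_maxcut (G : MultiGraph V) (h : G.vol ≠ 0) : 1 / 2 ≤ G.maxcut := by
  have h0 : (0 : ℝ) < G.vol := Nat.cast_pos.mpr (Nat.pos_of_ne_zero h)
  have h1 := sum_uncut_powerset G Finset.univ
  rw [induce_univ] at h1
  obtain ⟨L, -, hL⟩ := Finset.exists_le_of_sum_le (s := (Finset.univ : Finset V).powerset)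
    (f := G.uncut) (g := fun _ => (G.vol : ℝ) / 4) (Finset.powerset_nonempty _) (by
      rw [h1, Finset.sum_const, nsmul_eq_mul])
  refine le_trans ?_ (le_ciSup (Set.finite_range G.cutValue).bddAbove L)
  rw [cutValue_eq G h]
  have : G.uncut L / (G.vol / 2) ≤ 1 / 2 := by
    rw [div_le_iff₀ (by linarith)]
    linarith
  linarith

theorem exists_uncut_eq (G : MultiGraph V) (h : G.vol ≠ 0) {ε : ℝ} (hε : G.maxcut = 1 - ε) :
    0 ≤ ε ∧ ∃ X, G.uncut X = ε * (G.vol / 2) := by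
  have h0 : (0 : ℝ) < G.vol := Nat.cast_pos.mpr (Nat.pos_of_ne_zero h)
  obtain ⟨X, hX⟩ := exists_eq_ciSup_of_finite (f := G.cutValue)
  have : G.cutValue X = 1 - ε := hX.trans hε
  rw [cutValue_eq G h] at this
  have h2 : ε = G.uncut X / (G.vol / 2) := by linarith
  refine ⟨h2 ▸ div_nonneg (uncut_nonneg _ _) (by linarith), X, ?_⟩
  rw [h2]
  field_simp

end

section


open MultiGraph

variable {V : Type} [Fintype V] [DecidableEq V]

/-! ## Spectral estimates -/

section Spectral

open Matrix

theorem exists_eigenbasis {N : Matrix V V ℝ} (hN : N.IsHermitian) :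
    ∃ (b : Matrix V V ℝ) (lam : V → ℝ), b * bᵀ = 1 ∧ bᵀ * b = 1 ∧ N = b * diagonal lam * bᵀ := by
  have h := hN.spectral_theorem
  refine ⟨hN.eigenvectorUnitary, hN.eigenvalues, ?_, ?_, ?_⟩
  · exact Unitary.coe_mul_star_self hN.eigenvectorUnitary
  · exact Unitary.coe_star_mul_self hN.eigenvectorUnitary
  · rw [Unitary.conjStarAlgAut_apply] at h
    exact h

theorem pow_eq_of_eigenbasis {N b : Matrix V V ℝ} {lam : V → ℝ} (h1 : b * bᵀ = 1)
    (h2 : bᵀ * b = 1) (hN : N = b * diagonal lam * bᵀ) (l : ℕ) :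
    N ^ l = b * diagonal (fun k => lam k ^ l) * bᵀ := by
  induction l with
  | zero => simp [h1]
  | succ l ih =>
    rw [pow_succ, ih, hN]
    calc b * diagonal (fun k => lam k ^ l) * bᵀ * (b * diagonal lam * bᵀ)
        = b * diagonal (fun k => lam k ^ l) * (bᵀ * b) * diagonal lam * bᵀ := by
          simp only [Matrix.mul_assoc]
      _ = b * diagonal (fun k => lam k ^ (l + 1)) * bᵀ := by
          rw [h2, Matrix.mul_one, Matrix.mul_assoc b, diagonal_mul_diagonal]
          simp_rw [pow_succ]

theorem apply_of_eigenbasis (b : Matrix V V ℝ) (lam : V → ℝ) (i j : V) :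
    (b * diagonal lam * bᵀ) i j = ∑ k, lam k * (b i k * b j k) := by
  rw [Matrix.mul_apply]
  refine Finset.sum_congr rfl fun k _ => ?_
  rw [mul_diagonal, transpose_apply]
  ring

/-- The lazy walk operator `(1 - D^(-1/2) M D^(-1/2)) / 2`, in which hops carry a sign. -/
def lazyOp (G : MultiGraph V) : Matrix V V ℝ :=
  fun i j => ((if i = j then 1 else 0) - G.mult i j / (√(G.deg i) * √(G.deg j))) / 2

variable (G : MultiGraph V)

theorem lazyOp_isHermitian : (lazyOp G).IsHermitian := by
  ext i j
  simp only [conjTranspose_apply, star_trivial, lazyOp]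
  have h : (if j = i then (1 : ℝ) else 0) = if i = j then 1 else 0 := by simp only [eq_comm]
  rw [G.symm, mul_comm (√_), h]

theorem lazyOp_quadratic (x : V → ℝ) :
    x ⬝ᵥ lazyOp G *ᵥ x = ((∑ i, x i ^ 2) -
      G.esum fun i j => (x i / √(G.deg i)) * (x j / √(G.deg j))) / 2 := by
  simp only [dotProduct, mulVec, lazyOp, esum, ← Finset.sum_sub_distrib, Finset.sum_div,
    Finset.mul_sum]
  refine Finset.sum_congr rfl fun i _ => ?_
  rw [show x i ^ 2 = ∑ j, if i = j then x i * x j else 0 by simp [sq], ← Finset.sum_sub_distrib,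
    Finset.sum_div]
  refine Finset.sum_congr rfl fun j _ => ?_
  split_ifs <;> ring

/-- The Dirichlet-type form `∑ (x i - x j)² / 2` over the edges. -/
def energy (x : V → ℝ) : ℝ := G.esum fun i j => (x i - x j) ^ 2 / 4

/-- The squared norm weighted by degrees. -/
def normSq (x : V → ℝ) : ℝ := ∑ i, (G.deg i : ℝ) * x i ^ 2

theorem energy_nonneg (x : V → ℝ) : 0 ≤ energy G x :=
  G.esum_nonneg fun _ _ => by positivity

theorem normSq_nonneg (x : V → ℝ) : 0 ≤ normSq G x :=
  Finset.sum_nonneg fun _ _ => by positivity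

theorem esum_sq_add_sq (x : V → ℝ) :
    G.esum (fun i j => x i ^ 2 + x j ^ 2) = 2 * normSq G x := by
  rw [G.esum_add (fun i _ => x i ^ 2) (fun _ j => x j ^ 2), G.esum_left fun i => x i ^ 2,
    G.esum_right fun i => x i ^ 2, normSq]
  ring

theorem energy_eq (x : V → ℝ) :
    energy G x = (normSq G x - G.esum fun i j => x i * x j) / 2 := by
  have : energy G x = G.esum fun i j => (1 / 4 : ℝ) * (x i ^ 2 + x j ^ 2) -
      (1 / 2) * (x i * x j) := by
    unfold energy
    congr 1
    funext i j
    ring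
  rw [this, esum_sub, esum_mul_left, esum_mul_left, esum_sq_add_sq]
  ring

theorem energy_add_esum (x : V → ℝ) :
    energy G x + (G.esum fun i j => (x i + x j) ^ 2) / 4 = normSq G x := by
  have : (G.esum fun i j => (x i + x j) ^ 2) =
      G.esum fun i j => 2 * (x i ^ 2 + x j ^ 2) - 4 * ((x i - x j) ^ 2 / 4) := by
    congr 1
    funext i j
    ring
  rw [this, esum_sub, esum_mul_left, esum_mul_left, esum_sq_add_sq, ← energy]
  ring

theorem energy_le_normSq (x : V → ℝ) : energy G x ≤ normSq G x := by
  have := energy_add_esum G x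
  have : 0 ≤ G.esum fun i j => (x i + x j) ^ 2 := G.esum_nonneg fun _ _ => by positivity
  linarith

theorem normSq_div_sqrt_le (x : V → ℝ) :
    normSq G (fun i => x i / √(G.deg i)) ≤ ∑ i, x i ^ 2 := by
  refine Finset.sum_le_sum fun i _ => ?_
  rw [div_pow, Real.sq_sqrt (Nat.cast_nonneg _)]
  rcases eq_or_ne (G.deg i : ℝ) 0 with h | h
  · rw [h, zero_mul]
    positivity
  · rw [mul_div_cancel₀ _ h]

theorem normSq_div_sqrt_eq {x : V → ℝ} (hx : ∀ i, G.deg i = 0 → x i = 0) :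
    normSq G (fun i => x i / √(G.deg i)) = ∑ i, x i ^ 2 := by
  refine Finset.sum_congr rfl fun i _ => ?_
  rw [div_pow, Real.sq_sqrt (Nat.cast_nonneg _)]
  rcases eq_or_ne (G.deg i) 0 with h | h
  · simp [hx i h]
  · rw [mul_div_cancel₀ _ (Nat.cast_ne_zero.mpr h)]

/-- The form is the energy of x / √deg plus half the mass of x on isolated vertices, and the energy
lies between 0 and the weighted norm. -/
theorem lazyOp_quadratic_mem (x : V → ℝ) :
    x ⬝ᵥ lazyOp G *ᵥ x ∈ Set.Icc 0 (∑ i, x i ^ 2) := by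
  have h1 := lazyOp_quadratic G x
  have h2 := energy_eq G fun i => x i / √(G.deg i)
  have h3 := energy_nonneg G fun i => x i / √(G.deg i)
  have h4 := energy_le_normSq G fun i => x i / √(G.deg i)
  have h5 := normSq_div_sqrt_le G x
  constructor <;> linarith

theorem lazyOp_quadratic_eq {x : V → ℝ} (hx : ∀ i, G.deg i = 0 → x i = 0) :
    x ⬝ᵥ lazyOp G *ᵥ x = energy G fun i => x i / √(G.deg i) := by
  rw [lazyOp_quadratic, energy_eq, normSq_div_sqrt_eq G hx]

theorem lazyOp_apply_of_deg_eq_zero {i : V} (h : G.deg i = 0) (j : V) :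
    lazyOp G i j = (if i = j then 1 else 0) / 2 := by
  simp [lazyOp, h]

/-- Division by zero gives 0, so the row of an isolated vertex has only the diagonal entry 1/2.
Induced subgraphs do contain such vertices, and this keeps them out of the walk vectors. -/
theorem lazyOp_pow_apply_of_deg_eq_zero {i j : V} (h : G.deg i = 0) (hij : i ≠ j) (l : ℕ) :
    (lazyOp G ^ l) i j = 0 := by
  induction l with
  | zero => simp [hij]
  | succ l ih =>
    rw [pow_succ', Matrix.mul_apply]
    refine Finset.sum_eq_zero fun k _ => ?_
    rw [lazyOp_apply_of_deg_eq_zero G h]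
    split_ifs with hk
    · rw [← hk, ih, mul_zero]
    · simp

theorem lazyOp_pow_symm (l : ℕ) (i j : V) : (lazyOp G ^ l) i j = (lazyOp G ^ l) j i := by
  have := (lazyOp_isHermitian G).pow l
  have := this.apply j i
  simpa using this

theorem quadratic_eq_of_eigenbasis {N b : Matrix V V ℝ} {lam : V → ℝ}
    (hN : N = b * diagonal lam * bᵀ) (x : V → ℝ) :
    x ⬝ᵥ N *ᵥ x = ∑ k, lam k * (bᵀ *ᵥ x) k ^ 2 := by
  rw [hN, ← mulVec_mulVec, ← mulVec_mulVec, dotProduct_mulVec, ← mulVec_transpose]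
  simp only [dotProduct, mulVec_diagonal]
  exact Finset.sum_congr rfl fun k _ => by ring

theorem sum_sq_of_eigenbasis {b : Matrix V V ℝ} (h1 : b * bᵀ = 1) (x : V → ℝ) :
    ∑ k, (bᵀ *ᵥ x) k ^ 2 = ∑ i, x i ^ 2 := by
  have h : (bᵀ *ᵥ x) ⬝ᵥ (bᵀ *ᵥ x) = x ⬝ᵥ x := by
    rw [dotProduct_mulVec, vecMul_transpose, mulVec_mulVec, h1, one_mulVec]
  simpa [dotProduct, sq] using h

/-- Each eigenvalue is the quadratic form at a unit eigenvector. The holding probability 1/2 is what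
makes the eigenvalues nonnegative. -/
theorem lazyOp_eigenbasis : ∃ (b : Matrix V V ℝ) (lam : V → ℝ), b * bᵀ = 1 ∧ bᵀ * b = 1 ∧
    lazyOp G = b * diagonal lam * bᵀ ∧ ∀ k, lam k ∈ Set.Icc (0 : ℝ) 1 := by
  obtain ⟨b, lam, h1, h2, h3⟩ := exists_eigenbasis (lazyOp_isHermitian G)
  refine ⟨b, lam, h1, h2, h3, fun k => ?_⟩
  have h4 : bᵀ *ᵥ (fun i => b i k) = Pi.single k 1 := by
    have : (fun i => b i k) = b *ᵥ Pi.single k 1 := by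
      rw [mulVec_single_one]
      rfl
    rw [this, mulVec_mulVec, h2, one_mulVec]
  have h5 := quadratic_eq_of_eigenbasis h3 fun i => b i k
  have h6 := sum_sq_of_eigenbasis h1 fun i => b i k
  rw [h4] at h5 h6
  have h7 := lazyOp_quadratic_mem G fun i => b i k
  rw [← h6, h5] at h7
  simpa [Pi.single_apply] using h7

/-- Log-convexity: the Rayleigh quotient of `N ^ l e_i`. -/
theorem lazyOp_rayleigh (i : V) {l : ℕ} (hl : 0 < l) :
    (lazyOp G ^ (2 * l)) i i * (lazyOp G ^ (2 * l)) i i ^ (1 / (2 * l : ℝ)) ≤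
      (lazyOp G ^ (2 * l + 1)) i i := by
  obtain ⟨b, lam, h1, h2, h3, h4⟩ := lazyOp_eigenbasis G
  rw [pow_eq_of_eigenbasis h1 h2 h3, pow_eq_of_eigenbasis h1 h2 h3, apply_of_eigenbasis,
    apply_of_eigenbasis]
  have hw : ∑ k, b i k * b i k = 1 := by
    have := congrFun (congrFun h1 i) i
    rwa [Matrix.mul_apply, one_apply_eq] at this
  have hl' : (0 : ℝ) < 2 * l := by positivity
  -- Power mean inequality for the spectral measure of e_i; the exponent 1 + 1/(2l) takes λ^(2l) to
  -- λ^(2l+1).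
  have h := Real.rpow_arith_mean_le_arith_mean_rpow Finset.univ (fun k => b i k * b i k)
    (fun k => lam k ^ (2 * l)) (fun k _ => mul_self_nonneg _) hw
    (fun k _ => pow_nonneg (h4 k).1 _) (p := 1 + 1 / (2 * l : ℝ))
    (by have : 0 < 1 / (2 * l : ℝ) := by positivity
        linarith)
  have e1 : ∀ k, (lam k ^ (2 * l)) ^ (1 + 1 / (2 * l : ℝ)) = lam k ^ (2 * l + 1) := fun k => by
    rw [← Real.rpow_natCast, ← Real.rpow_mul (h4 k).1, ← Real.rpow_natCast]
    congr 1
    push_cast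
    field_simp
  simp_rw [e1, mul_comm (b i _ * b i _)] at h
  refine le_trans ?_ h
  have hnn : 0 ≤ ∑ k, lam k ^ (2 * l) * (b i k * b i k) :=
    Finset.sum_nonneg fun k _ => mul_nonneg (pow_nonneg (h4 k).1 _) (mul_self_nonneg _)
  rw [Real.rpow_add_of_nonneg hnn zero_le_one (by positivity), Real.rpow_one]

theorem lazyOp_pow_le_one (i : V) (l : ℕ) : (lazyOp G ^ l) i i ≤ 1 := by
  obtain ⟨b, lam, h1, h2, h3, h4⟩ := lazyOp_eigenbasis G
  rw [pow_eq_of_eigenbasis h1 h2 h3, apply_of_eigenbasis]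
  have hw : ∑ k, b i k * b i k = 1 := by
    have := congrFun (congrFun h1 i) i
    rwa [Matrix.mul_apply, one_apply_eq] at this
  rw [← hw]
  exact Finset.sum_le_sum fun k _ => mul_le_of_le_one_left (mul_self_nonneg _)
    (pow_le_one₀ (h4 k).1 (h4 k).2)

theorem sum_sq_lazyOp_pow (l : ℕ) (i : V) :
    ∑ j, (lazyOp G ^ l) j i ^ 2 = (lazyOp G ^ (2 * l)) i i := by
  rw [two_mul, pow_add, Matrix.mul_apply]
  refine Finset.sum_congr rfl fun j _ => ?_
  rw [lazyOp_pow_symm G l i j, sq]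

theorem quadratic_lazyOp_pow (l : ℕ) (i : V) :
    (fun j => (lazyOp G ^ l) j i) ⬝ᵥ lazyOp G *ᵥ (fun j => (lazyOp G ^ l) j i) =
      (lazyOp G ^ (2 * l + 1)) i i := by
  have e : lazyOp G ^ (2 * l + 1) = lazyOp G ^ l * (lazyOp G * lazyOp G ^ l) := by
    rw [← pow_succ', ← pow_add]
    congr 1
    omega
  rw [e, Matrix.mul_apply]
  simp only [dotProduct]
  refine Finset.sum_congr rfl fun j _ => ?_
  rw [lazyOp_pow_symm G l i j, Matrix.mul_apply]
  rfl

/-- If some cut misses few edges, then the walk operator has a large diagonal entry at many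
vertices. -/
theorem exists_good_starts {X : Finset V} {ε β : ℝ} (hvol : 0 < G.vol)
    (hX : G.uncut X ≤ ε * (G.vol / 2)) (hβ : 0 ≤ β) (hβε : β < 1 - ε) :
    ∃ B : Finset V, (1 - ε - β) / 4 * G.vol ≤ ∑ i ∈ B, (G.deg i : ℝ) ∧ ∀ i ∈ B, 0 < G.deg i ∧
      ∀ l : ℕ, β ^ (2 * l) * ((1 - ε - β) * G.deg i / (4 * G.vol)) ≤
        (lazyOp G ^ (2 * l)) i i := by
  classical
  obtain ⟨b, lam, h1, h2, h3, h4⟩ := lazyOp_eigenbasis G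
  have hm : (0 : ℝ) < G.vol := Nat.cast_pos.mpr hvol
  set x : V → ℝ := fun i => 2 * ind X i - 1 with hx
  have hx2 : ∀ i, x i ^ 2 = 1 := fun i => by
    simp only [hx]
    by_cases h : i ∈ X <;> simp [ind, h] <;> norm_num
  set u : V → ℝ := fun i => x i * √(G.deg i) / √G.vol with hu
  have hu2 : ∀ i, u i ^ 2 = G.deg i / G.vol := fun i => by
    simp only [hu]
    rw [div_pow, mul_pow, hx2, one_mul, Real.sq_sqrt (Nat.cast_nonneg _),
      Real.sq_sqrt (Nat.cast_nonneg _)]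
  have hun : ∑ i, u i ^ 2 = 1 := by
    simp_rw [hu2]
    rw [← Finset.sum_div, ← Nat.cast_sum, div_eq_one_iff_eq hm.ne']
    rfl
  -- `u` is the ±1 vector of the cut scaled by √deg to unit length; its quadratic form is the
  -- fraction of cut edges.
  have hquad : 1 - ε ≤ u ⬝ᵥ lazyOp G *ᵥ u := by
    rw [lazyOp_quadratic, hun]
    have e1 : (G.esum fun i j => (u i / √(G.deg i)) * (u j / √(G.deg j))) =
        G.esum fun i j => (1 / (G.vol : ℝ)) * (x i * x j) := by
      unfold esum
      refine Finset.sum_congr rfl fun i _ => Finset.sum_congr rfl fun j _ => ?_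
      rcases eq_or_ne (G.mult i j) 0 with h | h
      · simp [h]
      · have hi : 0 < G.deg i := lt_of_lt_of_le (Nat.pos_of_ne_zero h)
          (Finset.single_le_sum (f := G.mult i) (fun _ _ => Nat.zero_le _) (Finset.mem_univ j))
        have hj : 0 < G.deg j := lt_of_lt_of_le (Nat.pos_of_ne_zero (G.symm i j ▸ h))
          (Finset.single_le_sum (f := G.mult j) (fun _ _ => Nat.zero_le _) (Finset.mem_univ i))
        have hi' : √(G.deg i : ℝ) ≠ 0 := (Real.sqrt_pos.mpr (Nat.cast_pos.mpr hi)).ne'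
        have hj' : √(G.deg j : ℝ) ≠ 0 := (Real.sqrt_pos.mpr (Nat.cast_pos.mpr hj)).ne'
        have hm' : √(G.vol : ℝ) ≠ 0 := (Real.sqrt_pos.mpr hm).ne'
        have hmm : √(G.vol : ℝ) ^ 2 = G.vol := Real.sq_sqrt hm.le
        have e3 : 1 / (G.vol : ℝ) = 1 / √G.vol ^ 2 := by rw [hmm]
        simp only [hu]
        rw [e3]
        field_simp
    have e2 : (G.esum fun i j => x i * x j) = 4 * G.uncut X - G.vol := by
      rw [uncut_eq, vol_eq, ← esum_mul_left, ← esum_sub]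
      congr 1
      funext i j
      simp only [hx]
      ring
    rw [e1, esum_mul_left, e2]
    have : 1 / (G.vol : ℝ) * (4 * G.uncut X - G.vol) = 2 * (G.uncut X / (G.vol / 2)) - 1 := by
      field_simp
      ring
    rw [this]
    have : G.uncut X / (G.vol / 2) ≤ ε := by rwa [div_le_iff₀ (by linarith)]
    linarith
  set c : V → ℝ := bᵀ *ᵥ u with hc
  have hc1 : ∑ k, c k ^ 2 = 1 := by rw [hc, sum_sq_of_eigenbasis h1, hun]
  rw [quadratic_eq_of_eigenbasis h3, ← hc] at hquad
  -- The part of `u` in eigenspaces with eigenvalue at least `β`. As `u` has quotient at least 1 -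
  -- ε, its mass `C` is at least 1 - ε - β.
  set c' : V → ℝ := fun k => if β ≤ lam k then c k else 0 with hc'
  set C : ℝ := ∑ k, c' k ^ 2 with hC
  have hCβ : 1 - ε - β ≤ C := by
    have : ∑ k, lam k * c k ^ 2 ≤ ∑ k, (c' k ^ 2 + β * c k ^ 2) := by
      refine Finset.sum_le_sum fun k _ => ?_
      simp only [hc']
      split_ifs with h
      · nlinarith [(h4 k).2, sq_nonneg (c k), mul_le_mul_of_nonneg_right (h4 k).2 (sq_nonneg (c k)),
          mul_nonneg hβ (sq_nonneg (c k))]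
      · nlinarith [mul_le_mul_of_nonneg_right (not_le.mp h).le (sq_nonneg (c k))]
    rw [Finset.sum_add_distrib, ← Finset.mul_sum, hc1] at this
    linarith
  have hC0 : 0 < C := by linarith
  set h : V → ℝ := b *ᵥ c' with hh
  have hh2 : ∑ i, h i ^ 2 = C := by
    have := sum_sq_of_eigenbasis (b := bᵀ) (by rwa [transpose_transpose]) c'
    rwa [transpose_transpose] at this
  have huh : ∑ i, u i * h i = C := by
    have e : u ⬝ᵥ h = c ⬝ᵥ c' := by rw [hh, dotProduct_mulVec, ← mulVec_transpose]
    change u ⬝ᵥ h = C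
    rw [e]
    refine Finset.sum_congr rfl fun k _ => ?_
    simp only [hc']
    split_ifs <;> ring
  -- The vertices at which the projection `h` keeps at least half of its average correlation with
  -- `u`. The others contribute at most C/2 to ⟨u, h⟩ = C, so Cauchy–Schwarz on `B` gives it at
  -- least C/4 of the volume.
  set B : Finset V := Finset.univ.filter fun i => 0 < G.deg i ∧ C / 2 * u i ^ 2 ≤ u i * h i with hB
  refine ⟨B, ?_, fun i hi => ?_⟩
  · have hout : ∑ i ∈ Finset.univ.filter (fun i => ¬ (0 < G.deg i ∧ C / 2 * u i ^ 2 ≤ u i * h i)),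
        u i * h i ≤ C / 2 := by
      calc _ ≤ ∑ i ∈ Finset.univ.filter
            (fun i => ¬ (0 < G.deg i ∧ C / 2 * u i ^ 2 ≤ u i * h i)), C / 2 * u i ^ 2 := by
            refine Finset.sum_le_sum fun i hi => ?_
            rw [Finset.mem_filter, not_and_or] at hi
            rcases hi.2 with h0 | h0
            · have : u i = 0 := by
                have := hu2 i
                rw [Nat.eq_zero_of_not_pos h0, Nat.cast_zero, zero_div] at this
                exact pow_eq_zero_iff two_ne_zero |>.mp this
              simp [this]
            · exact (not_le.mp h0).le
        _ ≤ ∑ i, C / 2 * u i ^ 2 := Finset.sum_le_univ_sum_of_nonneg fun i => by positivity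
        _ = C / 2 := by rw [← Finset.mul_sum, hun, mul_one]
    have hsplit := Finset.sum_filter_add_sum_filter_not Finset.univ
      (fun i => 0 < G.deg i ∧ C / 2 * u i ^ 2 ≤ u i * h i) fun i => u i * h i
    rw [huh] at hsplit
    have hin : C / 2 ≤ ∑ i ∈ B, u i * h i := by linarith
    have hcs := Finset.sum_mul_sq_le_sq_mul_sq B u h
    have hhB : ∑ i ∈ B, h i ^ 2 ≤ C := by
      rw [← hh2]
      exact Finset.sum_le_univ_sum_of_nonneg fun i => by positivity
    have huB : ∑ i ∈ B, u i ^ 2 = (∑ i ∈ B, (G.deg i : ℝ)) / G.vol := by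
      rw [Finset.sum_div]
      exact Finset.sum_congr rfl fun i _ => hu2 i
    have hu0 : 0 ≤ ∑ i ∈ B, u i ^ 2 := Finset.sum_nonneg fun i _ => by positivity
    have h5 : (C / 2) ^ 2 ≤ (∑ i ∈ B, u i ^ 2) * C :=
      (pow_le_pow_left₀ (by linarith) hin 2).trans
        (hcs.trans (mul_le_mul_of_nonneg_left hhB hu0))
    have h6 : C / 4 ≤ ∑ i ∈ B, u i ^ 2 := by
      refine le_of_mul_le_mul_right ?_ hC0
      linarith [show (C / 2) ^ 2 = C / 4 * C by ring]
    rw [huB, le_div_iff₀ hm] at h6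
    exact le_trans (mul_le_mul_of_nonneg_right (by linarith) hm.le) h6
  · rw [hB, Finset.mem_filter] at hi
    obtain ⟨-, hd, hi⟩ := hi
    refine ⟨hd, fun l => ?_⟩
    rw [pow_eq_of_eigenbasis h1 h2 h3, apply_of_eigenbasis]
    have hui : 0 < u i ^ 2 := by
      rw [hu2]
      exact div_pos (Nat.cast_pos.mpr hd) hm
    -- The mass of e_i in the same eigenspaces. Cauchy–Schwarz gives h_i² ≤ C T, and with the choice
    -- of `B` this makes `T` at least C u_i² / 4.
    set T : ℝ := ∑ k, if β ≤ lam k then b i k ^ 2 else 0 with hT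
    have hT1 : h i ^ 2 ≤ C * T := by
      have e : h i = ∑ k, c' k * (if β ≤ lam k then b i k else 0) := by
        simp only [hh, mulVec, dotProduct, hc']
        refine Finset.sum_congr rfl fun k _ => ?_
        split_ifs <;> ring
      have := Finset.sum_mul_sq_le_sq_mul_sq Finset.univ c'
        (fun k => if β ≤ lam k then b i k else 0)
      rw [← e] at this
      refine this.trans (le_of_eq ?_)
      congr 1
      refine Finset.sum_congr rfl fun k _ => ?_
      split_ifs <;> ring
    have hT2 : (C / 2) ^ 2 * u i ^ 2 ≤ h i ^ 2 := by
      have h5 : (C / 2 * u i ^ 2) ^ 2 ≤ (u i * h i) ^ 2 :=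
        pow_le_pow_left₀ (by positivity) hi 2
      refine le_of_mul_le_mul_left ?_ hui
      linarith [show (C / 2 * u i ^ 2) ^ 2 = u i ^ 2 * ((C / 2) ^ 2 * u i ^ 2) by ring,
        show (u i * h i) ^ 2 = u i ^ 2 * h i ^ 2 by ring]
    have hT3 : C / 4 * u i ^ 2 ≤ T := by
      refine le_of_mul_le_mul_left ?_ hC0
      linarith [show (C / 2) ^ 2 * u i ^ 2 = C * (C / 4 * u i ^ 2) by ring]
    calc β ^ (2 * l) * ((1 - ε - β) * G.deg i / (4 * G.vol))
        ≤ β ^ (2 * l) * T := by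
          refine mul_le_mul_of_nonneg_left (le_trans ?_ hT3) (pow_nonneg hβ _)
          rw [hu2]
          rw [show (1 - ε - β) * (G.deg i : ℝ) / (4 * G.vol) =
            (1 - ε - β) / 4 * (G.deg i / G.vol) by field_simp]
          exact mul_le_mul_of_nonneg_right (by linarith) (by positivity)
      _ ≤ _ := by
          rw [hT, Finset.mul_sum]
          refine Finset.sum_le_sum fun k _ => ?_
          split_ifs with hk
          · rw [sq]
            exact mul_le_mul_of_nonneg_right (pow_le_pow_left₀ hβ hk _) (mul_self_nonneg _)
          · rw [mul_zero]
            exact mul_nonneg (pow_nonneg (h4 k).1 _) (mul_self_nonneg _)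

end Spectral

end

section


open MultiGraph MaxCut.Comp

variable {V : Type} [Fintype V] [DecidableEq V] (G : MultiGraph V)

/-! ## Random walks -/

theorem proportional_apply (f : V → ℕ) (h : ∑ v, f v ≠ 0) (v : V) :
    proportional f h v = ENNReal.ofReal ((f v : ℝ) / ∑ v, (f v : ℝ)) := by
  unfold proportional
  have h0 : (0 : ℝ) < ∑ v, (f v : ℝ) := by
    rw [← Nat.cast_sum]
    exact Nat.cast_pos.mpr (Nat.pos_of_ne_zero h)
  rw [PMF.normalize_apply, tsum_fintype, ENNReal.ofReal_div_of_pos h0, ← Nat.cast_sum,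
    ← Nat.cast_sum, ENNReal.ofReal_natCast, ENNReal.ofReal_natCast, div_eq_mul_inv]

theorem neighbour_toReal {i : V} (h : 0 < G.deg i) (k : V) :
    (neighbour G i k).toReal = G.mult i k / G.deg i := by
  unfold neighbour
  rw [dif_pos (show ∑ k, G.mult i k ≠ 0 from h.ne'), proportional_apply,
    ENNReal.toReal_ofReal (by positivity), ← Nat.cast_sum]
  rfl

/-- The transition probabilities of `l` steps of the lazy walk with parities. -/
def walkKer : ℕ → V × Bool → V × Bool → ℝ
  | 0, s, s' => if s = s' then 1 else 0
  | l + 1, s, s' => (walkKer l s s' +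
      ∑ k, (neighbour G s.1 k).toReal * walkKer l (k, !s.2) s') / 2

theorem walkKer_nonneg (l : ℕ) (s s' : V × Bool) : 0 ≤ walkKer G l s s' := by
  induction l generalizing s with
  | zero =>
    rw [walkKer]
    split_ifs <;> norm_num
  | succ l ih =>
    rw [walkKer]
    have : 0 ≤ ∑ k, (neighbour G s.1 k).toReal * walkKer G l (k, !s.2) s' :=
      Finset.sum_nonneg fun k _ => mul_nonneg ENNReal.toReal_nonneg (ih _)
    linarith [ih s]

theorem ev_coin (φ : Bool → ℝ≥0∞) :
    pev (PMF.uniformOfFintype Bool) φ = (φ true + φ false) / 2 := by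
  rw [pev_fintype]
  simp only [PMF.uniformOfFintype_apply, Fintype.card_bool, Fintype.sum_bool, Nat.cast_ofNat]
  rw [← mul_add, mul_comm, div_eq_mul_inv]

theorem ev_walk_ofReal (l : ℕ) (s : V × Bool) (ψ : V × Bool → ℝ) (hψ : ∀ s, 0 ≤ ψ s) :
    ev (walk G l s) (fun s' => ENNReal.ofReal (ψ s')) =
      ENNReal.ofReal (∑ s', walkKer G l s s' * ψ s') := by
  induction l generalizing s with
  | zero =>
    rw [walk, ev_pure]
    simp [walkKer]
  | succ l ih =>
    rw [walk, ev_bind, ev_tick, ev_bind, ev_sample, ev_coin]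
    simp only [if_true, Bool.false_eq_true, if_false]
    rw [ev_bind, ev_sample, ih, pev_fintype]
    simp_rw [ih]
    have hn : ∀ s, 0 ≤ ∑ s', walkKer G l s s' * ψ s' := fun s =>
      Finset.sum_nonneg fun s' _ => mul_nonneg (walkKer_nonneg G l s s') (hψ s')
    have e1 : ∀ k, neighbour G s.1 k * ENNReal.ofReal (∑ s', walkKer G l (k, !s.2) s' * ψ s') =
        ENNReal.ofReal ((neighbour G s.1 k).toReal *
          ∑ s', walkKer G l (k, !s.2) s' * ψ s') := fun k => by
      rw [ENNReal.ofReal_mul ENNReal.toReal_nonneg, ENNReal.ofReal_toReal (PMF.apply_ne_top _ _)]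
    simp_rw [e1]
    rw [← ENNReal.ofReal_sum_of_nonneg fun k _ => mul_nonneg ENNReal.toReal_nonneg (hn _),
      ← ENNReal.ofReal_add (hn s) (Finset.sum_nonneg fun k _ =>
        mul_nonneg ENNReal.toReal_nonneg (hn _)),
      show (2 : ℝ≥0∞) = ENNReal.ofReal 2 by simp, ← ENNReal.ofReal_div_of_pos two_pos]
    congr 1
    simp only [walkKer, Finset.mul_sum]
    rw [Finset.sum_comm, ← Finset.sum_add_distrib, Finset.sum_div]
    refine Finset.sum_congr rfl fun s' _ => ?_
    rw [div_mul_eq_mul_div, add_mul, Finset.sum_mul]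
    simp_rw [mul_assoc]

theorem sum_walkKer (l : ℕ) (s : V × Bool) : ∑ s', walkKer G l s s' = 1 := by
  have h := ev_walk_ofReal G l s (fun _ => 1) fun _ => zero_le_one
  simp only [mul_one, ENNReal.ofReal_one, ev_const] at h
  have h0 : 0 ≤ ∑ s', walkKer G l s s' := Finset.sum_nonneg fun s' _ => walkKer_nonneg G l s s'
  rw [← ENNReal.toReal_ofReal h0, ← h, ENNReal.toReal_one]

/-- The probability of an even walk from `s` to `j`, minus that of an odd one. -/
def walkMean (l : ℕ) (s : V × Bool) (j : V) : ℝ :=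
  walkKer G l s (j, false) - walkKer G l s (j, true)

/-- Each hop flips the parity and so contributes a factor -1. The signed transition probabilities
therefore obey the recursion of `lazyOp`, up to conjugation by √deg. -/
theorem walkMean_eq (l : ℕ) {i : V} (hi : 0 < G.deg i) (b : Bool) (j : V) :
    walkMean G l (i, b) j =
      (if b then -1 else 1) * (√(G.deg j) / √(G.deg i) * (lazyOp G ^ l) i j) := by
  induction l generalizing i b with
  | zero =>
    simp only [walkMean, walkKer, pow_zero, Matrix.one_apply, Prod.mk.injEq]
    have : √(G.deg i : ℝ) ≠ 0 := (Real.sqrt_pos.mpr (Nat.cast_pos.mpr hi)).ne'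
    by_cases hij : i = j
    · subst hij
      cases b <;> simp [this]
    · simp [hij]
  | succ l ih =>
    have e : walkMean G (l + 1) (i, b) j = (walkMean G l (i, b) j +
        ∑ k, (neighbour G i k).toReal * walkMean G l (k, !b) j) / 2 := by
      simp only [walkMean, walkKer, mul_sub, Finset.sum_sub_distrib]
      ring
    have e2 : ∀ k, (neighbour G i k).toReal * walkMean G l (k, !b) j =
        (if b then -1 else 1) * (√(G.deg j) / √(G.deg i)) *
          (-((G.mult i k : ℝ) / (√(G.deg i) * √(G.deg k))) * (lazyOp G ^ l) k j) := by
      intro k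
      rw [neighbour_toReal G hi]
      rcases eq_or_ne (G.mult i k) 0 with h | h
      · simp [h]
      · have hk : 0 < G.deg k := lt_of_lt_of_le (Nat.pos_of_ne_zero (G.symm i k ▸ h))
          (Finset.single_le_sum (f := G.mult k) (fun _ _ => Nat.zero_le _) (Finset.mem_univ i))
        rw [ih hk]
        have hi' : √(G.deg i : ℝ) ≠ 0 := (Real.sqrt_pos.mpr (Nat.cast_pos.mpr hi)).ne'
        have hk' : √(G.deg k : ℝ) ≠ 0 := (Real.sqrt_pos.mpr (Nat.cast_pos.mpr hk)).ne'
        have hdi : (G.deg i : ℝ) ≠ 0 := Nat.cast_ne_zero.mpr hi.ne'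
        cases b <;> simp <;> field_simp <;> rw [Real.sq_sqrt (Nat.cast_nonneg _)] <;> ring
    rw [e, ih hi]
    simp_rw [e2]
    rw [← Finset.mul_sum, pow_succ', Matrix.mul_apply]
    have e3 : ∑ k, lazyOp G i k * (lazyOp G ^ l) k j = ((lazyOp G ^ l) i j +
        ∑ k, -((G.mult i k : ℝ) / (√(G.deg i) * √(G.deg k))) * (lazyOp G ^ l) k j) / 2 := by
      have e4 : ∀ k, lazyOp G i k * (lazyOp G ^ l) k j =
          ((if i = k then (lazyOp G ^ l) k j else 0) +
            -((G.mult i k : ℝ) / (√(G.deg i) * √(G.deg k))) * (lazyOp G ^ l) k j) / 2 := by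
        intro k
        unfold lazyOp
        split_ifs <;> ring
      simp_rw [e4]
      rw [← Finset.sum_div, Finset.sum_add_distrib]
      simp
    rw [e3]
    ring

/-- The contribution of one walk to the tally. -/
def stepVec (s : V × Bool) (j : V) : ℝ := if j = s.1 then (if s.2 then -1 else 1) else 0

/-- `stepVec` is a random unit vector with mean `walkMean`, so the left side equals 1 - ‖mean‖² +
‖v‖². -/
theorem sum_walkKer_stepVec_sq (l : ℕ) (s : V × Bool) (v : V → ℝ) :
    ∑ s', walkKer G l s s' * ∑ j, (stepVec s' j - walkMean G l s j + v j) ^ 2 ≤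
      1 + ∑ j, v j ^ 2 := by
  set g := walkMean G l s with hg
  have e1 : ∀ s' : V × Bool, ∑ j, (stepVec s' j - g j + v j) ^ 2 =
      1 + 2 * ((if s'.2 then -1 else 1) * (v s'.1 - g s'.1)) + ∑ j, (v j - g j) ^ 2 := by
    intro s'
    have h1 : ∀ j, (stepVec s' j - g j + v j) ^ 2 =
        (if j = s'.1 then 1 + 2 * ((if s'.2 then -1 else 1) * (v s'.1 - g s'.1)) else 0) +
          (v j - g j) ^ 2 := by
      intro j
      unfold stepVec
      split_ifs with h h'
      · rw [h]
        ring
      · rw [h]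
        ring
      · ring
    simp_rw [h1]
    rw [Finset.sum_add_distrib]
    simp
  have e2 : ∑ s', walkKer G l s s' * ((if s'.2 then -1 else 1) * (v s'.1 - g s'.1)) =
      ∑ j, g j * (v j - g j) := by
    rw [Fintype.sum_prod_type]
    refine Finset.sum_congr rfl fun j _ => ?_
    rw [Fintype.sum_bool]
    simp only [if_true, Bool.false_eq_true, if_false, hg, walkMean]
    ring
  have e3 : ∑ s', walkKer G l s s' * ∑ j, (stepVec s' j - g j + v j) ^ 2 =
      1 + 2 * ∑ j, g j * (v j - g j) + ∑ j, (v j - g j) ^ 2 := by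
    simp_rw [e1, mul_add, Finset.sum_add_distrib, ← Finset.sum_mul, sum_walkKer, mul_left_comm _ (2 : ℝ),
      ← Finset.mul_sum, e2]
    ring
  rw [e3]
  have e4 : 2 * ∑ j, g j * (v j - g j) + ∑ j, (v j - g j) ^ 2 = ∑ j, v j ^ 2 - ∑ j, g j ^ 2 := by
    rw [Finset.mul_sum, ← Finset.sum_add_distrib, ← Finset.sum_sub_distrib]
    exact Finset.sum_congr rfl fun j _ => by ring
  have e5 : 0 ≤ ∑ j, g j ^ 2 := Finset.sum_nonneg fun j _ => sq_nonneg _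
  linarith

/-- Variances of independent vectors add. The shift `v` carries the deviation of the walks already
made through the induction. All vertices are controlled together, so no union bound over them is
needed. -/
theorem ev_tallyWalks (i : V) (l w : ℕ) (f₀ : V → ℤ) (v : V → ℝ) :
    ev (tallyWalks G i l w f₀) (fun f => ENNReal.ofReal
      (∑ j, ((f j : ℝ) - f₀ j - w * walkMean G l (i, false) j + v j) ^ 2)) ≤
      ENNReal.ofReal (w + ∑ j, v j ^ 2) := by
  set g := walkMean G l (i, false) with hg
  induction w generalizing f₀ v with
  | zero =>
    rw [tallyWalks, ev_pure]
    simp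
  | succ w ih =>
    rw [tallyWalks, ev_bind]
    simp only [ev_bind, ev_tick]
    have h1 : ∀ s : V × Bool, ev (tallyWalks G i l w
        (Function.update f₀ s.1 (f₀ s.1 + if s.2 then -1 else 1))) (fun f => ENNReal.ofReal
          (∑ j, ((f j : ℝ) - f₀ j - (w + 1 : ℕ) * g j + v j) ^ 2)) ≤
        ENNReal.ofReal (w + ∑ j, (stepVec s j - g j + v j) ^ 2) := by
      intro s
      refine le_trans (le_of_eq ?_) (ih (Function.update f₀ s.1 (f₀ s.1 + if s.2 then -1 else 1))
        fun j => stepVec s j - g j + v j)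
      congr 1
      funext f
      congr 1
      refine Finset.sum_congr rfl fun j _ => ?_
      have : ((Function.update f₀ s.1 (f₀ s.1 + if s.2 then -1 else 1) j : ℤ) : ℝ) =
          f₀ j + stepVec s j := by
        unfold stepVec
        by_cases hj : j = s.1
        · subst hj
          rw [Function.update_self, if_pos rfl]
          split_ifs <;> push_cast <;> ring
        · rw [Function.update_of_ne hj, if_neg hj, add_zero]
      rw [this]
      push_cast
      ring
    refine (ev_mono' h1).trans ?_
    rw [ev_walk_ofReal _ _ _ _ fun s => by positivity]
    refine ENNReal.ofReal_le_ofReal ?_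
    simp_rw [mul_add, Finset.sum_add_distrib, ← Finset.sum_mul, sum_walkKer]
    have := sum_walkKer_stepVec_sq G l (i, false) v
    rw [← hg] at this
    push_cast
    linarith

/-- Chebyshev's inequality for the tallies of a round. -/
theorem ev_tallyWalks_bad (i : V) (l w : ℕ) (hw : 0 < w) {t : ℝ} (ht : 0 < t) :
    ev (tallyWalks G i l w 0) ({f | ∃ j, 0 < G.deg j ∧
      t < |(f j : ℝ) / (G.deg j * w) - walkMean G l (i, false) j / G.deg j|}.indicator
        fun _ => 1) ≤ ENNReal.ofReal (1 / (t ^ 2 * w)) := by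
  have hw' : (0 : ℝ) < w := Nat.cast_pos.mpr hw
  have h1 := ev_tallyWalks G i l w 0 0
  simp only [Pi.zero_apply, Int.cast_zero, sub_zero, add_zero, ne_eq, OfNat.ofNat_ne_zero,
    not_false_eq_true, zero_pow, Finset.sum_const_zero] at h1
  have h2 := (ev_indicator_mul_le (tallyWalks G i l w 0) _ (ENNReal.ofReal ((t * w) ^ 2))
    {f | ∃ j, 0 < G.deg j ∧
      t < |(f j : ℝ) / (G.deg j * w) - walkMean G l (i, false) j / G.deg j|} (by
    rintro f ⟨j, hj, hf⟩
    refine ENNReal.ofReal_le_ofReal ?_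
    -- One coordinate is bounded by the whole squared deviation, and dividing by the degree only
    -- helps because it is at least 1.
    refine le_trans ?_ (Finset.single_le_sum (f := fun j =>
      ((f j : ℝ) - w * walkMean G l (i, false) j) ^ 2) (fun _ _ => sq_nonneg _)
      (Finset.mem_univ j))
    rw [← sq_abs ((f j : ℝ) - _)]
    refine pow_le_pow_left₀ (by positivity) ?_ 2
    have hd : (1 : ℝ) ≤ G.deg j := by exact_mod_cast hj
    have e : (f j : ℝ) / (G.deg j * w) - walkMean G l (i, false) j / G.deg j =
        ((f j : ℝ) - w * walkMean G l (i, false) j) / (G.deg j * w) := by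
      field_simp
    rw [e, abs_div, abs_of_pos (by positivity : (0 : ℝ) < G.deg j * w),
      lt_div_iff₀ (by positivity)] at hf
    refine le_trans ?_ hf.le
    refine mul_le_mul_of_nonneg_left ?_ ht.le
    nlinarith)).trans h1
  have hpos : (0 : ℝ) < (t * w) ^ 2 := by positivity
  rw [mul_comm, ← ENNReal.le_div_iff_mul_le (Or.inl (by simpa using hpos.ne'))
    (Or.inl ENNReal.ofReal_ne_top), ← ENNReal.ofReal_div_of_pos hpos] at h2
  refine h2.trans (ENNReal.ofReal_le_ofReal (le_of_eq ?_))
  field_simp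

end

section


open MultiGraph MaxCut.Comp

variable {V : Type} [Fintype V] [DecidableEq V] (G : MultiGraph V)

/-! ## Threshold cuts of a vector -/

/-- The inequality (a + b)² ≤ (1 + k) a² + (1 + 1/k) b² on each edge; the energy of the error is
then at most its norm. -/
theorem energy_perturb (x y : V → ℝ) {k : ℝ} (hk : 0 < k) :
    energy G x ≤ (1 + k) * energy G y + (1 + 1 / k) * normSq G (fun i => x i - y i) := by
  have h1 : energy G x ≤ (1 + k) * energy G y + (1 + 1 / k) * energy G (fun i => x i - y i) := by
    unfold energy
    rw [← esum_mul_left, ← esum_mul_left, ← esum_add]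
    refine G.esum_mono fun i j => ?_
    have key : ∀ a b : ℝ, (a + b) ^ 2 / 4 ≤ (1 + k) * (a ^ 2 / 4) + (1 + 1 / k) * (b ^ 2 / 4) := by
      intro a b
      have : (1 + k) * (a ^ 2 / 4) + (1 + 1 / k) * (b ^ 2 / 4) - (a + b) ^ 2 / 4 =
          (k * a - b) ^ 2 / (4 * k) := by
        field_simp
        ring
      have h2 : 0 ≤ (k * a - b) ^ 2 / (4 * k) := by positivity
      linarith
    have := key (y i - y j) (x i - y i - (x j - y j))
    rwa [show y i - y j + (x i - y i - (x j - y j)) = x i - x j by ring] at this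
  refine h1.trans ?_
  have := energy_le_normSq G fun i => x i - y i
  have h0 : 0 ≤ 1 + 1 / k := by positivity
  linarith [mul_le_mul_of_nonneg_left this h0]

theorem normSq_perturb (x y : V → ℝ) {k : ℝ} (hk : 0 < k) :
    normSq G x ≤ (1 + k) * normSq G y + (1 + 1 / k) * normSq G (fun i => x i - y i) := by
  unfold normSq
  rw [Finset.mul_sum, Finset.mul_sum, ← Finset.sum_add_distrib]
  refine Finset.sum_le_sum fun i _ => ?_
  have : (1 + k) * ((G.deg i : ℝ) * y i ^ 2) + (1 + 1 / k) * ((G.deg i : ℝ) * (x i - y i) ^ 2) -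
      (G.deg i : ℝ) * x i ^ 2 = G.deg i * ((k * y i - (x i - y i)) ^ 2 / k) := by
    field_simp
    ring
  have h2 : 0 ≤ (G.deg i : ℝ) * ((k * y i - (x i - y i)) ^ 2 / k) := by positivity
  linarith

theorem normSq_sub_comm (x y : V → ℝ) :
    normSq G (fun i => x i - y i) = normSq G (fun i => y i - x i) := by
  unfold normSq
  exact Finset.sum_congr rfl fun i _ => by ring

/-- A vector close to one with large Rayleigh quotient still has a large Rayleigh quotient. -/
theorem energy_sub_of_close {q z : V → ℝ} {θ K : ℝ} (hθ0 : 0 < θ) (hθ1 : θ < 1)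
    (hK : 2 / 3 ≤ (1 - θ) * K) (hK1 : K ≤ 1)
    (hq : (1 - θ / 4) * K * normSq G q ≤ energy G q)
    (hz : normSq G (fun i => q i - z i) ≤ (θ / 24) ^ 2 * normSq G q) :
    θ / 4 * normSq G q ≤ energy G z - (1 - θ) * K * normSq G z := by
  set k := θ / 24 with hk
  have hk0 : 0 < k := by positivity
  have hk1 : k < 1 / 24 := by rw [hk]; linarith
  have hA := normSq_nonneg G q
  have h1 := energy_perturb G q z hk0
  have h2 := normSq_perturb G z q hk0
  rw [normSq_sub_comm] at h2
  set A := normSq G q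
  set D := normSq G fun i => q i - z i
  have hD : (1 + 1 / k) * D ≤ 2 * k * A := by
    have h0 : 0 ≤ 1 + 1 / k := by positivity
    refine (mul_le_mul_of_nonneg_left hz h0).trans ?_
    have : (1 + 1 / k) * (k ^ 2 * A) = (k + k ^ 2) * A := by
      field_simp
      ring
    rw [this]
    exact mul_le_mul_of_nonneg_right (by nlinarith) hA
  have hK' : 2 / 3 ≤ K := by nlinarith
  have h3 : ((1 - θ / 4) * K - 2 * k) * A ≤ (1 + k) * energy G z := by linarith
  have h4 : normSq G z ≤ (1 + 3 * k) * A := by linarith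
  have h5 : (1 - θ) * K * normSq G z ≤ (1 - θ) * K * ((1 + 3 * k) * A) :=
    mul_le_mul_of_nonneg_left h4 (by linarith)
  have h6 : ((1 - θ / 4) * K - 2 * k) * (1 - k) * A ≤ energy G z := by
    have h7 := mul_le_mul_of_nonneg_left h3 (by linarith : 0 ≤ 1 - k)
    have h8 : (1 - k) * ((1 + k) * energy G z) ≤ energy G z := by
      have := energy_nonneg G z
      nlinarith [mul_nonneg (sq_nonneg k) this]
    linarith
  refine le_trans ?_ (sub_le_sub h6 h5)
  -- The gap (1 - θ/4) K - (1 - θ) K = 3θK/4 is at least θ/2 since K ≥ 2/3. The perturbation costs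
  -- at most 6k = θ/4, which explains k = θ/24.
  have h9 : θ / 4 ≤ ((1 - θ / 4) * K - 2 * k) * (1 - k) - (1 - θ) * K * (1 + 3 * k) := by
    have e1 : 0 ≤ (1 - θ / 4) * K := by nlinarith
    have e2 : (1 - θ / 4) * K ≤ 1 := by nlinarith
    have e3 : (1 - θ) * K ≤ 1 := by nlinarith
    have e4 : (1 - θ / 4) * K * k ≤ k := by nlinarith
    have e5 : (1 - θ) * K * k ≤ k := by nlinarith
    have e6 : θ / 2 ≤ θ * K * (3 / 4) := by nlinarith
    have e7 : 6 * k = θ / 4 := by rw [hk]; ring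
    nlinarith [sq_nonneg k]
  calc θ / 4 * A ≤ (((1 - θ / 4) * K - 2 * k) * (1 - k) - (1 - θ) * K * (1 + 3 * k)) * A :=
        mul_le_mul_of_nonneg_right h9 hA
    _ = _ := by ring

/-- The weighted sum of the threshold cuts at nested levels. -/
theorem sweep_sum {s : ℝ} (hs0 : 0 < s) (hs : soto s ≠ 1 / 2) (N : ℕ)
    (E O : ℕ → Finset V) (w : ℕ → ℝ) (hw : ∀ r < N, 0 ≤ w r)
    (hE : ∀ r r', r ≤ r' → r' < N → E r ⊆ E r') (hO : ∀ r r', r ≤ r' → r' < N → O r ⊆ O r')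
    (hdisj : ∀ r < N, Disjoint (E r) (O r)) (e p : V → ℝ)
    (he : ∀ j, e j = 1 ∨ e j = -1) (hp : ∀ j, 0 ≤ p j)
    (hsgn : ∀ r < N, ∀ j, ind (E r) j - ind (O r) j = e j * ind (E r ∪ O r) j)
    (hpw : ∀ j, p j ^ 2 = ∑ r ∈ Finset.range N, w r * ind (E r ∪ O r) j) :
    ∃ l : ℝ, 1 / 8 ≤ l ∧
      2 * l * (energy G (fun j => e j * p j) - (1 - s) * normSq G (fun j => e j * p j)) ≤
        ∑ r ∈ Finset.range N, w r * (G.cut (E r) (O r) - soto s * G.inc (E r) (O r)) := by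
  obtain ⟨l, hl, hedge⟩ := exists_edge_inequality hs0 hs
  refine ⟨l, hl, ?_⟩
  set a : ℕ → V → ℝ := fun r j => ind (E r ∪ O r) j with ha
  -- A classified vertex stays classified, so of two vertices one belongs to every level set that
  -- contains the other.
  have hnest : ∀ i j, (∀ r < N, a r i ≤ a r j) ∨ (∀ r < N, a r j ≤ a r i) := by
    intro i j
    by_contra hcon
    push Not at hcon
    obtain ⟨⟨r, hr, h1⟩, ⟨r', hr', h2⟩⟩ := hcon
    have hmono : ∀ r r' x, r ≤ r' → r' < N → a r x ≤ a r' x := by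
      intro r r' x hrr hr'
      simp only [ha]
      by_cases hx : x ∈ E r ∪ O r
      · have hx' : x ∈ E r' ∪ O r' := by
          rw [Finset.mem_union] at hx ⊢
          exact hx.imp (fun h => hE r r' hrr hr' h) (fun h => hO r r' hrr hr' h)
        rw [ind_of_mem hx, ind_of_mem hx']
      · rw [ind_of_notMem hx]
        exact ind_nonneg _ _
    have h01 : ∀ r x, a r x = 0 ∨ a r x = 1 := fun r x => by
      simp only [ha, ind]
      split_ifs <;> simp
    rcases le_total r r' with hrr | hrr
    · have g1 := hmono r r' i hrr hr'
      rcases h01 r i with h | h <;> rcases h01 r j with h' | h' <;> rcases h01 r' i with h'' | h'' <;>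
        rcases h01 r' j with h''' | h''' <;> linarith
    · have g1 := hmono r' r j hrr hr
      rcases h01 r i with h | h <;> rcases h01 r j with h' | h' <;> rcases h01 r' i with h'' | h'' <;>
        rcases h01 r' j with h''' | h''' <;> linarith
  have hprod : ∀ x y : V, (∀ r < N, a r x ≤ a r y) → (∀ r < N, a r x * a r y = a r x) := by
    intro x y h r hr
    have h1 := h r hr
    simp only [ha] at h1 ⊢
    by_cases hx : x ∈ E r ∪ O r
    · by_cases hy : y ∈ E r ∪ O r
      · rw [ind_of_mem hy, mul_one]
      · rw [ind_of_mem hx, ind_of_notMem hy] at h1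
        norm_num at h1
    · rw [ind_of_notMem hx, zero_mul]
  -- Layer-cake formula: p_j² is the total weight of the levels that contain j, so the levels
  -- containing both i and j weigh the minimum, and those containing at least one weigh the maximum.
  have hmin : ∀ i j, ∑ r ∈ Finset.range N, w r * (a r i * a r j) = min (p i ^ 2) (p j ^ 2) := by
    intro i j
    rcases hnest i j with h | h
    · have hle : p i ^ 2 ≤ p j ^ 2 := by
        rw [hpw, hpw]
        exact Finset.sum_le_sum fun r hr =>
          mul_le_mul_of_nonneg_left (h r (Finset.mem_range.mp hr)) (hw r (Finset.mem_range.mp hr))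
      rw [min_eq_left hle, hpw]
      exact Finset.sum_congr rfl fun r hr => by rw [hprod i j h r (Finset.mem_range.mp hr)]
    · have hle : p j ^ 2 ≤ p i ^ 2 := by
        rw [hpw, hpw]
        exact Finset.sum_le_sum fun r hr =>
          mul_le_mul_of_nonneg_left (h r (Finset.mem_range.mp hr)) (hw r (Finset.mem_range.mp hr))
      rw [min_eq_right hle, hpw]
      exact Finset.sum_congr rfl fun r hr => by
        rw [mul_comm (a r i), hprod j i h r (Finset.mem_range.mp hr)]
  have hmax : ∀ i j, ∑ r ∈ Finset.range N, w r * (a r i + a r j - a r i * a r j) =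
      max (p i ^ 2) (p j ^ 2) := by
    intro i j
    have h1 : ∑ r ∈ Finset.range N, w r * (a r i + a r j - a r i * a r j) =
        p i ^ 2 + p j ^ 2 - ∑ r ∈ Finset.range N, w r * (a r i * a r j) := by
      rw [hpw, hpw, ← Finset.sum_add_distrib, ← Finset.sum_sub_distrib]
      exact Finset.sum_congr rfl fun r _ => by ring
    rw [h1, hmin, ← min_add_max (p i ^ 2)]
    ring
  have hlhs : 2 * l * (energy G (fun j => e j * p j) - (1 - s) * normSq G (fun j => e j * p j)) =
      G.esum fun i j => (1 / 2) * (l * (2 * s * (p i ^ 2 + p j ^ 2) -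
        (e i * p i + e j * p j) ^ 2)) := by
    have h1 := energy_add_esum G fun j => e j * p j
    have h2 := esum_sq_add_sq G fun j => e j * p j
    have h3 : ∀ j, (e j * p j) ^ 2 = p j ^ 2 := fun j => by
      rcases he j with h | h <;> rw [h] <;> ring
    simp only [h3] at h2
    rw [esum_mul_left, esum_mul_left, esum_sub, esum_mul_left, h2]
    linear_combination 2 * l * h1
  have hrhs : ∑ r ∈ Finset.range N, w r * (G.cut (E r) (O r) - soto s * G.inc (E r) (O r)) =
      G.esum fun i j => (1 / 2) * ((max (p i ^ 2) (p j ^ 2) -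
        e i * e j * min (p i ^ 2) (p j ^ 2)) / 2 - soto s * max (p i ^ 2) (p j ^ 2)) := by
    have h1 : ∀ r ∈ Finset.range N, w r * (G.cut (E r) (O r) - soto s * G.inc (E r) (O r)) =
        G.esum fun i j => (1 / 2) * ((w r * (a r i + a r j - a r i * a r j) -
          e i * e j * (w r * (a r i * a r j))) / 2 -
            soto s * (w r * (a r i + a r j - a r i * a r j))) := by
      intro r hr
      have hr' := Finset.mem_range.mp hr
      rw [cut_eq _ (hdisj r hr'), inc_eq, ← esum_mul_left, ← esum_sub, ← esum_mul_left]
      congr 1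
      funext i j
      rw [hsgn r hr', hsgn r hr']
      simp only [ha]
      ring
    rw [Finset.sum_congr rfl h1, ← esum_sum]
    congr 1
    funext i j
    rw [← Finset.mul_sum, Finset.sum_sub_distrib, ← Finset.sum_div, Finset.sum_sub_distrib,
      ← Finset.mul_sum, ← Finset.mul_sum, hmax, hmin]
  rw [hlhs, hrhs]
  refine G.esum_mono fun i j => ?_
  have := hedge (e i) (e j) (p i) (p j) (he i) (he j) (hp i) (hp j)
  linarith

end

section


open MultiGraph MaxCut.Comp

variable {V : Type} [Fintype V] [DecidableEq V] (G : MultiGraph V)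

/-! ## Rounds of Find whose tallies are accurate -/

/-- A round with threshold `t` that classifies vertices almost according to the exact values `q`. -/
structure GoodStep (q : V → ℝ) (g t : ℝ) (S S' : Finset V × Finset V) : Prop where
  even_subset : S.1 ⊆ S'.1
  odd_subset : S.2 ⊆ S'.2
  disjoint : Disjoint S'.1 S'.2
  even_le : ∀ j ∈ S'.1, j ∉ S.1 → (1 - g) * t ≤ q j
  odd_le : ∀ j ∈ S'.2, j ∉ S.2 → q j ≤ -((1 - g) * t)
  rest_le : ∀ j, 0 < G.deg j → j ∉ S'.1 ∪ S'.2 → |q j| ≤ (1 + g) * t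

/-- The bounds (1 + 2g)(1 - g) ≥ 1, which needs g ≤ 1/2, and (1 + g)(1 - 2g) ≤ 1 - g. -/
theorem abs_sub_le_of_rounded {g t q : ℝ} (hg0 : 0 < g) (hg : g ≤ 1 / 2) (ht : 0 ≤ t)
    (h1 : (1 - g) * t ≤ q) (h2 : (1 - g) * q ≤ (1 + g) * t) : |q - t| ≤ 2 * g * q := by
  have hq : 0 ≤ q := le_trans (mul_nonneg (by linarith) ht) h1
  rw [abs_le]
  constructor
  · have : t ≤ (1 + 2 * g) * q := by
      calc t ≤ (1 + 2 * g) * ((1 - g) * t) := by nlinarith [mul_nonneg hg0.le ht]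
        _ ≤ (1 + 2 * g) * q := mul_le_mul_of_nonneg_left h1 (by linarith)
    linarith
  · have h3 : (1 + g) * ((1 - 2 * g) * q) ≤ (1 + g) * t := by
      refine le_trans ?_ h2
      nlinarith [mul_nonneg (mul_nonneg hg0.le hg0.le) hq]
    have := le_of_mul_le_mul_left h3 (by linarith)
    linarith

/-- The rounded vector that a run of accurate rounds determines. -/
theorem exists_rounding {q : V → ℝ} {g b : ℝ} {N : ℕ} {h : ℕ → Finset V × Finset V}
    (hg0 : 0 < g) (hg : g ≤ 1 / 2) (hq1 : ∀ j, |q j| ≤ 1) (hN : 0 < N) (h0 : h 0 = (∅, ∅))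
    (hstep : ∀ r < N, GoodStep G q g ((1 - g) ^ r) (h r) (h (r + 1)))
    (hb : (1 + g) * (1 - g) ^ (N - 1) ≤ b) :
    ∃ (w : ℕ → ℝ) (e p : V → ℝ), (∀ r < N, 0 ≤ w r ∧ w r ≤ ((1 - g) ^ r) ^ 2) ∧
      (∀ j, e j = 1 ∨ e j = -1) ∧ (∀ j, 0 ≤ p j) ∧
      (∀ r < N, ∀ j, ind (h (r + 1)).1 j - ind (h (r + 1)).2 j =
        e j * ind ((h (r + 1)).1 ∪ (h (r + 1)).2) j) ∧
      (∀ j, p j ^ 2 = ∑ r ∈ Finset.range N, w r * ind ((h (r + 1)).1 ∪ (h (r + 1)).2) j) ∧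
      normSq G (fun j => q j - e j * p j) ≤ 4 * g ^ 2 * normSq G q + b ^ 2 * G.vol := by
  classical
  have hmono : ∀ r r', r ≤ r' → r' ≤ N → (h r).1 ⊆ (h r').1 ∧ (h r).2 ⊆ (h r').2 := by
    intro r r' hrr
    induction r', hrr using Nat.le_induction with
    | base => exact fun _ => ⟨subset_rfl, subset_rfl⟩
    | succ r' _ ih =>
      intro hr'
      have g1 := ih (by omega)
      have g2 := hstep r' (by omega)
      exact ⟨g1.1.trans g2.even_subset, g1.2.trans g2.odd_subset⟩
  set t : ℕ → ℝ := fun r => (1 - g) ^ r with ht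
  have ht0 : ∀ r, 0 < t r := fun r => pow_pos (by linarith) r
  have htsucc : ∀ r, t (r + 1) = (1 - g) * t r := fun r => by
    simp only [ht]
    rw [pow_succ, mul_comm]
  have htle : ∀ r, t (r + 1) ≤ t r := fun r => by
    rw [htsucc]
    nlinarith [ht0 r]
  -- With these weights the levels telescope: a vertex first classified in round r₀ gets p² =
  -- t_{r₀}², so the rounded value is the threshold of that round. Vertices never classified get 0.
  set T : ℕ → ℝ := fun r => if r < N then t r ^ 2 else 0 with hT
  set w : ℕ → ℝ := fun r => T r - T (r + 1) with hw
  set U : ℕ → Finset V := fun r => (h r).1 ∪ (h r).2 with hU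
  have hUmono : ∀ r r', r ≤ r' → r' ≤ N → U r ⊆ U r' := fun r r' h1 h2 =>
    Finset.union_subset_union (hmono r r' h1 h2).1 (hmono r r' h1 h2).2
  have hdisjN : Disjoint (h N).1 (h N).2 := by
    have := (hstep (N - 1) (by omega)).disjoint
    rwa [Nat.sub_add_cancel hN] at this
  set e : V → ℝ := fun j => if j ∈ (h N).2 then -1 else 1 with he
  set P : V → ℝ := fun j => ∑ r ∈ Finset.range N, w r * ind (U (r + 1)) j with hP
  have hw01 : ∀ r < N, 0 ≤ w r ∧ w r ≤ (t r) ^ 2 := by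
    intro r hr
    simp only [hw, hT, if_pos hr]
    split_ifs
    · have := pow_le_pow_left₀ (ht0 (r + 1)).le (htle r) 2
      exact ⟨by linarith, by linarith [sq_nonneg (t (r + 1))]⟩
    · exact ⟨by simpa using sq_nonneg (t r), by simp⟩
  have hP0 : ∀ j, 0 ≤ P j := fun j => Finset.sum_nonneg fun r hr =>
    mul_nonneg (hw01 r (Finset.mem_range.mp hr)).1 (ind_nonneg _ _)
  have hPout : ∀ j, j ∉ U N → P j = 0 := fun j hj => Finset.sum_eq_zero fun r hr => by
    rw [ind_of_notMem fun hj' => hj (hUmono (r + 1) N (Finset.mem_range.mp hr) le_rfl hj'),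
      mul_zero]
  have hPin : ∀ j r₀, r₀ < N → j ∈ U (r₀ + 1) → j ∉ U r₀ → P j = t r₀ ^ 2 := by
    intro j r₀ hr₀ h1 h2
    have e1 : P j = ∑ r ∈ Finset.Ico r₀ N, w r := by
      simp only [hP]
      rw [Finset.range_eq_Ico, ← Finset.sum_Ico_consecutive _ (Nat.zero_le r₀) hr₀.le,
        Finset.sum_eq_zero, zero_add]
      · refine Finset.sum_congr rfl fun r hr => ?_
        rw [Finset.mem_Ico] at hr
        rw [ind_of_mem (hUmono (r₀ + 1) (r + 1) (by omega) (by omega) h1), mul_one]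
      · intro r hr
        rw [Finset.mem_Ico] at hr
        rw [ind_of_notMem fun hj' => h2 (hUmono (r + 1) r₀ (by omega) (by omega) hj'), mul_zero]
    rw [e1, Finset.sum_Ico_eq_sum_range]
    have := Finset.sum_range_sub' (fun i => T (r₀ + i)) (N - r₀)
    simp only [hw]
    refine this.trans ?_
    simp only [hT, add_zero, if_pos hr₀]
    rw [if_neg (by omega), sub_zero]
  refine ⟨w, e, fun j => √(P j), hw01, ?_, fun j => Real.sqrt_nonneg _, ?_,
    fun j => Real.sq_sqrt (hP0 j), ?_⟩
  · intro j
    simp only [he]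
    split_ifs <;> simp
  · intro r hr j
    have hm := hmono (r + 1) N hr le_rfl
    simp only [he]
    by_cases h1 : j ∈ (h (r + 1)).1
    · have h2 : j ∉ (h N).2 := Finset.disjoint_left.mp hdisjN (hm.1 h1)
      have h3 : j ∉ (h (r + 1)).2 := fun h3 => h2 (hm.2 h3)
      simp [ind, h1, h2, h3]
    · by_cases h3 : j ∈ (h (r + 1)).2
      · simp [ind, h1, h3, hm.2 h3]
      · simp [ind, h1, h3]
  · have key : ∀ j, 0 < G.deg j → (q j - e j * √(P j)) ^ 2 ≤ 4 * g ^ 2 * q j ^ 2 + b ^ 2 := by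
      intro j hj
      by_cases hjN : j ∈ U N
      · have hex : ∃ r, j ∈ U (r + 1) := ⟨N - 1, by rwa [Nat.sub_add_cancel hN]⟩
        obtain ⟨r₀, hr₀, h1, h2⟩ : ∃ r₀ < N, j ∈ U (r₀ + 1) ∧ j ∉ U r₀ := by
          refine ⟨Nat.find hex, ?_, Nat.find_spec hex, ?_⟩
          · have := Nat.find_min' hex (m := N - 1) (by rwa [Nat.sub_add_cancel hN])
            omega
          · rcases Nat.eq_zero_or_pos (Nat.find hex) with hz | hz
            · rw [hz]
              simp [hU, h0]
            · have := Nat.find_min hex (m := Nat.find hex - 1) (by omega)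
              rwa [Nat.sub_add_cancel hz] at this
        rw [hPin j r₀ hr₀ h1 h2, Real.sqrt_sq (ht0 r₀).le]
        -- The vertex was not classified one round earlier, with the threshold t_{r₀} / (1 - g). In
        -- round 0 the bound |q| ≤ 1 replaces this.
        have hup : (1 - g) * |q j| ≤ (1 + g) * t r₀ := by
          rcases Nat.eq_zero_or_pos r₀ with hz | hz
          · rw [hz]
            simp only [ht, pow_zero]
            nlinarith [hq1 j, abs_nonneg (q j)]
          · have := (hstep (r₀ - 1) (by omega)).rest_le j hj (by rwa [Nat.sub_add_cancel hz])
            have e1 := htsucc (r₀ - 1)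
            rw [Nat.sub_add_cancel hz] at e1
            rw [e1]
            calc (1 - g) * |q j| ≤ (1 - g) * ((1 + g) * t (r₀ - 1)) :=
                  mul_le_mul_of_nonneg_left this (by linarith)
              _ = _ := by ring
        have hst := hstep r₀ hr₀
        have hm := hmono (r₀ + 1) N hr₀ le_rfl
        simp only [hU, Finset.mem_union, not_or] at h1 h2
        have habs : |q j - e j * t r₀| ≤ 2 * g * |q j| := by
          simp only [he]
          rcases h1 with h1 | h1
          · have h3 : j ∉ (h N).2 := Finset.disjoint_left.mp hdisjN (hm.1 h1)
            have h4 := hst.even_le j h1 h2.1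
            have h5 : 0 ≤ q j := le_trans (mul_nonneg (by linarith) (ht0 r₀).le) h4
            rw [if_neg h3, one_mul]
            rw [abs_of_nonneg h5] at hup ⊢
            exact abs_sub_le_of_rounded hg0 hg (ht0 r₀).le h4 hup
          · have h4 := hst.odd_le j h1 h2.2
            have h6 : (1 - g) * t r₀ ≤ -q j := by linarith
            have h5 : 0 ≤ -q j := le_trans (mul_nonneg (by linarith) (ht0 r₀).le) h6
            rw [if_pos (hm.2 h1)]
            rw [← abs_neg (q j), abs_of_nonneg h5] at hup ⊢
            have := abs_sub_le_of_rounded hg0 hg (ht0 r₀).le h6 hup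
            rwa [← abs_neg, show -(q j - -1 * t r₀) = -q j - t r₀ by ring]
        have := pow_le_pow_left₀ (abs_nonneg _) habs 2
        rw [sq_abs, mul_pow, mul_pow, sq_abs] at this
        nlinarith [sq_nonneg b]
      · rw [hPout j hjN, Real.sqrt_zero, mul_zero, sub_zero]
        have h1 := (hstep (N - 1) (by omega)).rest_le j hj (by rwa [Nat.sub_add_cancel hN])
        have := pow_le_pow_left₀ (abs_nonneg _) (h1.trans hb) 2
        rw [sq_abs] at this
        have : 0 ≤ 4 * g ^ 2 * q j ^ 2 := by positivity
        linarith
    unfold normSq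
    rw [Finset.mul_sum, vol, Nat.cast_sum, Finset.mul_sum, ← Finset.sum_add_distrib]
    refine Finset.sum_le_sum fun j _ => ?_
    rcases Nat.eq_zero_or_pos (G.deg j) with hj | hj
    · simp [hj]
    · have := mul_le_mul_of_nonneg_left (key j hj) (Nat.cast_nonneg (α := ℝ) (G.deg j))
      simp only at this ⊢
      linarith

/-- If all rounds are accurate, then one of them passes the test of Find. -/
theorem exists_round_passes {q : V → ℝ} {g b θ K D c₁ M L τ Δ : ℝ} {N : ℕ}
    {h : ℕ → Finset V × Finset V} {s : ℝ}
    (hg0 : 0 < g) (hg : g ≤ 1 / 2) (hq1 : ∀ j, |q j| ≤ 1) (hN : 0 < N) (h0 : h 0 = (∅, ∅))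
    (hstep : ∀ r < N, GoodStep G q g ((1 - g) ^ r) (h r) (h (r + 1)))
    (hb : (1 + g) * (1 - g) ^ (N - 1) ≤ b)
    (hs0 : 0 < s) (hs : soto s ≠ 1 / 2) (hsK : 1 - s = (1 - θ) * K)
    (hθ0 : 0 < θ) (hθ1 : θ < 1) (hK1 : K ≤ 1)
    (hq : (1 - θ / 4) * K * normSq G q ≤ energy G q)
    (hD : b ^ 2 * G.vol ≤ D * normSq G q) (hgD : 4 * g ^ 2 + D ≤ (θ / 24) ^ 2)
    (hM : 0 < M) (hL : 0 < L) (hΔ : 0 < Δ) (hnorm : c₁ / M ≤ normSq G q)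
    (hinc : ∀ A B, G.inc A B ≤ Δ * (A ∪ B).card) (hτ : 0 < τ) (hNL : N * τ < θ / 16 * c₁ * L) :
    ∃ r < N, soto s * G.inc (h (r + 1)).1 (h (r + 1)).2 ≤ G.cut (h (r + 1)).1 (h (r + 1)).2 ∧
      τ / (Δ * ((1 - g) ^ r) ^ 2 * M * L) ≤ ((h (r + 1)).1 ∪ (h (r + 1)).2).card := by
  by_contra hcon
  push Not at hcon
  obtain ⟨w, e, p, hw, he, hp, hsgn, hpw, hclose⟩ :=
    exists_rounding G hg0 hg hq1 hN h0 hstep hb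
  have hmono : ∀ r r', r ≤ r' → r' < N → (h (r + 1)).1 ⊆ (h (r' + 1)).1 ∧
      (h (r + 1)).2 ⊆ (h (r' + 1)).2 := by
    intro r r' hrr
    induction r', hrr using Nat.le_induction with
    | base => exact fun _ => ⟨subset_rfl, subset_rfl⟩
    | succ r' _ ih =>
      intro hr'
      have g1 := ih (by omega)
      have g2 := hstep (r' + 1) (by omega)
      exact ⟨g1.1.trans g2.even_subset, g1.2.trans g2.odd_subset⟩
  have hnn := normSq_nonneg G q
  obtain ⟨l, hl, hsum⟩ := sweep_sum G hs0 hs N (fun r => (h (r + 1)).1) (fun r => (h (r + 1)).2) w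
    (fun r hr => (hw r hr).1) (fun r r' h1 h2 => (hmono r r' h1 h2).1)
    (fun r r' h1 h2 => (hmono r r' h1 h2).2) (fun r hr => (hstep r hr).disjoint) e p he hp hsgn hpw
  have hs3 : s < 1 / 3 := by
    by_contra h'
    exact hs (soto_of_third_le (not_lt.mp h'))
  have henergy := energy_sub_of_close G (z := fun j => e j * p j) hθ0 hθ1 (by linarith) hK1 hq (by
    refine hclose.trans ?_
    calc 4 * g ^ 2 * normSq G q + b ^ 2 * G.vol ≤ (4 * g ^ 2 + D) * normSq G q := by linarith
      _ ≤ _ := mul_le_mul_of_nonneg_right hgD hnn)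
  rw [← hsK] at henergy
  have hlow : θ / 16 * (c₁ / M) ≤ ∑ r ∈ Finset.range N,
      w r * (G.cut (h (r + 1)).1 (h (r + 1)).2 - soto s * G.inc (h (r + 1)).1 (h (r + 1)).2) := by
    refine le_trans ?_ hsum
    have h1 : θ / 4 * (c₁ / M) ≤ θ / 4 * normSq G q :=
      mul_le_mul_of_nonneg_left hnorm (by linarith)
    have h2 : 0 ≤ θ / 4 * normSq G q := by positivity
    nlinarith
  have hup : ∑ r ∈ Finset.range N,
      w r * (G.cut (h (r + 1)).1 (h (r + 1)).2 - soto s * G.inc (h (r + 1)).1 (h (r + 1)).2) ≤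
      ∑ r ∈ Finset.range N, τ / (M * L) := by
    refine Finset.sum_le_sum fun r hr => ?_
    have hr' := Finset.mem_range.mp hr
    have hpos : 0 < τ / (M * L) := by positivity
    -- A round can fail in two ways. If its cut is too small, its term is negative. If its set is
    -- too small, the term is at most t² Δ |set|, which is below the bound by the size test.
    rcases lt_or_ge (G.cut (h (r + 1)).1 (h (r + 1)).2)
      (soto s * G.inc (h (r + 1)).1 (h (r + 1)).2) with hlt | hge
    · exact (mul_nonpos_of_nonneg_of_nonpos (hw r hr').1 (by linarith)).trans hpos.le
    · have h1 := hcon r hr' hge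
      have ht : 0 < ((1 - g) ^ r) ^ 2 := pow_pos (pow_pos (by linarith) r) 2
      rw [lt_div_iff₀ (by positivity)] at h1
      have hi0 := G.inc_nonneg (h (r + 1)).1 (h (r + 1)).2
      have hci := G.cut_le_inc (hstep r hr').disjoint
      have h2 : G.cut (h (r + 1)).1 (h (r + 1)).2 -
          soto s * G.inc (h (r + 1)).1 (h (r + 1)).2 ≤
            Δ * ((h (r + 1)).1 ∪ (h (r + 1)).2).card := by
        have := hinc (h (r + 1)).1 (h (r + 1)).2
        have := mul_nonneg ((by norm_num : (0 : ℝ) ≤ 1 / 2).trans (half_le_soto s)) hi0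
        linarith
      rw [le_div_iff₀ (by positivity)]
      calc w r * (G.cut (h (r + 1)).1 (h (r + 1)).2 -
            soto s * G.inc (h (r + 1)).1 (h (r + 1)).2) * (M * L)
          ≤ ((1 - g) ^ r) ^ 2 * (Δ * ((h (r + 1)).1 ∪ (h (r + 1)).2).card) * (M * L) := by
            refine mul_le_mul_of_nonneg_right ?_ (by positivity)
            exact mul_le_mul (hw r hr').2 h2 (by linarith) ht.le
        _ ≤ τ := by linarith
  rw [Finset.sum_const, Finset.card_range, nsmul_eq_mul] at hup
  have h1 := hlow.trans hup
  rw [← mul_div_assoc, ← mul_div_assoc, div_le_div_iff₀ hM (by positivity)] at h1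
  have h2 : M * (θ / 16 * c₁ * L) ≤ M * (N * τ) := by linarith
  have := le_of_mul_le_mul_left h2 hM
  linarith

/-! ## The probability that Find succeeds -/

theorem numWalks_pos {c : Consts} {m : ℕ} (hm : 2 ≤ m) {t : ℝ} (ht : 0 < t) :
    0 < numWalks c m 1 t ∧ c.κ * Real.log m ≤ t ^ 2 * numWalks c m 1 t := by
  have hlog : 0 < Real.log m := Real.log_pos (by exact_mod_cast hm)
  have hκ := c.κ_pos
  have h1 : c.κ * Real.log m * 1 / t ^ 2 ≤ c.κ * Real.log m * max 1 t / t ^ 2 := by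
    gcongr
    exact le_max_left _ _
  have h2 : 0 < c.κ * Real.log m * 1 / t ^ 2 := by positivity
  unfold numWalks
  refine ⟨Nat.ceil_pos.mpr (h2.trans_le h1), ?_⟩
  have h3 := h1.trans (Nat.le_ceil _)
  rw [div_le_iff₀ (by positivity)] at h3
  linarith

/-- The test that ends a call of Find. -/
def Passes (c : Consts) (μ : ℝ) (m Δ : ℕ) (ε : ℝ) (r : ℕ) (S : Finset V × Finset V) : Prop :=
  soto (sigma c.θ ε μ) * G.inc S.1 S.2 ≤ G.cut S.1 S.2 ∧
    c.τ / (Δ * ((1 - c.γ) ^ r) ^ 2 * (m : ℝ) ^ (1 + μ) * Real.log m) ≤ ((S.1 ∪ S.2).card : ℝ)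

/-- The classification that a round with tallies `f` computes. -/
def classify (w : ℕ) (t : ℝ) (f : V → ℤ) (S : Finset V × Finset V) : Finset V × Finset V :=
  (S.1 ∪ Finset.univ.filter (fun j => j ∉ S.1 ∪ S.2 ∧ t < (f j : ℝ) / ((G.deg j : ℝ) * w)),
    S.2 ∪ Finset.univ.filter (fun j => j ∉ S.1 ∪ S.2 ∧ (f j : ℝ) / ((G.deg j : ℝ) * w) < -t))

theorem classify_disjoint {w : ℕ} {t : ℝ} {f : V → ℤ} {S : Finset V × Finset V} (ht : 0 < t)
    (hS : Disjoint S.1 S.2) : Disjoint (classify G w t f S).1 (classify G w t f S).2 := by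
  rw [Finset.disjoint_left] at hS ⊢
  intro j h1 h2
  simp only [classify, Finset.mem_union, Finset.mem_filter, Finset.mem_univ, true_and,
    not_or] at h1 h2
  rcases h1 with h1 | h1 <;> rcases h2 with h2 | h2
  · exact hS h1 h2
  · exact h2.1.1 h1
  · exact h1.1.2 h2
  · linarith [h1.2, h2.2]

/-- For an isolated vertex the quotient has denominator 0, hence is 0, and never exceeds a positive
threshold. -/
theorem classify_deg_pos {w : ℕ} {t : ℝ} {f : V → ℤ} {S : Finset V × Finset V} (ht : 0 < t)
    {j : V} (hj : j ∈ (classify G w t f S).1 ∪ (classify G w t f S).2) (hS : j ∉ S.1 ∪ S.2) :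
    0 < G.deg j := by
  by_contra h
  simp only [classify, Finset.mem_union, Finset.mem_filter, Finset.mem_univ, true_and,
    Nat.eq_zero_of_not_pos h, Nat.cast_zero, zero_mul, div_zero] at hj hS
  rcases hj with (hj | hj) | (hj | hj)
  · exact hS (Or.inl hj)
  · linarith [hj.2]
  · exact hS (Or.inr hj)
  · linarith [hj.2]

theorem classify_goodStep {w : ℕ} {g t : ℝ} {f : V → ℤ} {q : V → ℝ} {S : Finset V × Finset V}
    (ht : 0 < t) (hS : Disjoint S.1 S.2)
    (hf : ∀ j, 0 < G.deg j → |(f j : ℝ) / (G.deg j * w) - q j| ≤ g * t) :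
    GoodStep G q g t S (classify G w t f S) := by
  have hdeg : ∀ j ∈ (classify G w t f S).1 ∪ (classify G w t f S).2, j ∉ S.1 ∪ S.2 →
      |(f j : ℝ) / (G.deg j * w) - q j| ≤ g * t := fun j hj hj' =>
    hf j (classify_deg_pos G ht hj hj')
  refine ⟨Finset.subset_union_left, Finset.subset_union_left, classify_disjoint G ht hS,
    fun j hj hjS => ?_, fun j hj hjS => ?_, fun j hj hjS => ?_⟩
  · have h1 := hdeg j (Finset.mem_union_left _ hj)
    simp only [classify, Finset.mem_union, Finset.mem_filter, Finset.mem_univ, true_and] at hj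
    have h2 := hj.resolve_left hjS
    have h3 := (abs_le.mp (h1 (by simpa using h2.1))).2
    linarith [h2.2]
  · have h1 := hdeg j (Finset.mem_union_right _ hj)
    simp only [classify, Finset.mem_union, Finset.mem_filter, Finset.mem_univ, true_and] at hj
    have h2 := hj.resolve_left hjS
    have h3 := (abs_le.mp (h1 (by simpa using h2.1))).1
    linarith [h2.2]
  · have h1 := hf j hj
    simp only [classify, Finset.mem_union, Finset.mem_filter, Finset.mem_univ, true_and,
      not_or, not_and, not_lt] at hjS
    have h2 := hjS.1.2 ⟨hjS.1.1, hjS.2.1⟩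
    have h3 := hjS.2.2 ⟨hjS.1.1, hjS.2.1⟩
    rw [abs_le] at h1 ⊢
    constructor <;> linarith [h1.1, h1.2]

theorem ev_threshold (c : Consts) (μ : ℝ) (m : ℕ) (ε α : ℝ) (i : V) (t : ℝ)
    (S : Finset V × Finset V) (φ : Finset V × Finset V → ℝ≥0∞) :
    ev (threshold c μ m G ε α i t S) φ =
      ev (tallyWalks G i (walkLength c μ m ε) (numWalks c m α t) 0)
        (fun f => φ (classify G (numWalks c m α t) t f S)) := by
  unfold threshold
  simp only [ev_bind, ev_tick, ev_pure]
  rfl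

-- A union bound over the rounds: failure requires an inaccurate round, since `hend` excludes that
-- all remaining rounds are accurate and yet fail. `Inv` stands for the history of the earlier
-- rounds. The number of walks is proportional to log m / t², which makes the bound for each round
-- independent of `t`.
open Classical in
theorem ev_findRounds_none (c : Consts) (μ : ℝ) {m : ℕ} (Δ : ℕ) (hm : 2 ≤ m) (ε : ℝ) (i : V)
    (N : ℕ) (Inv : ℕ → Finset V × Finset V → Prop)
    (hdisj : ∀ r S, Inv r S → Disjoint S.1 S.2)
    (hstep : ∀ r < N, ∀ S S', Inv r S → GoodStep G
      (fun j => walkMean G (walkLength c μ m ε) (i, false) j / G.deg j) c.γ ((1 - c.γ) ^ r) S S' →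
      ¬ Passes G c μ m Δ ε r S' → Inv (r + 1) S')
    (hend : ∀ S, ¬ Inv N S) (n r : ℕ) (hn : r + n = N) (S : Finset V × Finset V)
    (hS : Inv r S) :
    ev (findRounds c μ m Δ G ε 1 i (List.range' r n) S)
      (({none} : Set (Option (Finset V × Finset V))).indicator fun _ => 1) ≤
      n * ENNReal.ofReal (1 / (c.γ ^ 2 * (c.κ * Real.log m))) := by
  induction n generalizing r S with
  | zero =>
    rw [add_zero] at hn
    exact absurd (hn ▸ hS) (hend S)
  | succ n ih =>
    rw [List.range'_succ, findRounds, ev_bind, ev_threshold]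
    have ht : 0 < (1 - c.γ) ^ r := pow_pos (by linarith [c.γ_mem.2]) r
    obtain ⟨hw0, hw⟩ := numWalks_pos (c := c) hm ht
    have hγ := c.γ_mem.1
    have hκ := c.κ_pos
    have hlog : 0 < Real.log m := Real.log_pos (by exact_mod_cast hm)
    set t := (1 - c.γ) ^ r
    set w := numWalks c m 1 t
    set bad : Set (V → ℤ) := {f | ∃ j, 0 < G.deg j ∧ c.γ * t <
      |(f j : ℝ) / (G.deg j * w) - walkMean G (walkLength c μ m ε) (i, false) j / G.deg j|}
    set B := ENNReal.ofReal (1 / (c.γ ^ 2 * (c.κ * Real.log m))) with hB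
    have hbad : ev (tallyWalks G i (walkLength c μ m ε) w 0) (bad.indicator fun _ => 1) ≤ B := by
      refine (ev_tallyWalks_bad G i _ w hw0 (mul_pos hγ ht)).trans (ENNReal.ofReal_le_ofReal ?_)
      refine one_div_le_one_div_of_le (by positivity) ?_
      rw [mul_pow, mul_assoc]
      exact mul_le_mul_of_nonneg_left hw (by positivity)
    refine le_trans (ev_mono' (ψ := fun f => bad.indicator (fun _ => 1) f + n * B) fun f => ?_) ?_
    · rw [ev_bind, ev_tick]
      by_cases hf : f ∈ bad
      · rw [Set.indicator_of_mem hf]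
        refine le_trans ?_ le_self_add
        exact ev_le_of_forall fun y _ => Set.indicator_le_self' (fun _ _ => zero_le_one) y.1
      · rw [Set.indicator_of_notMem hf, zero_add]
        have hgood := classify_goodStep G (w := w) (g := c.γ) (f := f) ht (hdisj r S hS)
          (q := fun j => walkMean G (walkLength c μ m ε) (i, false) j / G.deg j) (by
            intro j hj
            by_contra hcon
            exact hf ⟨j, hj, not_le.mp hcon⟩)
        split_ifs with hpass
        · rw [ev_pure]
          simp
        · exact ih (r + 1) (by omega) _ (hstep r (by omega) _ _ hS hgood hpass)
    · rw [ev_add, ev_const, Nat.cast_add, Nat.cast_one, add_mul, one_mul, add_comm]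
      exact add_le_add le_rfl hbad

end

/-! ### The tuned constants and the failure probability of Find from a good start -/

section


open MultiGraph MaxCut.Comp

variable {V : Type} [Fintype V] [DecidableEq V] (G : MultiGraph V)

/-- The constant in the lower bound on the norm of the walk vector. -/
def normConst (δ μ : ℝ) : ℝ := (δ ^ 2 / 4) ^ (1 + μ) / 9

/-- The relations between the constants of the algorithm that make Find succeed. -/
structure Consts.Tuned (c : Consts) (μ CN : ℝ) : Prop where
  δ_le : c.δ ≤ 1 / 3
  γ_le : c.γ ≤ 1 / 2
  exp_δ : 1 - c.θ / 4 ≤ Real.exp (-(c.δ * (1 + 1 / μ)))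
  γ_small : 4 * c.γ ^ 2 + 16 * c.γ ^ 2 / normConst c.δ μ ≤ (c.θ / 24) ^ 2
  rounds : ∀ m : ℕ, 2 ≤ m → (numRounds c μ m : ℝ) ≤ CN * Real.log m
  τ_small : CN * c.τ < c.θ / 16 * normConst c.δ μ
  κ_large : CN / (c.γ ^ 2 * c.κ) ≤ 1 / 2

theorem normConst_pos {δ : ℝ} (hδ : 0 < δ) (μ : ℝ) : 0 < normConst δ μ := by
  unfold normConst
  positivity

/-- The values that the tallies of the walks from `i` estimate. -/
def walkValue (l : ℕ) (i j : V) : ℝ := walkMean G l (i, false) j / G.deg j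

/-- So the estimated vector is N^l e_i / √deg(i) in the coordinates of `lazyOp_quadratic_eq`. Its
norm and energy become the diagonal entries of N^(2l) and N^(2l+1), divided by deg(i). -/
theorem walkValue_eq (l : ℕ) {i : V} (hi : 0 < G.deg i) :
    walkValue G l i = fun j => ((lazyOp G ^ l) j i / √(G.deg i)) / √(G.deg j) := by
  funext j
  unfold walkValue
  rw [walkMean_eq G l hi, lazyOp_pow_symm G l i j]
  simp only [Bool.false_eq_true, if_false, one_mul]
  rw [show √(G.deg j : ℝ) / √(G.deg i : ℝ) * (lazyOp G ^ l) j i / G.deg j =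
    (√(G.deg j : ℝ) / G.deg j) * ((lazyOp G ^ l) j i / √(G.deg i : ℝ)) by ring,
    Real.sqrt_div_self']
  ring

theorem walkVec_of_deg_eq_zero (l : ℕ) {i : V} (hi : 0 < G.deg i) (j : V) (hj : G.deg j = 0) :
    (lazyOp G ^ l) j i / √(G.deg i) = 0 := by
  rw [lazyOp_pow_apply_of_deg_eq_zero G hj (by rintro rfl; omega), zero_div]

theorem normSq_walkValue (l : ℕ) {i : V} (hi : 0 < G.deg i) :
    normSq G (walkValue G l i) = (lazyOp G ^ (2 * l)) i i / G.deg i := by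
  rw [walkValue_eq G l hi, normSq_div_sqrt_eq G (walkVec_of_deg_eq_zero G l hi)]
  simp_rw [div_pow, Real.sq_sqrt (Nat.cast_nonneg (α := ℝ) (G.deg i))]
  rw [← Finset.sum_div, sum_sq_lazyOp_pow]

theorem energy_walkValue (l : ℕ) {i : V} (hi : 0 < G.deg i) :
    energy G (walkValue G l i) = (lazyOp G ^ (2 * l + 1)) i i / G.deg i := by
  rw [walkValue_eq G l hi, ← lazyOp_quadratic_eq G (walkVec_of_deg_eq_zero G l hi),
    ← quadratic_lazyOp_pow]
  have h : (fun j => (lazyOp G ^ l) j i / √(G.deg i)) =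
      (√(G.deg i : ℝ))⁻¹ • fun j => (lazyOp G ^ l) j i := by
    funext j
    simp [div_eq_inv_mul]
  have h2 : (√(G.deg i : ℝ))⁻¹ * (√(G.deg i : ℝ))⁻¹ = (G.deg i : ℝ)⁻¹ := by
    rw [← mul_inv, Real.mul_self_sqrt (Nat.cast_nonneg _)]
  rw [h, Matrix.mulVec_smul, smul_dotProduct, dotProduct_smul, smul_smul, h2, smul_eq_mul,
    inv_mul_eq_div]

theorem abs_walkValue_le (l : ℕ) {i : V} (hi : 0 < G.deg i) (j : V) : |walkValue G l i j| ≤ 1 := by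
  have h1 : (lazyOp G ^ l) j i ^ 2 ≤ 1 := by
    refine le_trans ?_ (lazyOp_pow_le_one G i (2 * l))
    rw [← sum_sq_lazyOp_pow]
    exact Finset.single_le_sum (f := fun j => (lazyOp G ^ l) j i ^ 2) (fun _ _ => sq_nonneg _)
      (Finset.mem_univ j)
  rw [walkValue_eq G l hi]
  rcases Nat.eq_zero_or_pos (G.deg j) with hj | hj
  · simp [hj]
  · have hi1 : 1 ≤ √(G.deg i : ℝ) := Real.one_le_sqrt.mpr (by exact_mod_cast hi)
    have hj1 : 1 ≤ √(G.deg j : ℝ) := Real.one_le_sqrt.mpr (by exact_mod_cast hj)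
    rw [abs_div, abs_div, abs_of_pos (by linarith : (0 : ℝ) < √(G.deg i)),
      abs_of_pos (by linarith : (0 : ℝ) < √(G.deg j))]
    exact div_le_one_of_le₀ ((div_le_self (abs_nonneg _) hi1).trans
      (((sq_le_one_iff_abs_le_one _).mp h1).trans hj1)) (by linarith)

theorem eps_lt_of_soto_ne {θ μ ε : ℝ} (hμ : 0 < μ) (hθ0 : 0 < θ) (hε : 0 ≤ ε)
    (hs : soto (sigma θ ε μ) ≠ 1 / 2) :
    ε < 1 / 3 ∧ 2 / 3 < (1 - θ) * (1 - ε) ^ (1 + 1 / μ) ∧ (1 - ε) ^ (1 + 1 / μ) ≤ 1 ∧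
      sigma θ ε μ = 1 - (1 - θ) * (1 - ε) ^ (1 + 1 / μ) := by
  have hε3 : ε < 1 / 3 := by
    by_contra h
    exact hs (sotoAt_eq_half_of_third_le hμ hθ0.le (not_lt.mp h))
  have hmax : max (1 - ε) 0 = 1 - ε := max_eq_left (by linarith)
  refine ⟨hε3, ?_, Real.rpow_le_one (by linarith) (by linarith) (one_add_inv_pos hμ).le, ?_⟩
  · by_contra h
    refine hs (sotoAt_eq_half_iff.mpr ?_)
    rw [hmax]
    exact not_lt.mp h
  · rw [sigma, hmax]

theorem sigma_pos {θ μ ε : ℝ} (hμ : 0 < μ) (hθ0 : 0 < θ) (hθ1 : θ < 1) (hε : 0 ≤ ε) :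
    0 < sigma θ ε μ := by
  unfold sigma
  have : max (1 - ε) 0 ^ (1 + 1 / μ) ≤ 1 :=
    Real.rpow_le_one (le_max_right _ _) (max_le (by linarith) zero_le_one) (one_add_inv_pos hμ).le
  nlinarith

/-- The analytic consequences of the choice of the walk length. -/
theorem walkLength_spec {c : Consts} {μ CN ε : ℝ} {m : ℕ} (hμ : 0 < μ) (hc : c.Tuned μ CN)
    (hm : 2 ≤ m) (hε0 : 0 ≤ ε) (hs : soto (sigma c.θ ε μ) ≠ 1 / 2) {E F : ℝ}
    (hE : ((1 - ε) * Real.exp (-c.δ)) ^ (2 * walkLength c μ m ε) * (c.δ ^ 2 / (4 * m)) ≤ E)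
    (hEF : E ≤ F) :
    0 < walkLength c μ m ε ∧ normConst c.δ μ / (m : ℝ) ^ (1 + μ) ≤ E ∧
      (1 - c.θ / 4) * (1 - ε) ^ (1 + 1 / μ) ≤ F ^ (1 / (2 * walkLength c μ m ε : ℝ)) := by
  obtain ⟨hε3, hK, hK1, -⟩ := eps_lt_of_soto_ne hμ c.θ_mem.1 hε0 hs
  have hδ := c.δ_mem.1
  have hδ3 := hc.δ_le
  have hm0 : (0 : ℝ) < m := by positivity
  have hm2 : (2 : ℝ) ≤ m := by exact_mod_cast hm
  have hp := one_add_inv_pos hμ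
  have hK23 : 2 / 3 < (1 - ε) ^ (1 + 1 / μ) := by
    have : 0 ≤ (1 - ε) ^ (1 + 1 / μ) := Real.rpow_nonneg (by linarith) _
    nlinarith [c.θ_mem.1]
  set β := (1 - ε) * Real.exp (-c.δ) with hβ
  have hβ0 : 0 < β := mul_pos (by linarith) (Real.exp_pos _)
  set b := c.δ - Real.log (1 - ε) with hb
  have hlog : Real.log (1 - ε) ≤ 0 := Real.log_nonpos (by linarith) (by linarith)
  have hb0 : 0 < b := by linarith
  have hβb : β = Real.exp (-b) := by
    rw [hβ, hb, neg_sub, Real.exp_sub, Real.exp_log (by linarith), Real.exp_neg, div_eq_mul_inv]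
  set L := Real.log (4 * m / c.δ ^ 2) with hL
  have hX1 : 1 < 4 * m / c.δ ^ 2 := by
    rw [lt_div_iff₀ (by positivity)]
    nlinarith
  have hL0 : 0 < L := Real.log_pos hX1
  have hexpL : Real.exp (-L) = c.δ ^ 2 / (4 * m) := by
    rw [Real.exp_neg, hL, Real.exp_log (by linarith), inv_div]
  have hl : walkLength c μ m ε = ⌈μ * L / (2 * b)⌉₊ := rfl
  set l := walkLength c μ m ε
  have hpos : 0 < μ * L / (2 * b) := by positivity
  have hl0 : 0 < l := by
    rw [hl]
    exact Nat.ceil_pos.mpr hpos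
  have hl0' : (0 : ℝ) < l := Nat.cast_pos.mpr hl0
  -- Rounding up has two effects: the lower bound on `l` controls the 2l-th root, and the upper
  -- bound `hl2` controls the loss of norm.
  have hl1 : μ * L ≤ 2 * l * b := by
    have : μ * L / (2 * b) ≤ l := hl ▸ Nat.le_ceil _
    rw [div_le_iff₀ (by positivity)] at this
    linarith
  have hl2 : 2 * l * b ≤ μ * L + 2 * b := by
    have : (l : ℝ) < μ * L / (2 * b) + 1 := hl ▸ Nat.ceil_lt_add_one hpos.le
    have h2 : μ * L / (2 * b) * (2 * b) = μ * L := by field_simp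
    nlinarith
  have hβl : β ^ (2 * l) = Real.exp (-(2 * l * b)) := by
    rw [hβb, ← Real.exp_nat_mul]
    congr 1
    push_cast
    ring
  refine ⟨hl0, ?_, ?_⟩
  · refine le_trans ?_ hE
    have h1 : Real.exp (-(μ * L)) * Real.exp (-(2 * b)) ≤ β ^ (2 * l) := by
      rw [hβl, ← Real.exp_add]
      exact Real.exp_le_exp.mpr (by linarith)
    -- The price of rounding the length up, a factor β² with β ≥ 4/9; this is the 9 in `normConst`.
    have h2 : 1 / 9 ≤ Real.exp (-(2 * b)) := by
      have e1 : Real.exp (-(2 * b)) = β ^ 2 := by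
        rw [hβb, ← Real.exp_nat_mul]
        congr 1
        push_cast
        ring
      have e2 : 2 / 3 ≤ Real.exp (-c.δ) := by
        have := Real.add_one_le_exp (-c.δ)
        linarith
      have e3 : 4 / 9 ≤ β := by
        rw [hβ]
        nlinarith
      rw [e1]
      nlinarith
    have h3 : Real.exp (-(μ * L)) = (c.δ ^ 2 / (4 * m)) ^ μ := by
      rw [← hexpL, ← Real.exp_mul]
      congr 1
      ring
    have h4 : normConst c.δ μ / (m : ℝ) ^ (1 + μ) =
        (c.δ ^ 2 / (4 * m)) ^ μ * (1 / 9) * (c.δ ^ 2 / (4 * m)) := by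
      have e1 : c.δ ^ 2 / (4 * m) = c.δ ^ 2 / 4 / m := by field_simp
      have e2 : (c.δ ^ 2 / 4 / m) ^ (1 + μ) = (c.δ ^ 2 / 4 / m) * (c.δ ^ 2 / 4 / m) ^ μ := by
        rw [Real.rpow_add (by positivity), Real.rpow_one]
      rw [e1, mul_right_comm, mul_comm (_ ^ μ), ← e2, Real.div_rpow (by positivity) hm0.le,
        normConst]
      ring
    rw [h4]
    refine mul_le_mul_of_nonneg_right ?_ (by positivity)
    refine le_trans ?_ h1
    rw [h3]
    exact mul_le_mul_of_nonneg_left h2 (by positivity)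
  · have hEpos : 0 < β ^ (2 * l) * (c.δ ^ 2 / (4 * m)) := by positivity
    refine le_trans ?_ (Real.rpow_le_rpow hEpos.le (hE.trans hEF) (by positivity))
    rw [hβl, ← hexpL, ← Real.exp_add, ← Real.exp_mul]
    have e1 : (1 - ε) ^ (1 + 1 / μ) = Real.exp (Real.log (1 - ε) * (1 + 1 / μ)) := by
      rw [Real.rpow_def_of_pos (by linarith)]
    calc (1 - c.θ / 4) * (1 - ε) ^ (1 + 1 / μ)
        ≤ Real.exp (-(c.δ * (1 + 1 / μ))) * Real.exp (Real.log (1 - ε) * (1 + 1 / μ)) := by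
          rw [e1]
          exact mul_le_mul_of_nonneg_right hc.exp_δ (Real.exp_pos _).le
      _ = Real.exp (-(b * (1 + 1 / μ))) := by
          rw [← Real.exp_add]
          congr 1
          rw [hb]
          ring
      _ ≤ _ := by
          refine Real.exp_le_exp.mpr ?_
          have e2 : (-(2 * l * b) + -L) * (1 / (2 * l)) = -b - L / (2 * l) := by
            field_simp
            ring
          rw [e2]
          have e3 : L / (2 * l) ≤ b / μ := by
            rw [div_le_div_iff₀ (by positivity) hμ]
            linarith
          have e4 : b * (1 + 1 / μ) = b + b / μ := by ring
          linarith

theorem pow_numRounds_lt {c : Consts} {μ : ℝ} {m : ℕ} (hm : 2 ≤ m) :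
    0 < numRounds c μ m ∧ (1 - c.γ) ^ numRounds c μ m ≤ c.γ / (m : ℝ) ^ (1 + μ / 2) := by
  have hγ := c.γ_mem
  have hm0 : (0 : ℝ) < m := by positivity
  have hx : 0 < c.γ / (m : ℝ) ^ (1 + μ / 2) := div_pos hγ.1 (Real.rpow_pos_of_pos hm0 _)
  have hl : Real.log (1 - c.γ) < 0 := Real.log_neg (by linarith [hγ.2]) (by linarith [hγ.1])
  refine ⟨Nat.succ_pos _, ?_⟩
  rw [← Real.log_le_log_iff (pow_pos (by linarith [hγ.2]) _) hx, Real.log_pow]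
  have h1 : Real.log (c.γ / (m : ℝ) ^ (1 + μ / 2)) / Real.log (1 - c.γ) < numRounds c μ m := by
    unfold numRounds
    push_cast
    exact Nat.lt_floor_add_one _
  rw [div_lt_iff_of_neg hl] at h1
  exact h1.le

/-- The diagonal bound `hgood` supplies the Rayleigh quotient and the norm that
`exists_round_passes` asks for. The invariant for `ev_findRounds_none` is the existence of a history
of accurate rounds that all failed, and such a history cannot have full length. Here `m` belongs to
the input graph and only dominates the volume of `G`. -/
theorem ev_find_none {c : Consts} {μ CN ε : ℝ} {m Δ : ℕ} {i : V} (hμ : 0 < μ)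
    (hc : c.Tuned μ CN) (hm : 2 ≤ m) (hvol : G.vol ≤ m) (hΔ : 0 < Δ)
    (hinc : ∀ A B, G.inc A B ≤ Δ * (A ∪ B).card) (hε0 : 0 ≤ ε)
    (hs : soto (sigma c.θ ε μ) ≠ 1 / 2) (hi : 0 < G.deg i)
    (hgood : ∀ l : ℕ, ((1 - ε) * Real.exp (-c.δ)) ^ (2 * l) *
      ((1 - ε - (1 - ε) * Real.exp (-c.δ)) * G.deg i / (4 * G.vol)) ≤
        (lazyOp G ^ (2 * l)) i i) :
    ev (find c μ m Δ G ε 1 i)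
      (({none} : Set (Option (Finset V × Finset V))).indicator fun _ => 1) ≤
        ENNReal.ofReal (1 / 2) := by
  obtain ⟨hε3, hK, hK1, hsig⟩ := eps_lt_of_soto_ne hμ c.θ_mem.1 hε0 hs
  have hδ := c.δ_mem.1
  have hδ3 := hc.δ_le
  have hγ := c.γ_mem.1
  have hγ2 := hc.γ_le
  have hθ := c.θ_mem
  have hκ := c.κ_pos
  have hm0 : (0 : ℝ) < m := by positivity
  have hlogm : 0 < Real.log m := Real.log_pos (by exact_mod_cast hm)
  have hd1 : (1 : ℝ) ≤ G.deg i := by exact_mod_cast hi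
  have hvol0 : 0 < G.vol := lt_of_lt_of_le hi
    (Finset.single_le_sum (f := G.deg) (fun _ _ => Nat.zero_le _) (Finset.mem_univ i))
  have hvol0' : (0 : ℝ) < G.vol := Nat.cast_pos.mpr hvol0
  have hvol' : (G.vol : ℝ) ≤ m := Nat.cast_le.mpr hvol
  set l := walkLength c μ m ε with hl
  have hβ0 : 0 < (1 - ε) * Real.exp (-c.δ) := mul_pos (by linarith) (Real.exp_pos _)
  -- For δ ≤ 1/3, e^(-δ) ≤ 1/(1 + δ) ≤ 1 - 3δ/4. With 1 - ε > 2/3 the right side is at least δ/2.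
  have hCH : c.δ ^ 2 ≤ 1 - ε - (1 - ε) * Real.exp (-c.δ) := by
    have h1 : Real.exp (-c.δ) ≤ 1 - 3 / 4 * c.δ := by
      rw [Real.exp_neg, inv_le_comm₀ (Real.exp_pos _) (by linarith)]
      refine le_trans ?_ (Real.add_one_le_exp c.δ)
      rw [inv_le_iff_one_le_mul₀ (by linarith)]
      nlinarith
    nlinarith
  have hE : ((1 - ε) * Real.exp (-c.δ)) ^ (2 * l) * (c.δ ^ 2 / (4 * m)) ≤
      (lazyOp G ^ (2 * l)) i i / G.deg i := by
    rw [le_div_iff₀ (by linarith), mul_assoc]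
    refine le_trans (mul_le_mul_of_nonneg_left ?_ (by positivity)) (hgood l)
    rw [div_mul_eq_mul_div]
    exact div_le_div₀ (mul_nonneg ((sq_nonneg _).trans hCH) (by linarith))
      (mul_le_mul_of_nonneg_right hCH (by linarith)) (by positivity) (by linarith)
  have hNn : 0 ≤ (lazyOp G ^ (2 * l)) i i := by
    rw [← sum_sq_lazyOp_pow]
    positivity
  obtain ⟨hl0, hnorm, hray⟩ := walkLength_spec hμ hc hm hε0 hs hE
    (div_le_self hNn hd1)
  have hq : (1 - c.θ / 4) * (1 - ε) ^ (1 + 1 / μ) * normSq G (walkValue G l i) ≤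
      energy G (walkValue G l i) := by
    rw [normSq_walkValue G l hi, energy_walkValue G l hi, ← mul_div_assoc]
    refine div_le_div_of_nonneg_right ?_ (by linarith)
    refine le_trans (mul_le_mul_of_nonneg_right hray hNn) ?_
    rw [mul_comm]
    exact lazyOp_rayleigh G i hl0
  have hc1 := normConst_pos hδ μ
  obtain ⟨hN0, hNlast⟩ := pow_numRounds_lt (c := c) (μ := μ) hm
  set N := numRounds c μ m with hN
  have hmpow : (0 : ℝ) < (m : ℝ) ^ (1 + μ) := Real.rpow_pos_of_pos hm0 _
  have hmpow2 : (0 : ℝ) < (m : ℝ) ^ (1 + μ / 2) := Real.rpow_pos_of_pos hm0 _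
  have hNL : N * c.τ < c.θ / 16 * normConst c.δ μ * Real.log m := by
    calc N * c.τ ≤ CN * Real.log m * c.τ :=
          mul_le_mul_of_nonneg_right (hc.rounds m hm) c.τ_pos.le
      _ = CN * c.τ * Real.log m := by ring
      _ < _ := mul_lt_mul_of_pos_right hc.τ_small hlogm
  -- The last round has index N - 1, one step before the threshold drops below its limit; the factor
  -- 4 covers (1 + γ)/(1 - γ) ≤ 3.
  have hb : (1 + c.γ) * (1 - c.γ) ^ (N - 1) ≤ 4 * c.γ / (m : ℝ) ^ (1 + μ / 2) := by
    have h1 : (1 - c.γ) ^ N = (1 - c.γ) * (1 - c.γ) ^ (N - 1) := by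
      rw [← pow_succ', Nat.sub_add_cancel hN0]
    rw [h1] at hNlast
    have h2 : 0 ≤ (1 - c.γ) ^ (N - 1) := pow_nonneg (by linarith) _
    have h3 : (1 + c.γ) * (1 - c.γ) ^ (N - 1) ≤ 4 * ((1 - c.γ) * (1 - c.γ) ^ (N - 1)) := by
      nlinarith
    calc _ ≤ _ := h3
      _ ≤ 4 * (c.γ / (m : ℝ) ^ (1 + μ / 2)) := by linarith
      _ = _ := by ring
  -- The vertices never classified contribute at most (last threshold)² · m to the squared error.
  -- The exponent 1 + μ/2 makes this comparable to the squared norm, of order m^-(1+μ).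
  have hD : (4 * c.γ / (m : ℝ) ^ (1 + μ / 2)) ^ 2 * G.vol ≤
      16 * c.γ ^ 2 / normConst c.δ μ * normSq G (walkValue G l i) := by
    have h1 : ((m : ℝ) ^ (1 + μ / 2)) ^ 2 = m * (m : ℝ) ^ (1 + μ) := by
      rw [← Real.rpow_natCast, ← Real.rpow_mul hm0.le]
      nth_rewrite 2 [← Real.rpow_one (m : ℝ)]
      rw [← Real.rpow_add hm0]
      congr 1
      push_cast
      ring
    rw [← normSq_walkValue G l hi] at hnorm
    calc (4 * c.γ / (m : ℝ) ^ (1 + μ / 2)) ^ 2 * G.vol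
        ≤ (4 * c.γ / (m : ℝ) ^ (1 + μ / 2)) ^ 2 * m :=
          mul_le_mul_of_nonneg_left hvol' (sq_nonneg _)
      _ = 16 * c.γ ^ 2 / normConst c.δ μ * (normConst c.δ μ / (m : ℝ) ^ (1 + μ)) := by
          rw [div_pow, h1]
          field_simp
          ring
      _ ≤ _ := mul_le_mul_of_nonneg_left hnorm (by positivity)
  have key := ev_findRounds_none G c μ Δ hm ε i N
    (fun r S => ∃ h : ℕ → Finset V × Finset V, h 0 = (∅, ∅) ∧ h r = S ∧ ∀ r' < r,
      GoodStep G (walkValue G l i) c.γ ((1 - c.γ) ^ r') (h r') (h (r' + 1)) ∧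
        ¬ Passes G c μ m Δ ε r' (h (r' + 1))) ?_ ?_ ?_ N 0 (Nat.zero_add N) (∅, ∅)
    ⟨fun _ => (∅, ∅), rfl, rfl, fun r hr => absurd hr (Nat.not_lt_zero r)⟩
  · unfold find
    rw [List.range_eq_range']
    refine key.trans ?_
    rw [← ENNReal.ofReal_natCast, ← ENNReal.ofReal_mul (Nat.cast_nonneg _)]
    refine ENNReal.ofReal_le_ofReal (le_trans ?_ hc.κ_large)
    rw [mul_one_div, div_le_div_iff₀ (by positivity) (by positivity)]
    have := mul_le_mul_of_nonneg_right (hc.rounds m hm)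
      (by positivity : 0 ≤ c.γ ^ 2 * c.κ)
    linarith
  · rintro r S ⟨h, h0, rfl, hh⟩
    rcases Nat.eq_zero_or_pos r with hr | hr
    · rw [hr, h0]
      exact Finset.disjoint_empty_left _
    · have := (hh (r - 1) (by omega)).1.disjoint
      rwa [Nat.sub_add_cancel hr] at this
  · rintro r hr S S' ⟨h, h0, rfl, hh⟩ hst hfail
    refine ⟨Function.update h (r + 1) S', ?_, Function.update_self _ _ _, fun r' hr' => ?_⟩
    · rw [Function.update_of_ne (by omega), h0]
    · rcases Nat.lt_succ_iff_lt_or_eq.mp hr' with h' | rfl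
      · rw [Function.update_of_ne (by omega), Function.update_of_ne (by omega)]
        exact hh r' h'
      · rw [Function.update_of_ne (by omega), Function.update_self]
        exact ⟨hst, hfail⟩
  · rintro S ⟨h, h0, -, hh⟩
    obtain ⟨r, hr, h1, h2⟩ := exists_round_passes G hγ hγ2 (abs_walkValue_le G l hi) hN0 h0
      (fun r hr => (hh r hr).1) hb (sigma_pos hμ hθ.1 hθ.2 hε0) hs
      (by rw [hsig]; ring) hθ.1 hθ.2 hK1 hq hD hc.γ_small hmpow hlogm
      (Nat.cast_pos.mpr hΔ) (by rwa [normSq_walkValue G l hi]) hinc c.τ_pos hNL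
    exact (hh r hr).2 ⟨h1, h2⟩

end

section


open MultiGraph MaxCut.Comp

variable {V : Type} [Fintype V] [DecidableEq V] (G : MultiGraph V)

/-! ## Outcomes and costs of Find -/

theorem walk_cost (l : ℕ) (s : V × Bool) {y : (V × Bool) × ℕ}
    (hy : y ∈ (walk G l s).law.support) : y.2 ≤ 3 * l := by
  induction l generalizing s y with
  | zero =>
    rw [walk, mem_support_pure] at hy
    simp [hy]
  | succ l ih =>
    rw [walk, mem_support_bind] at hy
    obtain ⟨p, hp, y, hy, rfl⟩ := hy
    rw [mem_support_tick] at hp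
    rw [mem_support_bind] at hy
    obtain ⟨p', hp', y, hy, rfl⟩ := hy
    rw [mem_support_sample] at hp'
    obtain ⟨b, -, rfl⟩ := hp'
    subst hp
    cases b
    · simp only [Bool.false_eq_true, if_false] at hy
      rw [mem_support_bind] at hy
      obtain ⟨p', hp', y, hy, rfl⟩ := hy
      rw [mem_support_sample] at hp'
      obtain ⟨k, -, rfl⟩ := hp'
      have := ih _ hy
      simp only
      omega
    · simp only [if_true] at hy
      have := ih _ hy
      simp only
      omega

theorem tallyWalks_cost (i : V) (l w : ℕ) (f : V → ℤ) {y : (V → ℤ) × ℕ}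
    (hy : y ∈ (tallyWalks G i l w f).law.support) : y.2 ≤ w * (3 * l + 1) := by
  induction w generalizing f y with
  | zero =>
    rw [tallyWalks, mem_support_pure] at hy
    simp [hy]
  | succ w ih =>
    rw [tallyWalks, mem_support_bind] at hy
    obtain ⟨p, hp, y, hy, rfl⟩ := hy
    rw [mem_support_bind] at hy
    obtain ⟨p', hp', y, hy, rfl⟩ := hy
    rw [mem_support_tick] at hp'
    subst hp'
    have h1 := walk_cost G l _ hp
    have h2 := ih _ hy
    simp only
    rw [add_mul]
    omega

theorem threshold_support (c : Consts) (μ : ℝ) (m : ℕ) (ε α : ℝ) (i : V) (t : ℝ)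
    (S : Finset V × Finset V) {y : (Finset V × Finset V) × ℕ}
    (hy : y ∈ (threshold c μ m G ε α i t S).law.support) :
    (∃ f, y.1 = classify G (numWalks c m α t) t f S) ∧
      y.2 ≤ numWalks c m α t * (3 * walkLength c μ m ε + 1) + (2 * Fintype.card V + 1) := by
  unfold threshold at hy
  rw [mem_support_bind] at hy
  obtain ⟨p, hp, y, hy, rfl⟩ := hy
  rw [mem_support_tick] at hp
  rw [mem_support_bind] at hy
  obtain ⟨p', hp', y, hy, rfl⟩ := hy
  rw [mem_support_bind] at hy
  obtain ⟨p'', hp'', y, hy, rfl⟩ := hy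
  rw [mem_support_tick] at hp''
  rw [mem_support_pure] at hy
  subst hp hp'' hy
  have := tallyWalks_cost G _ _ _ _ hp'
  refine ⟨⟨p'.1, rfl⟩, ?_⟩
  simp only
  omega

/-- A bound on the cost of the round `r` of Find. -/
def roundCost (c : Consts) (μ : ℝ) (m : ℕ) (ε α : ℝ) (r : ℕ) : ℕ :=
  numWalks c m α ((1 - c.γ) ^ r) * (3 * walkLength c μ m ε + 1) +
    (3 * Fintype.card V + G.vol + 2)

/-- The two cost bounds are kept apart because a failing run pays for all rounds, a successful one
only up to the round that passes. -/
theorem findRounds_support (c : Consts) (μ : ℝ) (m Δ : ℕ) (ε α : ℝ) (i : V) (n r : ℕ)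
    (S : Finset V × Finset V) (hS : Disjoint S.1 S.2) (hSd : ∀ j ∈ S.1 ∪ S.2, 0 < G.deg j)
    {y : Option (Finset V × Finset V) × ℕ}
    (hy : y ∈ (findRounds c μ m Δ G ε α i (List.range' r n) S).law.support) :
    (y.1 = none → y.2 ≤ ∑ k ∈ Finset.Ico r (r + n), roundCost G c μ m ε α k) ∧
    ∀ T, y.1 = some T → Disjoint T.1 T.2 ∧ (∀ j ∈ T.1 ∪ T.2, 0 < G.deg j) ∧
      ∃ r' ∈ Finset.Ico r (r + n), Passes G c μ m Δ ε r' T ∧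
        y.2 ≤ ∑ k ∈ Finset.Ico r (r' + 1), roundCost G c μ m ε α k := by
  induction n generalizing r S y with
  | zero =>
    rw [List.range'_zero, findRounds, mem_support_pure] at hy
    subst hy
    simp
  | succ n ih =>
    rw [List.range'_succ, findRounds, mem_support_bind] at hy
    obtain ⟨p, hp, y, hy, rfl⟩ := hy
    rw [mem_support_bind] at hy
    obtain ⟨p', hp', y, hy, rfl⟩ := hy
    rw [mem_support_tick] at hp'
    subst hp'
    have ht : 0 < (1 - c.γ) ^ r := pow_pos (by linarith [c.γ_mem.2]) r
    obtain ⟨⟨f, hf⟩, hcost⟩ := threshold_support G c μ m ε α i _ S hp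
    have hdisj : Disjoint p.1.1 p.1.2 := by
      rw [hf]
      exact classify_disjoint G ht hS
    have hdeg : ∀ j ∈ p.1.1 ∪ p.1.2, 0 < G.deg j := by
      intro j hj
      by_cases hjS : j ∈ S.1 ∪ S.2
      · exact hSd j hjS
      · rw [hf] at hj
        exact classify_deg_pos G ht hj hjS
    have hround : p.2 + (Fintype.card V + G.vol + 1) ≤ roundCost G c μ m ε α r := by
      unfold roundCost
      omega
    split_ifs at hy with hpass
    · rw [mem_support_pure] at hy
      subst hy
      refine ⟨by simp, fun T hT => ?_⟩
      simp only [Option.some.injEq] at hT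
      subst hT
      refine ⟨hdisj, hdeg, r, Finset.mem_Ico.mpr ⟨le_rfl, by omega⟩, hpass, ?_⟩
      rw [Nat.Ico_succ_singleton, Finset.sum_singleton]
      simp only
      omega
    · obtain ⟨h1, h2⟩ := ih (r + 1) p.1 hdisj hdeg hy
      constructor
      · intro hnone
        have h3 := h1 hnone
        rw [Finset.sum_eq_sum_Ico_succ_bot (by omega), show r + (n + 1) = r + 1 + n by omega]
        simp only
        omega
      · intro T hT
        obtain ⟨h3, h4, r', hr', h5, h6⟩ := h2 T hT
        rw [Finset.mem_Ico] at hr'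
        refine ⟨h3, h4, r', Finset.mem_Ico.mpr ⟨by omega, by omega⟩, h5, ?_⟩
        rw [Finset.sum_eq_sum_Ico_succ_bot (by omega)]
        simp only
        omega

theorem find_support (c : Consts) (μ : ℝ) (m Δ : ℕ) (ε α : ℝ) (i : V)
    {y : Option (Finset V × Finset V) × ℕ} (hy : y ∈ (find c μ m Δ G ε α i).law.support) :
    (y.1 = none → y.2 ≤ ∑ k ∈ Finset.range (numRounds c μ m), roundCost G c μ m ε α k) ∧
    ∀ T, y.1 = some T → Disjoint T.1 T.2 ∧ (∀ j ∈ T.1 ∪ T.2, 0 < G.deg j) ∧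
      ∃ r < numRounds c μ m, Passes G c μ m Δ ε r T ∧
        y.2 ≤ ∑ k ∈ Finset.range (r + 1), roundCost G c μ m ε α k := by
  unfold find at hy
  rw [List.range_eq_range'] at hy
  have := findRounds_support G c μ m Δ ε α i _ _ _ (by simp) (by simp) hy
  rw [zero_add, ← Finset.range_eq_Ico] at this
  refine ⟨this.1, fun T hT => ?_⟩
  obtain ⟨h1, h2, r, hr, h3, h4⟩ := this.2 T hT
  exact ⟨h1, h2, r, Finset.mem_range.mp hr, h3, by rwa [Finset.range_eq_Ico]⟩

/-- The lower bound in the size test is positive. So every success removes a vertex, and the depth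
of the recursion suffices. -/
theorem Passes.card_pos {c : Consts} {μ : ℝ} {m Δ : ℕ} {ε : ℝ} {r : ℕ} {S : Finset V × Finset V}
    (h : Passes G c μ m Δ ε r S) (hm : 2 ≤ m) (hΔ : 0 < Δ) : (S.1 ∪ S.2).Nonempty := by
  have hlog : 0 < Real.log m := Real.log_pos (by exact_mod_cast hm)
  have hm0 : (0 : ℝ) < m := by positivity
  have ht : 0 < 1 - c.γ := by linarith [c.γ_mem.2]
  have hτ := c.τ_pos
  have hΔ' : (0 : ℝ) < Δ := Nat.cast_pos.mpr hΔ
  have h1 : 0 < c.τ / (Δ * ((1 - c.γ) ^ r) ^ 2 * (m : ℝ) ^ (1 + μ) * Real.log m) := by positivity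
  have h2 := h1.trans_le h.2
  exact Finset.card_pos.mp (Nat.cast_pos.mp h2)

/-- The parallel run of Find from a list of vertices. -/
theorem parallel_find_support (c : Consts) (μ : ℝ) (m Δ : ℕ) (ε α : ℝ) (starts : List V)
    {y : Option (Finset V × Finset V) × ℕ}
    (hy : y ∈ (parallel (starts.map fun i => find c μ m Δ G ε α i)).law.support) :
    (y.1 = none → y.2 ≤ 2 * (starts.length *
      ∑ k ∈ Finset.range (numRounds c μ m), roundCost G c μ m ε α k) + starts.length) ∧
    ∀ T, y.1 = some T → Disjoint T.1 T.2 ∧ (∀ j ∈ T.1 ∪ T.2, 0 < G.deg j) ∧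
      ∃ r < numRounds c μ m, Passes G c μ m Δ ε r T ∧ y.2 ≤ 2 * (starts.length *
        ∑ k ∈ Finset.range (r + 1), roundCost G c μ m ε α k) + starts.length := by
  obtain ⟨xs, hxs, rfl⟩ := mem_support_parallel hy
  rw [List.forall₂_map_left_iff] at hxs
  have hlen := hxs.length_eq
  have hmem : ∀ x ∈ xs, ∃ i, x ∈ (find c μ m Δ G ε α i).law.support := by
    intro x hx
    obtain ⟨n, hn, rfl⟩ := List.getElem_of_mem hx
    exact ⟨starts[n], List.forall₂_iff_get.mp hxs |>.2 n (by omega) hn⟩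
  constructor
  · intro hnone
    obtain ⟨h1, h2⟩ := roundRobin_eq_none hnone
    rw [h2, hlen]
    have : (xs.map Prod.snd).sum ≤
        xs.length * ∑ k ∈ Finset.range (numRounds c μ m), roundCost G c μ m ε α k := by
      have := List.sum_le_card_nsmul (xs.map Prod.snd)
        (∑ k ∈ Finset.range (numRounds c μ m), roundCost G c μ m ε α k) (by
          intro z hz
          rw [List.mem_map] at hz
          obtain ⟨x, hx, rfl⟩ := hz
          obtain ⟨i, hi⟩ := hmem x hx
          exact (find_support G c μ m Δ ε α i hi).1 (h1 x hx))
      simpa using this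
    omega
  · intro T hT
    obtain ⟨x, hx, hxT, hcost⟩ := roundRobin_eq_some hT
    obtain ⟨i, hi⟩ := hmem x hx
    obtain ⟨h1, h2, r, hr, h3, h4⟩ := (find_support G c μ m Δ ε α i hi).2 T hxT
    refine ⟨h1, h2, r, hr, h3, hcost.trans ?_⟩
    rw [hlen]
    have := Nat.mul_le_mul_left xs.length h4
    omega

theorem randomSide_support (U : Finset V) {y : Finset V × ℕ}
    (hy : y ∈ (randomSide U).law.support) : y.1 ⊆ U ∧ y.2 = U.card + 1 := by
  unfold randomSide at hy
  rw [mem_support_bind] at hy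
  obtain ⟨p, hp, y, hy, rfl⟩ := hy
  rw [mem_support_tick] at hp
  rw [mem_support_sample] at hy
  obtain ⟨L, hL, rfl⟩ := hy
  subst hp
  rw [PMF.mem_support_uniformOfFinset_iff, Finset.mem_powerset] at hL
  exact ⟨hL, rfl⟩

end

section


open MultiGraph MaxCut.Comp

variable {V : Type} [Fintype V] [DecidableEq V]

/-! ## The recursion -/

/-- The fraction of the edges that remain when the vertices of `S` are removed. -/
def remaining (G : MultiGraph V) (S : Finset V × Finset V) : ℝ :=
  1 - G.inc S.1 S.2 / ((G.vol : ℝ) / 2)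

theorem simpleRec_succ_support (c : Consts) (μ : ℝ) (G₀ : MultiGraph V) (α : ℝ) (d : ℕ)
    (U : Finset V) (ε : ℝ) {y : Option (Finset V) × ℕ}
    (hy : y ∈ (simpleRec c μ G₀ α (d + 1) U ε).law.support) :
    (∃ L ⊆ U, y = (some L, (Fintype.card V + G₀.vol + 1) + (U.card + 1))) ∨
    (soto (sigma c.θ ε μ) ≠ 1 / 2 ∧ ∃ (starts : List V) (z : Option (Finset V × Finset V) × ℕ),
      starts.length = ⌈c.a * Real.log G₀.vol⌉₊ ∧
      z ∈ (parallel (starts.map fun i =>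
        find c μ G₀.vol G₀.maxDeg (G₀.induce U) ε α i)).law.support ∧
      ((z.1 = none ∧ y = (none, (Fintype.card V + G₀.vol + 1) + starts.length + z.2)) ∨
        ∃ S, z.1 = some S ∧ ∃ (b : Bool) (x : Option (Finset V) × ℕ),
          x ∈ (simpleRec c μ G₀ α d (U \ (S.1 ∪ S.2))
            (ε / remaining (G₀.induce U) S)).law.support ∧
          y = (x.1.map fun L => L ∪ if b then S.1 else S.2,
            2 * (Fintype.card V + G₀.vol + 1) + starts.length + z.2 + 1 + x.2))) := by
  rw [simpleRec, mem_support_bind] at hy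
  obtain ⟨p, hp, y, hy, rfl⟩ := hy
  rw [mem_support_tick] at hp
  subst hp
  simp only at hy
  split_ifs at hy with h
  · left
    rw [mem_support_bind] at hy
    obtain ⟨p, hp, y, hy, rfl⟩ := hy
    rw [mem_support_pure] at hy
    subst hy
    obtain ⟨h1, h2⟩ := randomSide_support U hp
    exact ⟨p.1, h1, by simp [h2]⟩
  · right
    rw [mem_support_bind] at hy
    obtain ⟨p, hp, y, hy, rfl⟩ := hy
    obtain ⟨hlen, hcost, -⟩ := mem_support_samples _ hp
    rw [mem_support_bind] at hy
    obtain ⟨z, hz, y, hy, rfl⟩ := hy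
    refine ⟨(not_or.mp h).1, p.1, z, hlen, hz, ?_⟩
    rcases hz1 : z.1 with _ | S
    · rw [hz1] at hy
      simp only at hy
      rw [mem_support_pure] at hy
      subst hy
      left
      exact ⟨rfl, by simp only [hcost, hlen, Prod.mk.injEq, true_and]; omega⟩
    · rw [hz1] at hy
      simp only at hy
      rw [mem_support_bind] at hy
      obtain ⟨b, hb, y, hy, rfl⟩ := hy
      rw [mem_support_sample] at hb
      obtain ⟨b, -, rfl⟩ := hb
      rw [mem_support_bind] at hy
      obtain ⟨p', hp', y, hy, rfl⟩ := hy
      rw [mem_support_tick] at hp'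
      subst hp'
      rw [mem_support_bind] at hy
      obtain ⟨x, hx, y, hy, rfl⟩ := hy
      right
      refine ⟨S, rfl, b, x, hx, ?_⟩
      rcases hx1 : x.1 with _ | L
      · rw [hx1] at hy
        simp only at hy
        rw [mem_support_pure] at hy
        subst hy
        simp only [hcost, hlen, Option.map_none, Prod.mk.injEq, true_and]
        omega
      · rw [hx1] at hy
        simp only at hy
        rw [mem_support_pure] at hy
        subst hy
        simp only [hcost, hlen, Option.map_some, Prod.mk.injEq, true_and]
        omega

theorem subset_of_deg_pos {G₀ : MultiGraph V} {U T : Finset V}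
    (h : ∀ j ∈ T, 0 < (G₀.induce U).deg j) : T ⊆ U := by
  intro j hj
  by_contra hU
  have := h j hj
  rw [deg_induce_of_notMem G₀ hU] at this
  exact lt_irrefl _ this

theorem simpleRec_subset (c : Consts) (μ : ℝ) (G₀ : MultiGraph V) (α : ℝ) (d : ℕ)
    (U : Finset V) (ε : ℝ) {y : Option (Finset V) × ℕ}
    (hy : y ∈ (simpleRec c μ G₀ α d U ε).law.support) : ∀ L, y.1 = some L → L ⊆ U := by
  induction d generalizing U ε y with
  | zero =>
    rw [simpleRec, mem_support_pure] at hy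
    simp [hy]
  | succ d ih =>
    intro L hL
    rcases simpleRec_succ_support c μ G₀ α d U ε hy with
      ⟨L', h1, rfl⟩ | ⟨-, starts, z, -, hz, ⟨-, rfl⟩ | ⟨S, hS, b, x, hx, rfl⟩⟩
    · simp only [Option.some.injEq] at hL
      exact hL ▸ h1
    · simp at hL
    · obtain ⟨-, hdeg, -⟩ := (parallel_find_support _ c μ _ _ ε α starts hz).2 S hS
      have hsub : S.1 ∪ S.2 ⊆ U := subset_of_deg_pos hdeg
      simp only [Option.map_eq_some_iff] at hL
      obtain ⟨L', hL', rfl⟩ := hL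
      have h1 := ih _ _ hx L' hL'
      refine Finset.union_subset (h1.trans Finset.sdiff_subset) ?_
      split_ifs
      · exact Finset.subset_union_left.trans hsub
      · exact Finset.subset_union_right.trans hsub

/-- The probability that all the parallel runs of Find fail. -/
theorem ev_parallel_find_none {c : Consts} {μ CN ε : ℝ} {G₀ : MultiGraph V} {U X : Finset V}
    (hμ : 0 < μ) (hc : c.Tuned μ CN) (hm : 2 ≤ G₀.vol) (hΔ : 0 < G₀.maxDeg) (hε0 : 0 ≤ ε)
    (hs : soto (sigma c.θ ε μ) ≠ 1 / 2) (h : ∑ j, (G₀.induce U).deg j ≠ 0)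
    (hX : (G₀.induce U).uncut X ≤ ε * ((G₀.induce U).vol / 2)) (k : ℕ) :
    ev (samples (proportional (G₀.induce U).deg h) k) (fun starts =>
      ev (parallel (starts.map fun i => find c μ G₀.vol G₀.maxDeg (G₀.induce U) ε 1 i))
        (({none} : Set (Option (Finset V × Finset V))).indicator fun _ => 1)) ≤
      ENNReal.ofReal ((1 - c.δ ^ 2 / 8) ^ k) := by
  set G := G₀.induce U with hG
  have hδ := c.δ_mem.1
  have hδ3 := hc.δ_le
  obtain ⟨hε3, -⟩ := eps_lt_of_soto_ne hμ c.θ_mem.1 hε0 hs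
  have hvol : 0 < G.vol := Nat.pos_of_ne_zero h
  have hvol' : (0 : ℝ) < G.vol := Nat.cast_pos.mpr hvol
  have h34 : Real.exp (-c.δ) ≤ 1 - 3 / 4 * c.δ := by
    rw [Real.exp_neg, inv_le_comm₀ (Real.exp_pos _) (by linarith)]
    refine le_trans ?_ (Real.add_one_le_exp c.δ)
    rw [inv_le_iff_one_le_mul₀ (by linarith)]
    nlinarith
  have hCH : c.δ ^ 2 ≤ 1 - ε - (1 - ε) * Real.exp (-c.δ) := by nlinarith
  obtain ⟨B, hB, hBi⟩ := exists_good_starts G (ε := ε) (β := (1 - ε) * Real.exp (-c.δ)) hvol hX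
    (mul_nonneg (by linarith) (Real.exp_pos _).le) (by nlinarith)
  have hψ : ∀ i, ev (find c μ G₀.vol G₀.maxDeg G ε 1 i)
      (({none} : Set (Option (Finset V × Finset V))).indicator fun _ => 1) ≤
        ENNReal.ofReal (1 - ind B i / 2) := by
    intro i
    by_cases hi : i ∈ B
    · rw [ind_of_mem hi]
      norm_num
      have := ev_find_none G hμ hc hm (vol_induce_le G₀ U) hΔ
        (fun A B => by simpa using inc_induce_le G₀ U A B) hε0 hs (hBi i hi).1 (hBi i hi).2
      simpa using this
    · rw [ind_of_notMem hi]
      simp only [zero_div, sub_zero, ENNReal.ofReal_one]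
      exact ev_le_of_forall fun y _ => Set.indicator_le_self' (fun _ _ => zero_le_one) y.1
  have hone : ∀ i, (0 : ℝ) ≤ 1 - ind B i / 2 := fun i => by linarith [ind_le_one B i]
  -- The good starts hold at least a share δ²/4 of the volume and fail with probability at most 1/2;
  -- the others may always fail.
  have hpev : pev (proportional G.deg h) (fun i => ENNReal.ofReal (1 - ind B i / 2)) ≤
      ENNReal.ofReal (1 - c.δ ^ 2 / 8) := by
    rw [pev_fintype]
    simp_rw [proportional_apply]
    have : ∀ i, ENNReal.ofReal ((G.deg i : ℝ) / ∑ v, (G.deg v : ℝ)) *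
        ENNReal.ofReal (1 - ind B i / 2) =
        ENNReal.ofReal ((G.deg i : ℝ) / G.vol * (1 - ind B i / 2)) := fun i => by
      rw [ENNReal.ofReal_mul (by positivity), vol, Nat.cast_sum]
    simp_rw [this]
    rw [← ENNReal.ofReal_sum_of_nonneg fun i _ => mul_nonneg (by positivity) (hone i)]
    refine ENNReal.ofReal_le_ofReal ?_
    have e1 : ∑ i, (G.deg i : ℝ) / G.vol * (1 - ind B i / 2) =
        1 - (∑ i ∈ B, (G.deg i : ℝ)) / G.vol / 2 := by
      have e2 : ∑ i, (G.deg i : ℝ) / G.vol = 1 := by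
        rw [← Finset.sum_div, ← Nat.cast_sum, div_eq_one_iff_eq hvol'.ne']
        rfl
      have e3 : ∑ i, (G.deg i : ℝ) / G.vol * (ind B i / 2) =
          (∑ i ∈ B, (G.deg i : ℝ)) / G.vol / 2 := by
        rw [Finset.sum_div, Finset.sum_div]
        have : ∀ i, (G.deg i : ℝ) / G.vol * (ind B i / 2) =
            if i ∈ B then (G.deg i : ℝ) / G.vol / 2 else 0 := fun i => by
          unfold ind
          split_ifs <;> ring
        simp_rw [this, Finset.sum_ite_mem, Finset.univ_inter]
      simp_rw [mul_sub, mul_one]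
      rw [Finset.sum_sub_distrib, e2, e3]
    rw [e1]
    have e4 : c.δ ^ 2 / 4 ≤ (∑ i ∈ B, (G.deg i : ℝ)) / G.vol := by
      rw [le_div_iff₀ hvol']
      refine le_trans (mul_le_mul_of_nonneg_right ?_ hvol'.le) hB
      linarith
    linarith
  have hnn : (0 : ℝ) ≤ 1 - c.δ ^ 2 / 8 := by nlinarith
  refine le_trans (ev_mono' (ψ := fun starts =>
    (starts.map fun i => ENNReal.ofReal (1 - ind B i / 2)).prod) fun starts => ?_) ?_
  · refine (ev_parallel_none _).trans ?_
    rw [List.map_map]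
    induction starts with
    | nil => simp
    | cons i starts ih =>
      rw [List.map_cons, List.prod_cons, List.map_cons, List.prod_cons]
      exact mul_le_mul' (hψ i) ih
  · rw [ev_samples_prod, ENNReal.ofReal_pow hnn]
    exact pow_le_pow_left' hpev k

/-- The number of uncut edges of the result of a recursive call; failure counts as `e₀`. -/
def outCost (G : MultiGraph V) (e₀ : ℝ) : Option (Finset V) → ℝ≥0∞
  | none => ENNReal.ofReal e₀
  | some L => ENNReal.ofReal (G.uncut L)

/-- Induction with the potential e_U - e₀ perf(e_U / e₀), where e_U counts the remaining edges.
Dividing ε by ξ keeps ε e_U = ε₀ e₀, so the current parameter is ε₀ / z at z = e_U / e₀, the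
argument in the integrand. A success leaves inc - cut ≤ (1 - 𝒮) inc edges uncut on average over the
coin, and `perf_sub_le` shows that the potential pays for them. Each level adds at most φ e₀ for a
failed search. -/
theorem ev_simpleRec {c : Consts} {μ CN ε₀ : ℝ} {G₀ : MultiGraph V} {X : Finset V}
    (hμ : 0 < μ) (hc : c.Tuned μ CN) (hm : 2 ≤ G₀.vol) (hΔ : 0 < G₀.maxDeg) (hε₀ : 0 ≤ ε₀)
    {e₀ φ : ℝ} (he₀ : e₀ = G₀.vol / 2)
    (hφ : (1 - c.δ ^ 2 / 8) ^ ⌈c.a * Real.log G₀.vol⌉₊ ≤ φ) (d : ℕ) (U : Finset V) (ε : ℝ)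
    (hε : 0 ≤ ε) (hU : U.card < d)
    (hεU : (G₀.induce U).vol = 0 ∨ ε * ((G₀.induce U).vol / 2) = ε₀ * e₀)
    (hX : soto (sigma c.θ ε μ) ≠ 1 / 2 →
      (G₀.induce U).uncut X ≤ ε * ((G₀.induce U).vol / 2)) :
    ev (simpleRec c μ G₀ 1 d U ε) (outCost (G₀.induce U) e₀) ≤
      ENNReal.ofReal ((G₀.induce U).vol / 2 -
        e₀ * perf c.θ μ ε₀ ((G₀.induce U).vol / 2 / e₀) + d * (φ * e₀)) := by
  induction d generalizing U ε with
  | zero => exact absurd hU (Nat.not_lt_zero _)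
  | succ d ih =>
    have hm' : (2 : ℝ) ≤ G₀.vol := by exact_mod_cast hm
    have he₀pos : 0 < e₀ := by rw [he₀]; linarith
    have hθ := c.θ_mem
    have hδ := c.δ_mem.1
    have hδ3 := hc.δ_le
    have hφ0 : 0 ≤ φ := le_trans (pow_nonneg (by nlinarith) _) hφ
    set G := G₀.induce U with hG
    set eU : ℝ := (G.vol : ℝ) / 2 with heU
    have heU0 : 0 ≤ eU := by positivity
    have hzdiv : G.vol ≠ 0 → ε₀ / (eU / e₀) = ε := by
      intro hv
      have hv' : (0 : ℝ) < G.vol := Nat.cast_pos.mpr (Nat.pos_of_ne_zero hv)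
      have h1 := hεU.resolve_left hv
      rw [div_div_eq_mul_div, ← h1]
      exact mul_div_cancel_right₀ _ (by positivity)
    have hstep : ∀ e' : ℝ, 0 ≤ e' → e' ≤ eU → G.vol ≠ 0 →
        e₀ * (perf c.θ μ ε₀ (eU / e₀) - perf c.θ μ ε₀ (e' / e₀)) ≤
          sotoAt c.θ μ ε * (eU - e') := by
      intro e' h0 h1 hv
      have := perf_sub_le (θ := c.θ) hμ hθ.2.le hε₀ (div_nonneg h0 he₀pos.le)
        (div_le_div_of_nonneg_right h1 he₀pos.le)
      rw [hzdiv hv] at this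
      calc _ ≤ e₀ * (sotoAt c.θ μ ε * (eU / e₀ - e' / e₀)) :=
            mul_le_mul_of_nonneg_left this he₀pos.le
        _ = _ := by field_simp
    have hRU : 0 ≤ eU - e₀ * perf c.θ μ ε₀ (eU / e₀) := by
      by_cases hv : G.vol = 0
      · simp [heU, hv, perf_zero]
      · have := hstep 0 le_rfl heU0 hv
        rw [zero_div, perf_zero, sub_zero, sub_zero] at this
        have h1 : sotoAt c.θ μ ε ≤ 1 := soto_le_one _
        nlinarith
    rw [simpleRec, ev_bind, ev_tick]
    simp only
    split_ifs with h
    · rw [ev_bind]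
      simp only [ev_pure, outCost]
      refine (ev_randomSide G₀ U).trans (ENNReal.ofReal_le_ofReal ?_)
      have hd : 0 ≤ ((d + 1 : ℕ) : ℝ) * (φ * e₀) := by positivity
      have : e₀ * perf c.θ μ ε₀ (eU / e₀) ≤ eU / 2 := by
        by_cases hv : G.vol = 0
        · simp [heU, hv, perf_zero]
        · have h1 := hstep 0 le_rfl heU0 hv
          rw [zero_div, perf_zero, sub_zero, sub_zero] at h1
          rw [show sotoAt c.θ μ ε = 1 / 2 from h.resolve_right hv] at h1
          linarith
      rw [← hG, show (G.vol : ℝ) / 4 = eU / 2 by rw [heU]; ring]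
      linarith
    · obtain ⟨hs, hvol⟩ := not_or.mp h
      have hv : G.vol ≠ 0 := hvol
      have hvpos : (0 : ℝ) < G.vol := Nat.cast_pos.mpr (Nat.pos_of_ne_zero hv)
      have heUpos : 0 < eU := by positivity
      set R : ℝ := eU - e₀ * perf c.θ μ ε₀ (eU / e₀) + d * (φ * e₀) with hR
      have hR0 : 0 ≤ R := add_nonneg hRU (by positivity)
      rw [ev_bind]
      refine le_trans (ev_mono' (ψ := fun starts =>
        ev (parallel (starts.map fun i => find c μ G₀.vol G₀.maxDeg G ε 1 i))
          (({none} : Set (Option (Finset V × Finset V))).indicator fun _ => 1) *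
            ENNReal.ofReal e₀ + ENNReal.ofReal R) fun starts => ?_) ?_
      · rw [ev_bind, ← ev_mul_right, ← ev_const (parallel (starts.map fun i =>
          find c μ G₀.vol G₀.maxDeg G ε 1 i)) (ENNReal.ofReal R), ← ev_add]
        refine ev_mono fun y hy => ?_
        rcases hy1 : y.1 with _ | S
        · simp only [ev_pure, outCost, Set.mem_singleton_iff, Set.indicator_of_mem, one_mul]
          exact le_self_add
        · refine le_trans ?_ le_add_self
          simp only
          obtain ⟨hdisj, hdeg, r, -, hpass, -⟩ :=
            (parallel_find_support G c μ _ _ ε 1 starts hy).2 S hy1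
          have hsub : S.1 ∪ S.2 ⊆ U := subset_of_deg_pos hdeg
          have hne := hpass.card_pos G hm hΔ
          set U' := U \ (S.1 ∪ S.2) with hU'
          set e' : ℝ := ((G₀.induce U').vol : ℝ) / 2 with he'
          have he'0 : 0 ≤ e' := by positivity
          have hinc : G.inc S.1 S.2 = eU - e' := inc_induce_eq G₀ hsub
          have hinc0 := G.inc_nonneg S.1 S.2
          have hci := G.cut_le_inc hdisj
          have hcard : U'.card < d := by
            have h1 : U'.card < U.card := by
              refine Finset.card_lt_card (Finset.sdiff_ssubset hsub hne)
            omega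
          have hrem : 1 - G.inc S.1 S.2 / ((G.vol : ℝ) / 2) = e' / eU := by
            rw [hinc, ← heU]
            field_simp
            ring
          have hmul : e' ≠ 0 → ε / (e' / eU) * e' = ε * eU := by
            intro h0
            field_simp
          -- If no edge remains, the new parameter is a division by zero and the invariant is lost,
          -- which the first alternative of `hεU` permits. Otherwise the reference cut `X` misses no
          -- more edges than before, while ε e_U is unchanged.
          have hIH := ih U' (ε / (e' / eU)) (div_nonneg hε (div_nonneg he'0 heU0)) hcard (by
            by_cases h0 : (G₀.induce U').vol = 0
            · exact Or.inl h0
            · right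
              have h0' : e' ≠ 0 := div_ne_zero (Nat.cast_ne_zero.mpr h0) two_ne_zero
              rw [← he', hmul h0']
              exact hεU.resolve_left hv) (fun _ => by
            rw [← he']
            by_cases h0 : e' = 0
            · rw [h0, mul_zero]
              exact (uncut_le _ _).trans (le_of_eq h0)
            · rw [hmul h0]
              exact (uncut_induce_mono G₀ Finset.sdiff_subset X).trans (hX hs))
          rw [← he'] at hIH
          simp only [ev_bind, ev_sample, ev_tick]
          -- The coin is tossed before the recursive call but does not influence it, so both
          -- outcomes can be averaged for a fixed result of that call.
          rw [ev_coin, ← ev_add, div_eq_mul_inv, ← ev_mul_right]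
          refine le_trans (ev_mono (ψ := fun o => ENNReal.ofReal (G.inc S.1 S.2 - G.cut S.1 S.2) +
            outCost (G₀.induce U') e₀ o) fun x hx => ?_) ?_
          · rcases hx1 : x.1 with _ | L
            · simp only [ev_pure, outCost]
              rw [← div_eq_mul_inv, ENNReal.add_div, ENNReal.add_halves]
              exact le_add_self
            · have hL := simpleRec_subset c μ G₀ 1 d U' _ hx L hx1
              simp only [ev_pure, outCost, if_true, Bool.false_eq_true, if_false]
              rw [← ENNReal.ofReal_add (uncut_nonneg _ _) (uncut_nonneg _ _),
                uncut_union_add G₀ hdisj hsub hL, ← hG, ← hU',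
                ← ENNReal.ofReal_add (by linarith) (uncut_nonneg _ _), ← div_eq_mul_inv,
                show (2 : ℝ≥0∞) = ENNReal.ofReal 2 by simp, ← ENNReal.ofReal_div_of_pos two_pos]
              refine ENNReal.ofReal_le_ofReal (le_of_eq ?_)
              ring
          · rw [ev_add, ev_const, ← hG, hrem]
            refine (add_le_add le_rfl hIH).trans ?_
            have hst := hstep e' he'0 (by linarith) hv
            have hcut : sotoAt c.θ μ ε * (eU - e') ≤ G.cut S.1 S.2 := hinc ▸ hpass.1
            have hR' : 0 ≤ e' - e₀ * perf c.θ μ ε₀ (e' / e₀) := by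
              have h1 := perf_sub_le (θ := c.θ) (x := 0) (y := e' / e₀) hμ hθ.2.le hε₀ le_rfl
                (div_nonneg he'0 he₀pos.le)
              rw [perf_zero, sub_zero, sub_zero] at h1
              have h2 : sotoAt c.θ μ (ε₀ / (e' / e₀)) ≤ 1 := soto_le_one _
              have h3 : perf c.θ μ ε₀ (e' / e₀) ≤ e' / e₀ :=
                h1.trans (mul_le_of_le_one_left (div_nonneg he'0 he₀pos.le) h2)
              have h4 := mul_le_mul_of_nonneg_left h3 he₀pos.le
              rw [mul_div_cancel₀ _ he₀pos.ne'] at h4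
              linarith
            rw [← ENNReal.ofReal_add (by linarith) (add_nonneg hR' (by positivity))]
            refine ENNReal.ofReal_le_ofReal ?_
            rw [hR]
            linarith
      · rw [ev_add, ev_const, ev_mul_right]
        have hfail := ev_parallel_find_none hμ hc hm hΔ hε hs hvol (hX hs)
          ⌈c.a * Real.log G₀.vol⌉₊
        refine (add_le_add (mul_le_mul' (hfail.trans (ENNReal.ofReal_le_ofReal hφ)) le_rfl)
          le_rfl).trans ?_
        rw [← ENNReal.ofReal_mul hφ0, ← ENNReal.ofReal_add (by positivity) hR0]
        refine ENNReal.ofReal_le_ofReal (le_of_eq ?_)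
        rw [hR]
        push_cast
        ring

/-- The expected number of uncut edges of the output of Simple. -/
theorem ev_simple {c : Consts} {μ CN ε : ℝ} {G : MultiGraph V} {X : Finset V}
    (hμ : 0 < μ) (hc : c.Tuned μ CN) (hm : 2 ≤ G.vol) (hΔ : 0 < G.maxDeg) (hε : 0 ≤ ε)
    {φ : ℝ} (hφ : (1 - c.δ ^ 2 / 8) ^ ⌈c.a * Real.log G.vol⌉₊ ≤ φ)
    (hX : soto (sigma c.θ ε μ) ≠ 1 / 2 → G.uncut X ≤ ε * (G.vol / 2)) :
    ev (simple c μ G ε 1) (fun L => ENNReal.ofReal (G.uncut L)) ≤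
      ENNReal.ofReal ((1 - perf c.θ μ ε 1 + (Fintype.card V + 1) * φ) * (G.vol / 2)) := by
  have hm' : (2 : ℝ) ≤ G.vol := by exact_mod_cast hm
  have h := ev_simpleRec (X := X) hμ hc hm hΔ hε rfl hφ (Fintype.card V + 1) Finset.univ ε hε
    (by rw [Finset.card_univ]; omega) (Or.inr (by rw [induce_univ]))
    (by rw [induce_univ]; exact hX)
  rw [induce_univ, div_self (by positivity)] at h
  unfold simple
  rw [ev_bind]
  refine le_trans (le_trans (ev_mono' fun o => ?_) h) (ENNReal.ofReal_le_ofReal (le_of_eq ?_))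
  · rcases o with _ | L
    · simp only [outCost]
      have := ev_randomSide G Finset.univ
      rw [induce_univ] at this
      exact this.trans (ENNReal.ofReal_le_ofReal (by linarith))
    · simp only [ev_pure, outCost]
      exact le_rfl
  · push_cast
    ring

end

section


open MultiGraph MaxCut.Comp

variable {V : Type} [Fintype V] [DecidableEq V]

/-! ## The running time -/

/-- The constant in the bound on the length of the walks. -/
def lengthConst (c : Consts) (μ : ℝ) : ℝ := μ * (Real.log (4 / c.δ ^ 2) + 1) / (2 * c.δ) + 1

theorem log_four_div_nonneg (c : Consts) : 0 ≤ Real.log (4 / c.δ ^ 2) := by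
  obtain ⟨h0, h1⟩ := c.δ_mem
  refine Real.log_nonneg ?_
  rw [le_div_iff₀ (by positivity)]
  nlinarith

theorem lengthConst_nonneg (c : Consts) {μ : ℝ} (hμ : 0 < μ) : 0 ≤ lengthConst c μ := by
  have h0 := c.δ_mem.1
  have h1 := log_four_div_nonneg c
  unfold lengthConst
  positivity

theorem log_nonneg_of_two_le {m : ℕ} (hm : 2 ≤ m) : 0 ≤ Real.log m :=
  Real.log_nonneg (by exact_mod_cast (by omega : 1 ≤ m))

theorem walkLength_le {c : Consts} {μ ε : ℝ} {m : ℕ} (hμ : 0 < μ) (hm : 2 ≤ m) (hε0 : 0 ≤ ε)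
    (hε1 : ε < 1) : (walkLength c μ m ε : ℝ) ≤ lengthConst c μ * (1 + Real.log m) := by
  obtain ⟨hδ0, hδ1⟩ := c.δ_mem
  have hlm := log_nonneg_of_two_le hm
  have hl4 := log_four_div_nonneg c
  have hm0 : (0 : ℝ) < m := by positivity
  have hlog : Real.log (4 * m / c.δ ^ 2) = Real.log (4 / c.δ ^ 2) + Real.log m := by
    rw [← Real.log_mul (by positivity) hm0.ne']
    congr 1
    ring
  have hle : Real.log (1 - ε) ≤ 0 := Real.log_nonpos (by linarith) (by linarith)
  have hx : 0 ≤ μ * Real.log (4 * m / c.δ ^ 2) := by rw [hlog]; positivity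
  unfold walkLength
  refine (Nat.ceil_lt_add_one (div_nonneg hx (by linarith))).le.trans ?_
  have h1 : μ * Real.log (4 * m / c.δ ^ 2) / (2 * (c.δ - Real.log (1 - ε))) ≤
      μ * Real.log (4 * m / c.δ ^ 2) / (2 * c.δ) :=
    div_le_div_of_nonneg_left hx (by positivity) (by linarith)
  have h2 : μ * Real.log (4 * m / c.δ ^ 2) / (2 * c.δ) ≤
      μ * (Real.log (4 / c.δ ^ 2) + 1) / (2 * c.δ) * (1 + Real.log m) := by
    rw [div_mul_eq_mul_div, mul_assoc]
    gcongr
    rw [hlog]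
    nlinarith
  unfold lengthConst
  nlinarith

theorem numWalks_le {c : Consts} {m : ℕ} {t : ℝ} (hm : 2 ≤ m) (ht0 : 0 < t) (ht1 : t ≤ 1) :
    (numWalks c m 1 t : ℝ) ≤ (c.κ + 1) * (1 + Real.log m) * (1 / t ^ 2) := by
  have hlm := log_nonneg_of_two_le hm
  have hκ := c.κ_pos
  unfold numWalks
  rw [max_eq_left ht1, mul_one]
  refine (Nat.ceil_lt_add_one (by positivity)).le.trans ?_
  have h1 : 1 ≤ 1 / t ^ 2 := by
    rw [le_div_iff₀ (by positivity), one_mul]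
    exact pow_le_one₀ ht0.le ht1
  rw [div_eq_mul_one_div]
  nlinarith [mul_nonneg hκ.le (zero_le_one.trans h1), mul_nonneg hlm (zero_le_one.trans h1)]

theorem le_pow_of_lt_numRounds {c : Consts} {μ : ℝ} {m r : ℕ} (hμ : 0 < μ) (hm : 2 ≤ m)
    (hr : r < numRounds c μ m) : c.γ / (m : ℝ) ^ (1 + μ / 2) ≤ (1 - c.γ) ^ r := by
  obtain ⟨hγ0, hγ1⟩ := c.γ_mem
  have hm1 : (1 : ℝ) ≤ m := by exact_mod_cast (by omega : 1 ≤ m)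
  have hm0 : (0 : ℝ) < m := by linarith
  have hx : 0 < c.γ / (m : ℝ) ^ (1 + μ / 2) := div_pos hγ0 (Real.rpow_pos_of_pos hm0 _)
  have hx1 : c.γ / (m : ℝ) ^ (1 + μ / 2) ≤ 1 := by
    rw [div_le_one (Real.rpow_pos_of_pos hm0 _)]
    exact hγ1.le.trans (Real.one_le_rpow hm1 (by positivity))
  have hl : Real.log (1 - c.γ) < 0 := Real.log_neg (by linarith) (by linarith)
  have h1 : (r : ℝ) ≤ Real.log (c.γ / (m : ℝ) ^ (1 + μ / 2)) / Real.log (1 - c.γ) := by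
    rw [← Nat.le_floor_iff (div_nonneg_of_nonpos (Real.log_nonpos hx.le hx1) hl.le)]
    exact Nat.lt_succ_iff.mp hr
  rw [le_div_iff_of_neg hl, ← Real.log_pow] at h1
  exact (Real.log_le_log_iff hx (pow_pos (by linarith) _)).mp h1

/-- The worst case for the number of walks. It is needed only for searches in which every start
fails. -/
theorem one_div_sq_le_of_lt_numRounds {c : Consts} {μ : ℝ} {m r : ℕ} (hμ : 0 < μ) (hm : 2 ≤ m)
    (hr : r < numRounds c μ m) :
    1 / ((1 - c.γ) ^ r) ^ 2 ≤ (m : ℝ) ^ (2 + μ) / c.γ ^ 2 := by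
  have h := le_pow_of_lt_numRounds hμ hm hr
  have hγ := c.γ_mem.1
  have hm0 : (0 : ℝ) < m := by positivity
  have hp : (0 : ℝ) < (m : ℝ) ^ (1 + μ / 2) := Real.rpow_pos_of_pos hm0 _
  have h2 : (m : ℝ) ^ (2 + μ) = ((m : ℝ) ^ (1 + μ / 2)) ^ 2 := by
    rw [← Real.rpow_natCast, ← Real.rpow_mul hm0.le]
    congr 1
    push_cast
    ring
  rw [h2, ← div_pow, ← one_div_pow]
  refine pow_le_pow_left₀ (one_div_nonneg.mpr ((div_pos hγ hp).le.trans h)) ?_ 2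
  rw [← one_div_div c.γ]
  exact one_div_le_one_div_of_le (div_pos hγ hp) h

/-- The constant in the bound on the cost of a round. -/
def roundConst (c : Consts) (μ : ℝ) : ℝ := (c.κ + 1) * (3 * lengthConst c μ + 1)

theorem roundConst_nonneg (c : Consts) {μ : ℝ} (hμ : 0 < μ) : 0 ≤ roundConst c μ := by
  have := lengthConst_nonneg c hμ
  have := c.κ_pos
  unfold roundConst
  positivity

theorem roundCost_le {c : Consts} {μ ε : ℝ} {G : MultiGraph V} {m k r : ℕ} (hμ : 0 < μ)
    (hm : 2 ≤ m) (hε0 : 0 ≤ ε) (hε1 : ε < 1) (hV : Fintype.card V ≤ m) (hvol : G.vol ≤ m)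
    (hk : k ≤ r) : (roundCost G c μ m ε 1 k : ℝ) ≤
      roundConst c μ * (1 + Real.log m) ^ 2 * (1 / ((1 - c.γ) ^ r) ^ 2) + 5 * m := by
  obtain ⟨hγ0, hγ1⟩ := c.γ_mem
  have hlm := log_nonneg_of_two_le hm
  have hκ := c.κ_pos
  have hL := lengthConst_nonneg c hμ
  have hb0 : 0 < 1 - c.γ := by linarith
  have h1 := numWalks_le (c := c) hm (pow_pos hb0 k) (pow_le_one₀ hb0.le (by linarith))
  have h2 : 1 / ((1 - c.γ) ^ k) ^ 2 ≤ 1 / ((1 - c.γ) ^ r) ^ 2 := by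
    refine one_div_le_one_div_of_le (by positivity) (pow_le_pow_left₀ (by positivity) ?_ 2)
    exact pow_le_pow_of_le_one hb0.le (by linarith) hk
  have h3 : (numWalks c m 1 ((1 - c.γ) ^ k) : ℝ) ≤
      (c.κ + 1) * (1 + Real.log m) * (1 / ((1 - c.γ) ^ r) ^ 2) :=
    h1.trans (mul_le_mul_of_nonneg_left h2 (by positivity))
  have h4 : (3 * walkLength c μ m ε + 1 : ℝ) ≤ (3 * lengthConst c μ + 1) * (1 + Real.log m) := by
    have := walkLength_le (c := c) hμ hm hε0 hε1
    linarith
  have h5 : ((3 * Fintype.card V + G.vol + 2 : ℕ) : ℝ) ≤ 5 * m := by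
    exact_mod_cast (by omega : 3 * Fintype.card V + G.vol + 2 ≤ 5 * m)
  unfold roundCost
  push_cast at h5 ⊢
  refine add_le_add ((mul_le_mul h3 h4 (by positivity) (by positivity)).trans (le_of_eq ?_)) h5
  unfold roundConst
  ring

/-- The constant in the bound on the cost of the parallel searches. -/
def searchConst (c : Consts) (μ CN : ℝ) : ℝ :=
  (c.a + 1) * (2 * (CN * (roundConst c μ * (1 / c.γ ^ 2 + 1 / c.τ) + 5)) + 1)

theorem Consts.Tuned.CN_nonneg {c : Consts} {μ CN : ℝ} (hc : c.Tuned μ CN) : 0 ≤ CN := by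
  have h := hc.rounds 2 le_rfl
  have hl : (0 : ℝ) < Real.log (2 : ℕ) := Real.log_pos (by norm_num)
  by_contra hneg
  have := mul_neg_of_neg_of_pos (not_le.mp hneg) hl
  have : (0 : ℝ) ≤ numRounds c μ 2 := Nat.cast_nonneg _
  linarith

theorem searchConst_nonneg {c : Consts} {μ CN : ℝ} (hμ : 0 < μ) (hc : c.Tuned μ CN) :
    0 ≤ searchConst c μ CN := by
  have := hc.CN_nonneg
  have := roundConst_nonneg c hμ
  have := c.a_pos
  have := c.τ_pos
  unfold searchConst
  positivity

/-- Common to failing and successful searches: `X` bounds 1/t² and `Q` is the budget. Of the five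
logarithmic factors one comes from the starts, one from the rounds, two from the number and length
of the walks, and one from `X`. -/
theorem search_cost_le {c : Consts} {μ CN Q X : ℝ} {m n : ℕ} (hμ : 0 < μ) (hc : c.Tuned μ CN)
    (hm : 2 ≤ m) (hn : n ≤ numRounds c μ m) {f : ℕ → ℕ} {starts : ℕ}
    (hlen : starts = ⌈c.a * Real.log m⌉₊) (hQ : 1 ≤ Q) (hmQ : m ≤ Q)
    (hX : X ≤ (1 / c.γ ^ 2 + 1 / c.τ) * (1 + Real.log m) * Q)
    (hf : ∀ k < n, (f k : ℝ) ≤ roundConst c μ * (1 + Real.log m) ^ 2 * X + 5 * m) :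
    ((2 * (starts * ∑ k ∈ Finset.range n, f k) + starts : ℕ) : ℝ) ≤
      searchConst c μ CN * (1 + Real.log m) ^ 5 * Q := by
  have hlm := log_nonneg_of_two_le hm
  set P := 1 + Real.log m with hP
  have hP1 : 1 ≤ P := by linarith
  have hP0 : 0 ≤ P := by linarith
  have hCN := hc.CN_nonneg
  have hR := roundConst_nonneg c hμ
  have ha := c.a_pos
  have hτ := c.τ_pos
  have hs : (starts : ℝ) ≤ (c.a + 1) * P := by
    rw [hlen]
    refine (Nat.ceil_lt_add_one (by positivity)).le.trans ?_
    rw [hP]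
    nlinarith
  set W := roundConst c μ * (1 / c.γ ^ 2 + 1 / c.τ) + 5 with hW
  have hW0 : 0 ≤ W := by positivity
  have hfk : ∀ k ∈ Finset.range n, (f k : ℝ) ≤ W * P ^ 3 * Q := by
    intro k hk
    refine (hf k (Finset.mem_range.mp hk)).trans ?_
    have h1 := mul_le_mul_of_nonneg_left hX (by positivity : 0 ≤ roundConst c μ * P ^ 2)
    have h2 : (m : ℝ) ≤ P ^ 3 * Q :=
      hmQ.trans (le_mul_of_one_le_left (by linarith) (one_le_pow₀ hP1))
    calc _ ≤ roundConst c μ * P ^ 2 * ((1 / c.γ ^ 2 + 1 / c.τ) * P * Q) + 5 * (P ^ 3 * Q) := by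
          linarith
      _ = _ := by rw [hW]; ring
  have hnP : (n : ℝ) ≤ CN * P := by
    have h1 : (n : ℝ) ≤ numRounds c μ m := by exact_mod_cast hn
    have h2 := hc.rounds m hm
    nlinarith
  have hsum : (∑ k ∈ Finset.range n, (f k : ℝ)) ≤ CN * W * P ^ 4 * Q := by
    refine (Finset.sum_le_card_nsmul _ _ _ hfk).trans ?_
    rw [Finset.card_range, nsmul_eq_mul]
    refine (mul_le_mul_of_nonneg_right hnP (by positivity)).trans (le_of_eq ?_)
    ring
  have hsum0 : 0 ≤ ∑ k ∈ Finset.range n, (f k : ℝ) := Finset.sum_nonneg fun k _ => by positivity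
  have h1 : (1 : ℝ) ≤ P ^ 4 * Q := one_le_mul_of_one_le_of_one_le (one_le_pow₀ hP1) hQ
  push_cast
  calc 2 * (starts * ∑ k ∈ Finset.range n, (f k : ℝ)) + starts
      = starts * (2 * (∑ k ∈ Finset.range n, (f k : ℝ)) + 1) := by ring
    _ ≤ ((c.a + 1) * P) * (2 * (CN * W * P ^ 4 * Q) + P ^ 4 * Q) := by
        refine mul_le_mul hs (by linarith) (by positivity) (by positivity)
    _ = _ := by
        rw [searchConst, ← hW]
        ring

/-- The size test bounds 1/t² for the passing round by Δ m^(1+μ) ln m / τ times the number of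
classified vertices. A successful search is thus paid for by the vertices that it removes. A failing
one pays the worst case m^(2+μ). -/
theorem parallel_find_cost {c : Consts} {μ CN ε : ℝ} {G : MultiGraph V} {m Δ : ℕ} (hμ : 0 < μ)
    (hc : c.Tuned μ CN) (hm : 2 ≤ m) (hΔ : 0 < Δ) (hε0 : 0 ≤ ε) (hε1 : ε < 1)
    (hV : Fintype.card V ≤ m) (hvol : G.vol ≤ m) {starts : List V}
    (hlen : starts.length = ⌈c.a * Real.log m⌉₊) {y : Option (Finset V × Finset V) × ℕ}
    (hy : y ∈ (parallel (starts.map fun i => find c μ m Δ G ε 1 i)).law.support) :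
    (y.1 = none → (y.2 : ℝ) ≤ searchConst c μ CN * (1 + Real.log m) ^ 5 *
      (m * (Δ * (m : ℝ) ^ (1 + μ)))) ∧
    ∀ T, y.1 = some T → (y.2 : ℝ) ≤ searchConst c μ CN * (1 + Real.log m) ^ 5 *
      ((T.1 ∪ T.2).card * (Δ * (m : ℝ) ^ (1 + μ))) := by
  obtain ⟨h1, h2⟩ := parallel_find_support G c μ m Δ ε 1 starts hy
  have hm1 : (1 : ℝ) ≤ m := by exact_mod_cast (by omega : 1 ≤ m)
  have hm0 : (0 : ℝ) < m := by linarith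
  have hlm := log_nonneg_of_two_le hm
  have hτ := c.τ_pos
  have hγ := c.γ_mem
  have hΔ1 : (1 : ℝ) ≤ Δ := by exact_mod_cast hΔ
  have hmD : (m : ℝ) ≤ Δ * (m : ℝ) ^ (1 + μ) := by
    have : (m : ℝ) ≤ (m : ℝ) ^ (1 + μ) := by
      conv_lhs => rw [← Real.rpow_one (m : ℝ)]
      exact Real.rpow_le_rpow_of_exponent_le hm1 (by linarith)
    nlinarith
  constructor
  · intro hnone
    refine (Nat.cast_le.mpr (h1 hnone)).trans (search_cost_le
      (X := (m : ℝ) ^ (2 + μ) / c.γ ^ 2) hμ hc hm le_rfl hlen ?_ ?_ ?_ ?_)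
    · nlinarith
    · nlinarith
    · have hpow : (m : ℝ) ^ (2 + μ) = m * (m : ℝ) ^ (1 + μ) := by
        rw [show 2 + μ = 1 + (1 + μ) by ring, Real.rpow_add hm0, Real.rpow_one]
      rw [hpow]
      have h3 : m * (m : ℝ) ^ (1 + μ) ≤ m * (Δ * (m : ℝ) ^ (1 + μ)) := by
        refine mul_le_mul_of_nonneg_left ?_ hm0.le
        exact le_mul_of_one_le_left (by positivity) hΔ1
      have h4 : 1 / c.γ ^ 2 ≤ (1 / c.γ ^ 2 + 1 / c.τ) * (1 + Real.log m) := by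
        have : 0 ≤ 1 / c.τ := by positivity
        have : 0 ≤ 1 / c.γ ^ 2 := by positivity
        nlinarith
      rw [div_eq_mul_one_div, mul_comm]
      exact mul_le_mul h4 h3 (by positivity) (by positivity)
    · intro k hk
      refine (roundCost_le hμ hm hε0 hε1 hV hvol (le_refl k)).trans ?_
      have := roundConst_nonneg c hμ
      exact add_le_add (mul_le_mul_of_nonneg_left (one_div_sq_le_of_lt_numRounds hμ hm hk)
        (by positivity)) le_rfl
  · intro T hT
    obtain ⟨-, -, r, hr, hpass, hcost⟩ := h2 T hT
    have hne := hpass.card_pos G hm hΔ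
    have hcard : (1 : ℝ) ≤ (T.1 ∪ T.2).card := by exact_mod_cast hne.card_pos
    have hb0 : 0 < 1 - c.γ := by linarith [hγ.2]
    refine (Nat.cast_le.mpr hcost).trans (search_cost_le
      (X := 1 / ((1 - c.γ) ^ r) ^ 2) hμ hc hm hr hlen ?_ ?_ ?_ ?_)
    · nlinarith
    · nlinarith
    · have h3 := hpass.2
      have hlog : 0 < Real.log m := Real.log_pos (by exact_mod_cast hm)
      rw [div_le_iff₀ (by positivity)] at h3
      have h4 : 1 / ((1 - c.γ) ^ r) ^ 2 ≤
          1 / c.τ * Real.log m * ((T.1 ∪ T.2).card * (Δ * (m : ℝ) ^ (1 + μ))) := by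
        rw [div_le_iff₀ (by positivity), div_mul_eq_mul_div, one_mul, div_mul_eq_mul_div,
          div_mul_eq_mul_div, le_div_iff₀ hτ]
        linarith
      refine h4.trans ?_
      have : 0 ≤ 1 / c.γ ^ 2 := by positivity
      have : 0 ≤ 1 / c.τ := by positivity
      gcongr
      · linarith
      · linarith
    · intro k hk
      exact roundCost_le hμ hm hε0 hε1 hV hvol (Nat.lt_succ_iff.mp hk)

theorem remaining_nonneg {G : MultiGraph V} {S : Finset V × Finset V} :
    0 ≤ remaining G S := by
  unfold remaining
  by_cases hv : G.vol = 0
  · simp [hv]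
  · have hv' : (0 : ℝ) < G.vol := Nat.cast_pos.mpr (Nat.pos_of_ne_zero hv)
    have h1 := inc_induce_eq G (U := Finset.univ) (A := S.1) (B := S.2) (Finset.subset_univ _)
    rw [induce_univ] at h1
    rw [sub_nonneg, div_le_one (by positivity), h1]
    have : (0 : ℝ) ≤ ((G.induce (Finset.univ \ (S.1 ∪ S.2))).vol : ℝ) / 2 := by positivity
    linarith

/-- Amortization with the potential |U| + m: each removed vertex pays once, and the constant part
`G₀.vol` pays for the last call, which is a random assignment or a failing search. -/
theorem simpleRec_cost {c : Consts} {μ CN : ℝ} {G₀ : MultiGraph V} (hμ : 0 < μ)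
    (hc : c.Tuned μ CN) (hm : 2 ≤ G₀.vol) (hΔ : 0 < G₀.maxDeg) (hV : Fintype.card V ≤ G₀.vol)
    (d : ℕ) (U : Finset V) (ε : ℝ) (hε : 0 ≤ ε) {y : Option (Finset V) × ℕ}
    (hy : y ∈ (simpleRec c μ G₀ 1 d U ε).law.support) :
    (y.2 : ℝ) ≤ (searchConst c μ CN + c.a + 8) * (1 + Real.log G₀.vol) ^ 5 *
      ((U.card + G₀.vol) * (G₀.maxDeg * (G₀.vol : ℝ) ^ (1 + μ))) := by
  have hlm := log_nonneg_of_two_le hm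
  have hK := searchConst_nonneg hμ hc
  have ha := c.a_pos
  set P := 1 + Real.log G₀.vol with hP
  have hP1 : 1 ≤ P := by linarith
  have hP0 : 0 ≤ P := by linarith
  have hm2 : (2 : ℝ) ≤ G₀.vol := by exact_mod_cast hm
  have hm0 : (0 : ℝ) < G₀.vol := by linarith
  have hΔ1 : (1 : ℝ) ≤ G₀.maxDeg := by exact_mod_cast hΔ
  set D := (G₀.maxDeg : ℝ) * (G₀.vol : ℝ) ^ (1 + μ) with hD
  have hmD : (G₀.vol : ℝ) ≤ D := by
    have : (G₀.vol : ℝ) ≤ (G₀.vol : ℝ) ^ (1 + μ) := by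
      conv_lhs => rw [← Real.rpow_one (G₀.vol : ℝ)]
      exact Real.rpow_le_rpow_of_exponent_le (by linarith) (by linarith)
    nlinarith
  have hD0 : 0 < D := by linarith
  have hV' : (Fintype.card V : ℝ) ≤ G₀.vol := by exact_mod_cast hV
  have hP5 : P ≤ P ^ 5 := le_self_pow₀ hP1 (by norm_num)
  have hP51 : 1 ≤ P ^ 5 := one_le_pow₀ hP1
  have hlenP : ∀ l : ℕ, l = ⌈c.a * Real.log G₀.vol⌉₊ → (l : ℝ) ≤ (c.a + 1) * P ^ 5 := by
    rintro l rfl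
    refine (Nat.ceil_lt_add_one (by positivity)).le.trans ?_
    nlinarith
  induction d generalizing U ε y with
  | zero =>
    rw [simpleRec, mem_support_pure] at hy
    subst hy
    simp only [Nat.cast_zero]
    positivity
  | succ d ih =>
    rcases simpleRec_succ_support c μ G₀ 1 d U ε hy with
      ⟨L, -, rfl⟩ | ⟨hs, starts, z, hlen, hz, h⟩
    · have hU : (U.card : ℝ) ≤ G₀.vol :=
        (Nat.cast_le.mpr (Finset.card_le_univ U)).trans hV'
      push_cast
      have h1 : (4 : ℝ) * G₀.vol ≤ 8 * P ^ 5 * (U.card * D + G₀.vol * D) := by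
        have h2 : (0 : ℝ) ≤ U.card * D := by positivity
        have h3 : (G₀.vol : ℝ) ≤ G₀.vol * D := by nlinarith
        nlinarith
      have h2 : 0 ≤ (searchConst c μ CN + c.a) * P ^ 5 * ((U.card + G₀.vol) * D) := by positivity
      nlinarith
    · have hε1 : ε < 1 := by linarith [(eps_lt_of_soto_ne hμ c.θ_mem.1 hε hs).1]
      obtain ⟨hnone, hsome⟩ := parallel_find_cost hμ hc hm hΔ hε hε1 hV (vol_induce_le G₀ U) hlen hz
      have hl := hlenP _ hlen
      rcases h with ⟨hz1, rfl⟩ | ⟨S, hS, b, x, hx, rfl⟩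
      · have h1 := hnone hz1
        push_cast
        rw [← hP, ← hD] at h1
        have h3 : (G₀.vol : ℝ) ≤ G₀.vol * D := by nlinarith
        have h4 : (1 : ℝ) ≤ G₀.vol * D := by nlinarith
        have h5 : P ^ 5 ≤ P ^ 5 * (G₀.vol * D) := le_mul_of_one_le_right (by positivity) h4
        have h6 : (G₀.vol : ℝ) ≤ P ^ 5 * (G₀.vol * D) :=
          h3.trans (le_mul_of_one_le_left (by positivity) hP51)
        have h7 : 0 ≤ (searchConst c μ CN + c.a + 8) * P ^ 5 * (U.card * D) := by positivity
        have h8 := mul_le_mul_of_nonneg_left h5 ha.le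
        linarith
      · have h1 := hsome S hS
        have hIH := ih (U \ (S.1 ∪ S.2)) _ (div_nonneg hε remaining_nonneg) hx
        obtain ⟨-, hdeg, r, -, hpass, -⟩ :=
          (parallel_find_support (G₀.induce U) c μ _ _ ε 1 starts hz).2 S hS
        have hsub : S.1 ∪ S.2 ⊆ U := subset_of_deg_pos hdeg
        have hne := hpass.card_pos (G₀.induce U) hm hΔ
        have hcard : (1 : ℝ) ≤ (S.1 ∪ S.2).card := by exact_mod_cast hne.card_pos
        have hUc : ((U \ (S.1 ∪ S.2)).card : ℝ) = U.card - (S.1 ∪ S.2).card := by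
          rw [Finset.card_sdiff_of_subset hsub, Nat.cast_sub (Finset.card_le_card hsub)]
        rw [hUc] at hIH
        set s : ℝ := ((S.1 ∪ S.2).card : ℝ)
        rw [← hP, ← hD] at h1
        push_cast
        have h3 : (G₀.vol : ℝ) ≤ s * D := by nlinarith
        have h4 : (1 : ℝ) ≤ s * D := by nlinarith
        have h5 : P ^ 5 ≤ P ^ 5 * (s * D) := le_mul_of_one_le_right (by positivity) h4
        have h6 : (G₀.vol : ℝ) ≤ P ^ 5 * (s * D) :=
          h3.trans (le_mul_of_one_le_left (by positivity) hP51)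
        have h8 := mul_le_mul_of_nonneg_left h5 ha.le
        linarith

theorem simple_cost {c : Consts} {μ CN : ℝ} {G : MultiGraph V} (hμ : 0 < μ)
    (hc : c.Tuned μ CN) (hm : 2 ≤ G.vol) (hΔ : 0 < G.maxDeg) (hV : Fintype.card V ≤ G.vol)
    {ε : ℝ} (hε : 0 ≤ ε) {y : Finset V × ℕ} (hy : y ∈ (simple c μ G ε 1).law.support) :
    (y.2 : ℝ) ≤ (2 * (searchConst c μ CN + c.a + 8) + 2) * (1 + Real.log G.vol) ^ 5 *
      (G.maxDeg * (G.vol : ℝ) ^ (2 + μ)) := by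
  unfold simple at hy
  rw [mem_support_bind] at hy
  obtain ⟨p, hp, y, hy, rfl⟩ := hy
  have h1 := simpleRec_cost hμ hc hm hΔ hV _ _ ε hε hp
  have hy2 : y.2 ≤ Fintype.card V + 1 := by
    rcases hp1 : p.1 with _ | L
    · rw [hp1] at hy
      have := (randomSide_support _ hy).2
      rw [this, Finset.card_univ]
    · rw [hp1] at hy
      simp only at hy
      rw [mem_support_pure] at hy
      simp [hy]
  have hm0 : (0 : ℝ) < G.vol := by positivity
  have hm1 : (1 : ℝ) ≤ G.vol := by exact_mod_cast (by omega : 1 ≤ G.vol)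
  have hΔ1 : (1 : ℝ) ≤ G.maxDeg := by exact_mod_cast hΔ
  have hlm := log_nonneg_of_two_le hm
  have hK := searchConst_nonneg hμ hc
  have ha := c.a_pos
  have hpow : (G.vol : ℝ) ^ (2 + μ) = G.vol * (G.vol : ℝ) ^ (1 + μ) := by
    rw [show 2 + μ = 1 + (1 + μ) by ring, Real.rpow_add hm0, Real.rpow_one]
  have hV' : (Fintype.card V : ℝ) ≤ G.vol := by exact_mod_cast hV
  have hy3 : (y.2 : ℝ) ≤ Fintype.card V + 1 := by exact_mod_cast hy2
  have h2 : (1 : ℝ) ≤ (1 + Real.log G.vol) ^ 5 := one_le_pow₀ (by linarith)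
  set B := (G.maxDeg : ℝ) * (G.vol : ℝ) ^ (1 + μ) with hB
  have hB1 : 1 ≤ B := one_le_mul_of_one_le_of_one_le hΔ1 (Real.one_le_rpow hm1 (by linarith))
  have h3 : (G.maxDeg : ℝ) * (G.vol : ℝ) ^ (2 + μ) = G.vol * B := by rw [hpow, hB]; ring
  have h4 : (G.vol : ℝ) ≤ (1 + Real.log G.vol) ^ 5 * (G.vol * B) := by
    have : (G.vol : ℝ) ≤ G.vol * B := le_mul_of_one_le_right hm0.le hB1
    exact this.trans (le_mul_of_one_le_left (by positivity) h2)
  rw [h3]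
  push_cast
  have h5 : (searchConst c μ CN + c.a + 8) * (1 + Real.log G.vol) ^ 5 *
      (((Finset.univ : Finset V).card + G.vol) * B) ≤
      (searchConst c μ CN + c.a + 8) * (1 + Real.log G.vol) ^ 5 * ((G.vol + G.vol) * B) := by
    rw [Finset.card_univ]
    gcongr
  linarith

theorem bestCut_cost (G : MultiGraph V) {K : ℝ} (xs : List (Comp (Finset V)))
    (hxs : ∀ x ∈ xs, ∀ y ∈ x.law.support, (y.2 : ℝ) ≤ K) (best : Finset V) {y : Finset V × ℕ}
    (hy : y ∈ (bestCut G xs best).law.support) :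
    (y.2 : ℝ) ≤ xs.length * (K + (Fintype.card V + G.vol + 1)) := by
  induction xs generalizing best y with
  | nil =>
    rw [bestCut, mem_support_pure] at hy
    simp [hy]
  | cons x xs ih =>
    rw [bestCut, mem_support_bind] at hy
    obtain ⟨p, hp, y, hy, rfl⟩ := hy
    rw [mem_support_bind] at hy
    obtain ⟨p', hp', y, hy, rfl⟩ := hy
    rw [mem_support_tick] at hp'
    subst hp'
    have h1 := hxs x List.mem_cons_self p hp
    have h2 := ih (fun x hx => hxs x (List.mem_cons_of_mem _ hx)) _ hy
    rw [List.length_cons]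
    push_cast
    linarith

theorem simple'_cost {c : Consts} {μ CN : ℝ} {G : MultiGraph V} (hμ : 0 < μ)
    (hc : c.Tuned μ CN) (hm : 2 ≤ G.vol) (hΔ : 0 < G.maxDeg) (hV : Fintype.card V ≤ G.vol)
    {y : Finset V × ℕ} (hy : y ∈ (simple' c μ G).law.support) :
    (y.2 : ℝ) ≤ gridSize c * (c.b + 1) * (2 * (searchConst c μ CN + c.a + 8) + 5) *
      (G.maxDeg * (G.vol : ℝ) ^ (2 + μ)) * (1 + Real.log G.vol) ^ 6 := by
  obtain ⟨hγ0, hγ1⟩ := c.γ_mem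
  have hlm := log_nonneg_of_two_le hm
  have hK := searchConst_nonneg hμ hc
  have ha := c.a_pos
  have hb := c.b_pos
  unfold simple' at hy
  have h1 := bestCut_cost G _ (fun x hx y hy => by
    rw [List.mem_flatMap] at hx
    obtain ⟨r, -, hx⟩ := hx
    rw [List.eq_of_mem_replicate hx] at hy
    exact simple_cost hμ hc hm hΔ hV (sub_nonneg.mpr (pow_le_one₀ (by linarith) (by linarith))) hy)
    _ hy
  rw [List.length_flatMap] at h1
  simp only [List.length_replicate, List.map_const', List.length_range, List.sum_replicate,
    smul_eq_mul, Nat.cast_mul] at h1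
  refine h1.trans ?_
  set P := 1 + Real.log G.vol with hP
  have hP1 : 1 ≤ P := by linarith
  have hm2 : (2 : ℝ) ≤ G.vol := by exact_mod_cast hm
  have hm0 : (0 : ℝ) < G.vol := by linarith
  have hΔ1 : (1 : ℝ) ≤ G.maxDeg := by exact_mod_cast hΔ
  have hlen : (⌈c.b * Real.log G.vol⌉₊ : ℝ) ≤ (c.b + 1) * P := by
    refine (Nat.ceil_lt_add_one (by positivity)).le.trans ?_
    nlinarith
  have hV' : (Fintype.card V : ℝ) ≤ G.vol := by exact_mod_cast hV
  set B := (G.maxDeg : ℝ) * (G.vol : ℝ) ^ (2 + μ) with hB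
  have hmB : (G.vol : ℝ) ≤ B := by
    have : (G.vol : ℝ) ≤ (G.vol : ℝ) ^ (2 + μ) := by
      conv_lhs => rw [← Real.rpow_one (G.vol : ℝ)]
      exact Real.rpow_le_rpow_of_exponent_le (by linarith) (by linarith)
    nlinarith
  have h3 : (G.vol : ℝ) ≤ P ^ 5 * B :=
    hmB.trans (le_mul_of_one_le_left (by linarith) (one_le_pow₀ hP1))
  calc _ ≤ gridSize c * ((c.b + 1) * P) *
        ((2 * (searchConst c μ CN + c.a + 8) + 5) * P ^ 5 * B) := by
        refine mul_le_mul (mul_le_mul_of_nonneg_left hlen (Nat.cast_nonneg _)) ?_ ?_ ?_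
        · linarith
        · have : 0 ≤ B := by linarith
          positivity
        · positivity
    _ = _ := by ring

end

section


open MultiGraph MaxCut.Comp

/-! ## The choice of the constants -/

theorem exists_pow_ceil_le {q : ℝ} (hq0 : 0 < q) (hq1 : q < 1) (K : ℝ) :
    ∃ a : ℝ, 0 < a ∧ ∀ m : ℕ, 2 ≤ m → q ^ ⌈a * Real.log m⌉₊ ≤ (m : ℝ) ^ (-K) := by
  have hl : Real.log q < 0 := Real.log_neg hq0 hq1
  -- The maximum with 1 only ensures that the constant is positive.
  refine ⟨max K 1 / -Real.log q, div_pos (lt_max_of_lt_right one_pos) (neg_pos.mpr hl),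
    fun m hm => ?_⟩
  have hm0 : (0 : ℝ) < m := by positivity
  have hm1 : (1 : ℝ) ≤ m := by exact_mod_cast (by omega : 1 ≤ m)
  calc q ^ ⌈max K 1 / -Real.log q * Real.log m⌉₊
      = q ^ ((⌈max K 1 / -Real.log q * Real.log m⌉₊ : ℕ) : ℝ) := (Real.rpow_natCast _ _).symm
    _ ≤ q ^ (max K 1 / -Real.log q * Real.log m) :=
        Real.rpow_le_rpow_of_exponent_ge hq0 hq1.le (Nat.le_ceil _)
    _ = (m : ℝ) ^ (-max K 1) := by
        rw [Real.rpow_def_of_pos hq0, Real.rpow_def_of_pos hm0]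
        congr 1
        have := hl.ne
        field_simp
    _ ≤ (m : ℝ) ^ (-K) :=
        Real.rpow_le_rpow_of_exponent_le hm1 (neg_le_neg (le_max_left _ _))

theorem exists_succ_mul_pow_ceil_le {q φ : ℝ} (hq0 : 0 < q) (hq1 : q < 1) (hφ : 0 < φ) :
    ∃ a : ℝ, 0 < a ∧ ∀ m : ℕ, 2 ≤ m → (m + 1) * q ^ ⌈a * Real.log m⌉₊ ≤ φ := by
  obtain ⟨n, hn⟩ := exists_pow_lt_of_lt_one hφ (by norm_num : (1 / 2 : ℝ) < 1)
  -- Two powers of m absorb m + 1 ≤ m², and the remaining n give m^(-n) ≤ 2^(-n) < φ.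
  obtain ⟨a, ha, h⟩ := exists_pow_ceil_le hq0 hq1 ((n + 2 : ℕ) : ℝ)
  refine ⟨a, ha, fun m hm => ?_⟩
  have hm2 : (2 : ℝ) ≤ m := by exact_mod_cast hm
  have h1 := h m hm
  rw [Real.rpow_neg (by positivity), Real.rpow_natCast] at h1
  have h2 : ((m : ℝ)⁻¹) ^ n ≤ (1 / 2) ^ n := by
    refine pow_le_pow_left₀ (by positivity) ?_ n
    rw [one_div]
    exact inv_anti₀ two_pos hm2
  calc (m + 1) * q ^ ⌈a * Real.log m⌉₊ ≤ (m : ℝ) ^ 2 * ((m : ℝ) ^ (n + 2))⁻¹ :=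
        mul_le_mul (by nlinarith) h1 (by positivity) (by positivity)
    _ = ((m : ℝ)⁻¹) ^ n := by
        rw [pow_add, inv_pow]
        field_simp
    _ ≤ φ := h2.trans hn.le

/-- `CN` depends on γ alone, uniformly in the other constants, because τ and κ are chosen afterwards
in terms of `CN`. -/
theorem exists_numRounds_le {γ μ : ℝ} (hγ0 : 0 < γ) (hγ1 : γ < 1) (hμ : 0 < μ) :
    ∃ CN : ℝ, 0 ≤ CN ∧ ∀ c : Consts, c.γ = γ → ∀ m : ℕ, 2 ≤ m →
      (numRounds c μ m : ℝ) ≤ CN * Real.log m := by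
  have hl : 0 < -Real.log (1 - γ) := neg_pos.mpr (Real.log_neg (by linarith) (by linarith))
  have hl2 : 0 < Real.log 2 := Real.log_pos (by norm_num)
  have hlγ : 0 < -Real.log γ := neg_pos.mpr (Real.log_neg hγ0 hγ1)
  refine ⟨(-Real.log γ / Real.log 2 + (1 + μ / 2)) / -Real.log (1 - γ) + 1 / Real.log 2,
    by positivity, ?_⟩
  rintro c rfl m hm
  have hm2 : (2 : ℝ) ≤ m := by exact_mod_cast hm
  have hm0 : (0 : ℝ) < m := by linarith
  have hlm : Real.log 2 ≤ Real.log m := Real.log_le_log two_pos hm2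
  have h1 : Real.log (c.γ / (m : ℝ) ^ (1 + μ / 2)) / Real.log (1 - c.γ) =
      (-Real.log c.γ + (1 + μ / 2) * Real.log m) / -Real.log (1 - c.γ) := by
    rw [Real.log_div hγ0.ne' (Real.rpow_pos_of_pos hm0 _).ne', Real.log_rpow hm0, div_neg,
      ← neg_div]
    congr 1
    ring
  have h2 : 1 ≤ 1 / Real.log 2 * Real.log m := by
    rw [one_div_mul_eq_div, one_le_div hl2]
    exact hlm
  unfold numRounds
  push_cast
  rw [h1]
  have h3 : -Real.log c.γ ≤ -Real.log c.γ / Real.log 2 * Real.log m := by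
    rw [div_mul_eq_mul_div, le_div_iff₀ hl2]
    exact mul_le_mul_of_nonneg_left hlm hlγ.le
  have h4 : 0 ≤ (-Real.log c.γ + (1 + μ / 2) * Real.log m) / -Real.log (1 - c.γ) := by
    have : 0 < Real.log m := by linarith
    positivity
  have h5 := Nat.floor_le h4
  have h6 : (-Real.log c.γ + (1 + μ / 2) * Real.log m) / -Real.log (1 - c.γ) ≤
      (-Real.log c.γ / Real.log 2 + (1 + μ / 2)) / -Real.log (1 - c.γ) * Real.log m := by
    rw [div_mul_eq_mul_div]
    refine div_le_div_of_nonneg_right ?_ hl.le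
    linarith
  linarith

/-- There is no circularity: δ depends on θ, γ on δ and θ, `CN` on γ, then κ and τ on all of these;
a depends on δ and φ, and b on ϱ and p. -/
theorem exists_tuned {μ θ r φ ϱ p : ℝ} (hμ : 0 < μ) (hθ0 : 0 < θ) (hθ1 : θ < 1) (hr : 0 < r)
    (hφ : 0 < φ) (hϱ0 : 0 < ϱ) (hϱ1 : ϱ < 1) :
    ∃ (c : Consts) (CN : ℝ), c.Tuned μ CN ∧ c.θ = θ ∧ c.γ ≤ r ∧ c.γ ≤ 1 / 4 ∧
      (∀ m : ℕ, 2 ≤ m → (m + 1) * (1 - c.δ ^ 2 / 8) ^ ⌈c.a * Real.log m⌉₊ ≤ φ) ∧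
      ∀ m : ℕ, 2 ≤ m → ϱ ^ ⌈c.b * Real.log m⌉₊ ≤ (m : ℝ) ^ (-p) := by
  obtain ⟨δ, hδ0, hδ3, hδ⟩ : ∃ δ : ℝ, 0 < δ ∧ δ ≤ 1 / 3 ∧
      1 - θ / 4 ≤ Real.exp (-(δ * (1 + 1 / μ))) := by
    have hp : 0 < 1 + 1 / μ := by positivity
    refine ⟨min (1 / 3) (θ / 4 / (1 + 1 / μ)), lt_min (by norm_num) (by positivity),
      min_le_left _ _, ?_⟩
    have h1 : min (1 / 3) (θ / 4 / (1 + 1 / μ)) * (1 + 1 / μ) ≤ θ / 4 := by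
      rw [← le_div_iff₀ hp]
      exact min_le_right _ _
    have h2 := Real.add_one_le_exp (-(min (1 / 3) (θ / 4 / (1 + 1 / μ)) * (1 + 1 / μ)))
    linarith
  have hN := normConst_pos hδ0 μ
  obtain ⟨γ, hγ0, hγr, hγ4, hγ⟩ : ∃ γ : ℝ, 0 < γ ∧ γ ≤ r ∧ γ ≤ 1 / 4 ∧
      4 * γ ^ 2 + 16 * γ ^ 2 / normConst δ μ ≤ (θ / 24) ^ 2 := by
    set s := 4 + 16 / normConst δ μ with hs
    have hs1 : 1 ≤ s := by
      have : 0 < 16 / normConst δ μ := by positivity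
      linarith
    refine ⟨min (min r (1 / 4)) (θ / 24 / s), by positivity,
      (min_le_left _ _).trans (min_le_left _ _), (min_le_left _ _).trans (min_le_right _ _), ?_⟩
    set γ := min (min r (1 / 4)) (θ / 24 / s)
    have hγ0 : 0 ≤ γ := by positivity
    have h1 : γ * s ≤ θ / 24 := by
      rw [← le_div_iff₀ (by linarith)]
      exact min_le_right _ _
    calc 4 * γ ^ 2 + 16 * γ ^ 2 / normConst δ μ = γ ^ 2 * s := by rw [hs]; ring
      _ ≤ (γ * s) ^ 2 := by
          rw [mul_pow]
          exact mul_le_mul_of_nonneg_left (by nlinarith) (sq_nonneg _)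
      _ ≤ (θ / 24) ^ 2 := pow_le_pow_left₀ (by positivity) h1 2
  obtain ⟨CN, hCN, hrounds⟩ := exists_numRounds_le hγ0 (by linarith : γ < 1) hμ
  obtain ⟨a, ha, haφ⟩ := exists_succ_mul_pow_ceil_le (q := 1 - δ ^ 2 / 8) (by nlinarith)
    (by nlinarith [pow_pos hδ0 2]) hφ
  obtain ⟨b, hb, hbp⟩ := exists_pow_ceil_le hϱ0 hϱ1 p
  refine ⟨{
    δ := δ
    γ := γ
    θ := θ
    κ := 2 * (CN + 1) / γ ^ 2
    τ := θ / 16 * normConst δ μ / (CN + 1)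
    a := a
    b := b
    δ_mem := ⟨hδ0, by linarith⟩
    γ_mem := ⟨hγ0, by linarith⟩
    θ_mem := ⟨hθ0, hθ1⟩
    κ_pos := by positivity
    τ_pos := by positivity
    a_pos := ha
    b_pos := hb }, CN, ⟨hδ3, by simpa using by linarith, hδ, hγ, ?_, ?_, ?_⟩, rfl, hγr, hγ4,
      haφ, hbp⟩
  · exact hrounds _ rfl
  · simp only
    rw [mul_div_assoc', div_lt_iff₀ (by linarith)]
    have : 0 < θ / 16 * normConst δ μ := by positivity
    nlinarith
  · simp only
    rw [mul_div_cancel₀ _ (by positivity), div_le_iff₀ (by positivity)]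
    linarith

/-- The first grid point at or above ε exceeds it by at most γ. If there is none, the last point is
used: its complement is at most (1/2)/(1 - γ) ≤ 2/3, so both it and ε are at least 1/3, where only a
random cut is required. -/
theorem exists_grid {c : Consts} (hγ : c.γ ≤ 1 / 4) {ε : ℝ} (hε : ε ∈ Set.Icc (0 : ℝ) (1 / 2)) :
    ∃ r < gridSize c, (ε ≤ 1 - (1 - c.γ) ^ r ∧ 1 - (1 - c.γ) ^ r ≤ ε + c.γ) ∨
      (1 / 3 ≤ 1 - (1 - c.γ) ^ r ∧ 1 - (1 - c.γ) ^ r ≤ ε) := by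
  obtain ⟨hγ0, hγ1⟩ := c.γ_mem
  have hb0 : 0 < 1 - c.γ := by linarith
  have hl : Real.log (1 - c.γ) < 0 := Real.log_neg hb0 (by linarith)
  have hlast : (1 - c.γ) ^ gridSize c ≤ 1 / 2 := by
    rw [← Real.log_le_log_iff (pow_pos hb0 _) (by norm_num), Real.log_pow, gridSize,
      ← div_le_iff_of_neg hl]
    push_cast
    exact (Nat.lt_floor_add_one _).le
  by_cases h : (1 - c.γ) ^ (gridSize c - 1) ≤ 1 - ε
  · have hex : ∃ r, (1 - c.γ) ^ r ≤ 1 - ε := ⟨_, h⟩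
    classical
    have hfind := Nat.find_spec hex
    have hle := Nat.find_min' hex h
    refine ⟨Nat.find hex, ?_, Or.inl ⟨by linarith, ?_⟩⟩
    · have : 0 < gridSize c := Nat.succ_pos _
      omega
    · rcases hk : Nat.find hex with _ | k
      · rw [pow_zero]
        linarith [hε.1]
      · have hmin := Nat.find_min hex (m := k) (by omega)
        rw [pow_succ]
        nlinarith [hε.1, not_le.mp hmin]
  · refine ⟨gridSize c - 1, Nat.sub_lt (Nat.succ_pos _) one_pos, Or.inr ⟨?_, by linarith⟩⟩
    have h1 : (1 - c.γ) ^ gridSize c = (1 - c.γ) ^ (gridSize c - 1) * (1 - c.γ) :=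
      pow_succ _ _
    have h2 : 0 < (1 - c.γ) ^ (gridSize c - 1) := pow_pos hb0 _
    nlinarith

/-! ## The probability of success -/

variable {V : Type} [Fintype V] [DecidableEq V]

/-- The best cut lies below `v` only if the initial cut and all independent runs do. -/
theorem ev_bestCut_lt (G : MultiGraph V) (v : ℝ) (xs : List (Comp (Finset V))) (best : Finset V) :
    ev (bestCut G xs best) ({L | G.cutValue L < v}.indicator fun _ => 1) ≤
      ({L | G.cutValue L < v}.indicator fun _ => 1) best *
        (xs.map fun x => ev x ({L | G.cutValue L < v}.indicator fun _ => 1)).prod := by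
  induction xs generalizing best with
  | nil => simp [bestCut, ev_pure]
  | cons x xs ih =>
    rw [bestCut, ev_bind, List.map_cons, List.prod_cons, ← mul_assoc, ← ev_mul_left,
      ← ev_mul_right]
    refine ev_mono' fun L => ?_
    rw [ev_bind, ev_tick]
    refine (ih _).trans (mul_le_mul' ?_ le_rfl)
    by_cases h1 : G.cutValue best < v <;> by_cases h2 : G.cutValue L < v
    · simp only [Set.indicator, Set.mem_ofPred_eq, h1, h2, if_true, mul_one]
      split_ifs <;> simp
    · have : G.cutValue best < G.cutValue L := by linarith
      simp [Set.indicator, h2, this]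
    · have : ¬ G.cutValue best < G.cutValue L := by linarith
      simp [Set.indicator, h1, this]
    · simp only [Set.indicator, Set.mem_ofPred_eq, h1, h2, if_false, mul_zero]
      split_ifs <;> simp_all

theorem prod_map_le_of_mem {ι : Type} {f : ι → ℝ≥0∞} (hf : ∀ i, f i ≤ 1) {l : List ι} {i : ι}
    (hi : i ∈ l) : (l.map f).prod ≤ f i := by
  have hle : ∀ l : List ι, (l.map f).prod ≤ 1 := fun l => by
    induction l with
    | nil => simp
    | cons j l ih => simpa using mul_le_one' (hf j) ih
  induction l with
  | nil => simp at hi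
  | cons j l ih =>
    rw [List.map_cons, List.prod_cons]
    rcases List.mem_cons.mp hi with rfl | hi
    · exact mul_le_of_le_one_right' (hle l)
    · exact (mul_le_of_le_one_left' (hf j)).trans (ih hi)

theorem prod_map_flatMap_replicate {ι α : Type} (f : α → ℝ≥0∞) (x : ι → α) (k : ℕ) (l : List ι) :
    ((l.flatMap fun i => List.replicate k (x i)).map f).prod =
      (l.map fun i => f (x i) ^ k).prod := by
  induction l with
  | nil => simp
  | cons i l ih => simp [ih]

/-- Only the repetitions at one grid point are used; the other runs cannot hurt. -/
theorem ev_simple'_lt (c : Consts) (μ : ℝ) (G : MultiGraph V) (v : ℝ) {r : ℕ}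
    (hr : r < gridSize c) :
    ev (simple' c μ G) ({L | G.cutValue L < v}.indicator fun _ => 1) ≤
      ev (simple c μ G (1 - (1 - c.γ) ^ r) 1) ({L | G.cutValue L < v}.indicator fun _ => 1) ^
        ⌈c.b * Real.log G.vol⌉₊ := by
  have h1 : ∀ x : Comp (Finset V), ev x ({L | G.cutValue L < v}.indicator fun _ => 1) ≤ 1 :=
    fun x => ev_le_of_forall fun y _ => Set.indicator_le_self' (fun _ _ => zero_le_one) y.1
  refine (ev_bestCut_lt G v _ _).trans ?_
  refine (mul_le_of_le_one_left' (Set.indicator_le_self' (fun _ _ => zero_le_one) _)).trans ?_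
  rw [prod_map_flatMap_replicate]
  exact prod_map_le_of_mem (f := fun r => ev (simple c μ G (1 - (1 - c.γ) ^ r) 1)
    ({L | G.cutValue L < v}.indicator fun _ => 1) ^ ⌈c.b * Real.log G.vol⌉₊)
    (fun i => pow_le_one' (h1 _) _) (List.mem_range.mpr hr)

/-- Markov's inequality for the fraction of uncut edges. -/
theorem ev_cutValue_lt_le (G : MultiGraph V) (hv : G.vol ≠ 0) (x : Comp (Finset V)) {v β : ℝ}
    (hv1 : v < 1) (hx : ev x (fun L => ENNReal.ofReal (G.uncut L)) ≤
      ENNReal.ofReal (β * (G.vol / 2))) :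
    ev x ({L | G.cutValue L < v}.indicator fun _ => 1) ≤ ENNReal.ofReal (β / (1 - v)) := by
  have hm0 : (0 : ℝ) < G.vol := Nat.cast_pos.mpr (Nat.pos_of_ne_zero hv)
  have hpos : 0 < (1 - v) * ((G.vol : ℝ) / 2) := mul_pos (by linarith) (by positivity)
  have h := (ev_indicator_mul_le x (fun L => ENNReal.ofReal (G.uncut L))
    (ENNReal.ofReal ((1 - v) * (G.vol / 2))) {L | G.cutValue L < v} fun L hL => by
      refine ENNReal.ofReal_le_ofReal ?_
      rw [Set.mem_ofPred_eq, cutValue_eq G hv] at hL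
      rw [← le_div_iff₀ (by positivity)]
      linarith).trans hx
  rw [mul_comm, ← ENNReal.le_div_iff_mul_le (Or.inl (by simpa using hpos))
    (Or.inl ENNReal.ofReal_ne_top), ← ENNReal.ofReal_div_of_pos hpos] at h
  rwa [mul_div_mul_right _ _ (by positivity)] at h

theorem two_le_vol [Nonempty V] {G : MultiGraph V} (hdeg : ∀ v, 0 < G.deg v) :
    2 ≤ G.vol ∧ Fintype.card V ≤ G.vol ∧ 0 < G.maxDeg := by
  obtain ⟨v⟩ := ‹Nonempty V›
  have hcard : Fintype.card V ≤ G.vol := by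
    have := Finset.card_nsmul_le_sum Finset.univ G.deg 1 fun v _ => hdeg v
    rwa [smul_eq_mul, mul_one, Finset.card_univ] at this
  obtain ⟨k, -, hk⟩ : ∃ k ∈ Finset.univ, 0 < G.mult v k := by
    by_contra! h
    exact (hdeg v).ne' (Finset.sum_eq_zero fun k hk => Nat.le_zero.mp (h k hk))
  have hne : v ≠ k := by
    rintro rfl
    rw [G.loopless] at hk
    exact lt_irrefl _ hk
  have h2 : 1 < Fintype.card V := Fintype.one_lt_card_iff.mpr ⟨v, k, hne⟩
  exact ⟨by omega, hcard, (hdeg v).trans_le (deg_le_maxDeg G v)⟩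

/-- At a suitable grid point the expected uncut fraction is at most 1 - H + η/4. By Markov's
inequality one run falls below H - η/2 with probability at most a constant less than 1, and O(log m)
repetitions make this polynomially small. -/
theorem prob_simple'_ge {c : Consts} {μ CN η p r₀ : ℝ} (hμ : 0 < μ) (hη : 0 < η)
    (hc : c.Tuned μ CN) (hγr : c.γ ≤ r₀) (hγ : c.γ ≤ 1 / 4)
    (happrox : ∀ ε ∈ Set.Icc (0 : ℝ) 1, ∀ ε' ∈ Set.Icc (0 : ℝ) 1,
      |ε' - ε| ≤ r₀ → perf 0 μ ε 1 - η / 8 ≤ perf c.θ μ ε' 1)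
    (hφ : ∀ m : ℕ, 2 ≤ m → (m + 1) * (1 - c.δ ^ 2 / 8) ^ ⌈c.a * Real.log m⌉₊ ≤ η / 8)
    (hϱ : ∀ m : ℕ, 2 ≤ m →
      ((1 / 2 + η / 4) / (1 / 2 + η / 2)) ^ ⌈c.b * Real.log m⌉₊ ≤ (m : ℝ) ^ (-max p 0))
    [Nonempty V] {G : MultiGraph V} (hdeg : ∀ v, 0 < G.deg v) {ε : ℝ} (hε : G.maxcut = 1 - ε) :
    1 - (Fintype.card V : ℝ) ^ (-p) ≤ (simple' c μ G).prob
      {L | H ε μ - η ≤ G.cutValue L ∧ (ratio μ - η) * G.maxcut ≤ G.cutValue L} := by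
  obtain ⟨hm, hV, hΔ⟩ := two_le_vol hdeg
  have hv : G.vol ≠ 0 := by omega
  obtain ⟨hε0, X, hX⟩ := exists_uncut_eq G hv hε
  have hε2 : ε ≤ 1 / 2 := by linarith [half_le_maxcut G hv]
  have hm0 : (0 : ℝ) < G.vol := by positivity
  have hθ := c.θ_mem
  have hH := H_eq_perf hμ hε0
  have hH1 : H ε μ ≤ 1 := by
    have h1 := perf_sub_le (θ := 0) (x := 0) (y := 1) hμ zero_le_one hε0 le_rfl zero_le_one
    have h2 : sotoAt 0 μ (ε / 1) ≤ 1 := soto_le_one _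
    rw [perf_zero] at h1
    linarith
  have hH2 : 1 / 2 ≤ H ε μ := hH ▸ half_le_perf_one hμ
  obtain ⟨r, hr, hcase⟩ := exists_grid hγ ⟨hε0, hε2⟩
  have hb0 : 0 < 1 - c.γ := by linarith
  set ε' := 1 - (1 - c.γ) ^ r with hε'
  have hε'0 : 0 ≤ ε' := sub_nonneg.mpr (pow_le_one₀ hb0.le (by linarith [c.γ_mem.1]))
  have hε'1 : ε' ≤ 1 := by linarith [pow_pos hb0 r]
  have hperf : H ε μ - η / 8 ≤ perf c.θ μ ε' 1 := by
    rw [hH]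
    rcases hcase with ⟨h1, h2⟩ | ⟨h1, h2⟩
    · exact happrox ε ⟨hε0, by linarith⟩ ε' ⟨hε'0, hε'1⟩ (by rw [abs_le]; constructor <;> linarith)
    · rw [perf_one_of_third_le hμ le_rfl zero_le_one (h1.trans h2),
        perf_one_of_third_le hμ hθ.1.le hθ.2.le h1]
      linarith
  have hsimple := ev_simple (c := c) (G := G) (X := X) hμ hc hm hΔ hε'0 le_rfl fun hs => by
    rw [hX]
    rcases hcase with ⟨h1, -⟩ | ⟨h1, -⟩
    · exact mul_le_mul_of_nonneg_right h1 (by positivity)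
    · exact absurd (sotoAt_eq_half_of_third_le hμ hθ.1.le h1) hs
  have hfrac : 1 - perf c.θ μ ε' 1 + (Fintype.card V + 1) *
      (1 - c.δ ^ 2 / 8) ^ ⌈c.a * Real.log G.vol⌉₊ ≤ 1 - H ε μ + η / 4 := by
    have h1 : ((Fintype.card V : ℝ) + 1) * (1 - c.δ ^ 2 / 8) ^ ⌈c.a * Real.log G.vol⌉₊ ≤ η / 8 := by
      refine le_trans (mul_le_mul_of_nonneg_right ?_ (pow_nonneg ?_ _)) (hφ G.vol hm)
      · have : (Fintype.card V : ℝ) ≤ G.vol := by exact_mod_cast hV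
        linarith
      · nlinarith [c.δ_mem.1, c.δ_mem.2]
    linarith
  have hone := ev_cutValue_lt_le G hv (simple c μ G ε' 1) (v := H ε μ - η / 2) (by linarith)
    (hsimple.trans (ENNReal.ofReal_le_ofReal (mul_le_mul_of_nonneg_right hfrac (by positivity))))
  -- The quotient increases with 1 - H, and H ≥ 1/2, so the bound does not depend on ε.
  have hratio : (1 - H ε μ + η / 4) / (1 - (H ε μ - η / 2)) ≤
      (1 / 2 + η / 4) / (1 / 2 + η / 2) := by
    rw [div_le_div_iff₀ (by linarith) (by linarith)]
    nlinarith
  have hall : ev (simple' c μ G) ({L | G.cutValue L < H ε μ - η / 2}.indicator fun _ => 1) ≤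
      ENNReal.ofReal ((Fintype.card V : ℝ) ^ (-p)) := by
    refine (ev_simple'_lt c μ G _ hr).trans ?_
    refine (pow_le_pow_left' (hone.trans (ENNReal.ofReal_le_ofReal hratio)) _).trans ?_
    rw [← ENNReal.ofReal_pow (by positivity)]
    refine ENNReal.ofReal_le_ofReal ((hϱ G.vol hm).trans ?_)
    have hn1 : (1 : ℝ) ≤ Fintype.card V := by exact_mod_cast Fintype.card_pos (α := V)
    -- Replacing m by n ≤ m requires a nonpositive exponent, hence `max p 0`.
    refine le_trans (Real.rpow_le_rpow_of_nonpos (by linarith) (Nat.cast_le.mpr hV)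
      (by simp)) ?_
    exact Real.rpow_le_rpow_of_exponent_le hn1 (neg_le_neg (le_max_left _ _))
  rw [prob_compl]
  refine sub_le_sub_left (ENNReal.toReal_le_of_le_ofReal (by positivity)
    (le_trans (ev_mono' fun L => Set.indicator_le_indicator_of_subset ?_
      (fun _ => zero_le_one) L) hall)) 1
  intro L hL
  by_contra hlt
  rw [Set.mem_ofPred_eq, not_lt] at hlt
  refine hL ⟨by linarith, ?_⟩
  -- Minimality gives h(μ)(1 - ε) ≤ H, and η(1 - ε) ≥ η/2. Hence a cut of value H - η/2 also meets
  -- the ratio bound, which is why the runs are measured against η/2.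
  obtain ⟨-, -, -, hmin⟩ := exists_min_ratio hμ
  have h1 := hmin ε ⟨hε0, hε2⟩
  rw [le_div_iff₀ (by linarith)] at h1
  rw [hε]
  nlinarith

end

end MaxCut

end

/-! ### The main theorem -/

theorem mainTheorem4 (μ η p : ℝ) (hμ : 0 < μ) (hη : 0 < η) :
    (∃ ε₀ ∈ Set.Icc (0 : ℝ) (1 / 2), MaxCut.ratio μ = MaxCut.H ε₀ μ / (1 - ε₀) ∧
      ∀ ε ∈ Set.Icc (0 : ℝ) (1 / 2), MaxCut.ratio μ ≤ MaxCut.H ε μ / (1 - ε)) ∧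
    ∃ (c : MaxCut.Consts) (C : ℝ) (k : ℕ),
      ∀ (V : Type) [Fintype V] [DecidableEq V] [Nonempty V] (G : MaxCut.MultiGraph V),
        (∀ v, 0 < G.deg v) →
          (∀ ε : ℝ, G.maxcut = 1 - ε →
            1 - (Fintype.card V : ℝ) ^ (-p) ≤ (MaxCut.simple' c μ G).prob
              {L | MaxCut.H ε μ - η ≤ G.cutValue L ∧
                (MaxCut.ratio μ - η) * G.maxcut ≤ G.cutValue L}) ∧
          ∀ x ∈ (MaxCut.simple' c μ G).law.support,
            (x.2 : ℝ) ≤ C * (G.maxDeg * (G.vol : ℝ) ^ (2 + μ)) * (1 + Real.log G.vol) ^ k := by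
  refine ⟨MaxCut.exists_min_ratio hμ, ?_⟩
  obtain ⟨r, hr0, hr1, happrox⟩ := MaxCut.exists_perf_approx hμ (by positivity : 0 < η / 8)
  -- The error budget: η/8 for θ and the grid, η/8 for failed searches, and the rest of η/2 as the
  -- margin in Markov's inequality; `ϱ` is the resulting bound for the failure of one run.
  obtain ⟨c, CN, hc, hθ, hγr, hγ, hφ, hϱ⟩ := MaxCut.exists_tuned (θ := r) (r := r) (φ := η / 8)
    (ϱ := (1 / 2 + η / 4) / (1 / 2 + η / 2)) (p := max p 0) hμ hr0 hr1 hr0 (by positivity)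
    (by positivity) (by rw [div_lt_one (by positivity)]; linarith)
  refine ⟨c, MaxCut.gridSize c * (c.b + 1) * (2 * (MaxCut.searchConst c μ CN + c.a + 8) + 5), 6,
    fun V _ _ _ G hdeg => ⟨fun ε hε => ?_, fun x hx => ?_⟩⟩
  · exact MaxCut.prob_simple'_ge hμ hη hc hγr hγ
      (happrox c.θ ⟨hθ ▸ hr0.le, hθ.le⟩) hφ hϱ hdeg hε
  · obtain ⟨hm, hV, hΔ⟩ := MaxCut.two_le_vol hdeg
    exact MaxCut.simple'_cost hμ hc hm hΔ hV hx
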